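/- Let $(M,g)$ be a smooth Riemannian manifold (without boundary, Hausdorff, second countable, not necessarily compact), and let $\mathcal E\to M$ be a smooth real vector bundle of finite rank with a smooth fibre metric $\langle\,,\rangle$ and a smooth connection $\nabla$ compatible with $\langle\,,\rangle$. For $p,q\in\mathbb R$, a smooth section $\tau$ of $\mathcal E$ and a compact set $D\subset M$, the vertical $(p,q)$-energy of $\tau$ over $D$ is $$E^v_{p,q}(\tau;D)=\frac12\int_D \frac{1}{(1+|\tau|^2)^{p}}\sum_i\Big(\langle\nabla_{E_i}\tau,\nabla_{E_i}\tau\rangle+q\,\langle\nabla_{E_i}\tau,\tau\rangle^2\Big)\,\mathrm{vol}(g),$$ where $\{E_i\}$ is an orthonormal tangent frame. A smooth section $\sigma$ is a $(p,q)$-harmonic section of $\mathcal E$ if $\frac{d}{dt}\big|_{t=0}E^v_{p,q}(\sigma_t;D)=0$ for every compact $D$ and every smooth variation $\sigma_t$ $(t\in\mathbb R)$ of $\sigma=\sigma_0$ through sections of $\mathcal E$ with $\sigma_t=\sigma$ outside $D$. For $k>0$, a smooth section $\sigma$ with $|\sigma|=k$ everywhere is a harmonic section of the sphere bundle $S\mathcal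 E(k)=\{e\in\mathcal E:|e|=k\}$ if the same holds with $(p,q)=(0,0)$ for all such variations that satisfy $|\sigma_t|=k$ everywhere for all $t$. Finally $\nabla^*\nabla\sigma=-\operatorname{Trace}\nabla^2\sigma=-\sum_i\big(\nabla_{E_i}\nabla_{E_i}\sigma-\nabla_{\nabla_{E_i}E_i}\sigma\big)$, where the Levi-Civita connection is used on $TM$. Let $\sigma$ be a smooth section of $\mathcal E$ of constant length $k>0$, and let $p,q\in\mathbb R$. (a) If $p\neq 1+1/k^2$, then $\sigma$ is a $(p,q)$-harmonic section of $\mathcal E$ if and only if $\sigma$ is parallel, i.e. $\nabla\sigma=0$. (b) If $p=1+1/k^2$, then $\sigma$ is a $(p,q)$-harmonic section of $\mathcal E$ if and only if $\sigma$ is a harmonic section of $S\mathcal E(k)$. Moreover, for every $p$, $\sigma$ is a harmonic section of $S\mathcal E(k)$ if and only if $\nabla^*\nabla\sigma=\dfrac{1}{k^2}\,|\nabla\sigma|^2\,\sigma$. -/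

import Mathlib

open Bundle Manifold MeasureTheory
open scoped ContDiff

noncomputable section

namespace HarmonicSections

/-! ### The Riemannian base manifold -/

section Base

variable {n : ℕ} {M : Type*} [TopologicalSpace M] [ChartedSpace (EuclideanSpace ℝ (Fin n)) M]

instance finiteDimensional_tangentSpace (x : M) :
    FiniteDimensional ℝ (TangentSpace (𝓡 n) x) :=
  inferInstanceAs (FiniteDimensional ℝ (EuclideanSpace ℝ (Fin n)))

variable [IsManifold (𝓡 n) ∞ M]
  [RiemannianBundle (fun x : M ↦ TangentSpace (𝓡 n) x)]

/-- The coordinate vector field `∂_i` of the preferred chart at `c`, at the point with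
coordinates `y`. -/
def coordVector (c : M) (y : EuclideanSpace ℝ (Fin n)) (i : Fin n) :
    TangentSpace (𝓡 n) ((chartAt (EuclideanSpace ℝ (Fin n)) c).symm y) :=
  mfderiv 𝓘(ℝ, EuclideanSpace ℝ (Fin n)) (𝓡 n)
    (chartAt (EuclideanSpace ℝ (Fin n)) c).symm y (EuclideanSpace.single i (1 : ℝ))

/-- The metric coefficients `g_ij = g(∂_i, ∂_j)` in the preferred chart at `c`, at the point with
coordinates `y`. -/
def metricMatrix (c : M) (y : EuclideanSpace ℝ (Fin n)) : Matrix (Fin n) (Fin n) ℝ :=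
  Matrix.of fun i j ↦ inner ℝ (coordVector c y i) (coordVector c y j)

/-- The measure `√(det g_ij) dy¹ ⋯ dyⁿ` on the domain of the preferred chart at `c`,
extended by zero to `M`. -/
def chartVolume [MeasurableSpace M] (c : M) : Measure M :=
  Measure.map (chartAt (EuclideanSpace ℝ (Fin n)) c).symm
    ((volume.restrict (chartAt (EuclideanSpace ℝ (Fin n)) c).target).withDensity
      fun y ↦ ENNReal.ofReal (Real.sqrt (metricMatrix c y).det))

variable (n M) in
/-- The Riemannian volume measure `vol(g)`: the measure on `M` which is `√(det g_ij) dy¹ ⋯ dyⁿ` in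
every chart. Since the local measures agree on overlaps, it is their least upper bound. -/
def riemannianVolume [MeasurableSpace M] : Measure M :=
  ⨆ c : M, chartVolume (n := n) c

/-- An orthonormal basis `E_1, …, E_n` of the tangent space at `x`. -/
def tangentBasis (x : M) :
    OrthonormalBasis (Fin (Module.finrank ℝ (TangentSpace (𝓡 n) x))) ℝ (TangentSpace (𝓡 n) x) :=
  stdOrthonormalBasis ℝ (TangentSpace (𝓡 n) x)

/-- The Koszul expression for `g(∇_X Y, Z)` at `x`, where `∇` is the Levi-Civita connection. -/
def koszul (X Y Z : Π x : M, TangentSpace (𝓡 n) x) (x : M) : ℝ :=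
  (1 / 2) *
    (mvfderiv (𝓡 n) (fun y ↦ inner ℝ (Y y) (Z y)) x (X x)
      + mvfderiv (𝓡 n) (fun y ↦ inner ℝ (Z y) (X y)) x (Y x)
      - mvfderiv (𝓡 n) (fun y ↦ inner ℝ (X y) (Y y)) x (Z x)
      + inner ℝ (VectorField.mlieBracket (𝓡 n) X Y x) (Z x)
      - inner ℝ (VectorField.mlieBracket (𝓡 n) Y Z x) (X x)
      + inner ℝ (VectorField.mlieBracket (𝓡 n) Z X x) (Y x))

/-- The Levi-Civita derivative `(∇_X Y)(x)` of vector fields differentiable at `x`: the tangent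
vector whose inner product with each `Z` is given by the Koszul formula. Here
`FiberBundle.extend` extends a tangent vector at `x` to a vector field, smooth near `x`. -/
def leviCivita (X Y : Π x : M, TangentSpace (𝓡 n) x) (x : M) : TangentSpace (𝓡 n) x :=
  ∑ i, koszul X Y (FiberBundle.extend (EuclideanSpace ℝ (Fin n)) (tangentBasis x i)) x
    • tangentBasis x i

end Base

/-! ### Sections of a Riemannian vector bundle -/

section Bundle

variable {n : ℕ} {M : Type*} [TopologicalSpace M] [ChartedSpace (EuclideanSpace ℝ (Fin n)) M]
  [IsManifold (𝓡 n) ∞ M]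
  [RiemannianBundle (fun x : M ↦ TangentSpace (𝓡 n) x)]
  {F : Type*} [NormedAddCommGroup F] [NormedSpace ℝ F]
  {V : M → Type*} [TopologicalSpace (TotalSpace F V)]
  [∀ x, NormedAddCommGroup (V x)] [∀ x, InnerProductSpace ℝ (V x)] [FiberBundle F V]
  (nabla : CovariantDerivative (𝓡 n) F V)

/-- `σ` is parallel: `∇σ = 0`. -/
def IsParallel (σ : Π x : M, V x) : Prop :=
  ∀ x, nabla σ x = 0

/-- `|∇σ|²` at `x`. -/
def normSqNabla (σ : Π x : M, V x) (x : M) : ℝ :=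
  ∑ i, ‖nabla σ x (tangentBasis x i)‖ ^ 2

/-- The rough Laplacian `∇*∇σ = - Trace ∇²σ = - ∑ i, (∇_{E_i} ∇_{E_i} σ - ∇_{∇_{E_i} E_i} σ)`. -/
def roughLaplacian (σ : Π x : M, V x) (x : M) : V x :=
  - ∑ i,
    let X : Π y : M, TangentSpace (𝓡 n) y :=
      FiberBundle.extend (EuclideanSpace ℝ (Fin n)) (tangentBasis x i)
    nabla (fun y ↦ nabla σ y (X y)) x (X x) - nabla σ x (leviCivita X X x)

/-- The metric `h_{p,q}` on vertical vectors at a point `e` of the total space, the vertical tangent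
space at `e` being identified with the fibre through `e`:
`w(e)^p (⟨a, b⟩ + q ⟨a, e⟩ ⟨b, e⟩)`, where `w(e) = 1 / (1 + |e|²)`. -/
def verticalMetric (p q : ℝ) {x : M} (e a b : V x) : ℝ :=
  (1 / (1 + ‖e‖ ^ 2)) ^ p * (inner ℝ a b + q * inner ℝ a e * inner ℝ b e)

/-- `|d^vσ|²` at `x`, measured with `h_{p,q}`; the vertical component of `dσ(X)` is `∇_X σ`. -/
def verticalEnergyDensity (p q : ℝ) (σ : Π x : M, V x) (x : M) : ℝ :=
  ∑ i, verticalMetric p q (σ x) (nabla σ x (tangentBasis x i)) (nabla σ x (tangentBasis x i))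

/-- The vertical `(p,q)`-energy of `σ` over `D`: `½ ∫_D |d^vσ|² vol(g)`. -/
def verticalEnergy [MeasurableSpace M] (p q : ℝ) (D : Set M) (σ : Π x : M, V x) : ℝ :=
  (1 / 2) * ∫ x in D, verticalEnergyDensity nabla p q σ x ∂(riemannianVolume n M)

variable (n F) in
/-- `σ` is a smooth section. -/
def IsSmoothSection (σ : Π x : M, V x) : Prop :=
  ContMDiff (𝓡 n) ((𝓡 n).prod 𝓘(ℝ, F)) ∞ fun x ↦ (⟨x, σ x⟩ : TotalSpace F V)

variable (n F) in
/-- `s` is a smooth variation of `σ` through sections of `V` (one section for each time),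
with support in `D`. -/
structure IsSmoothVariation (D : Set M) (σ : Π x : M, V x) (s : ℝ → Π x : M, V x) : Prop where
  smooth : ContMDiff ((𝓡 n).prod 𝓘(ℝ, ℝ)) ((𝓡 n).prod 𝓘(ℝ, F)) ∞
    fun z : M × ℝ ↦ (⟨z.1, s z.2 z.1⟩ : TotalSpace F V)
  zero : s 0 = σ
  eq_of_notMem : ∀ t, ∀ x ∉ D, s t x = σ x

/-- `σ` is a smooth section in the class `S` and is stationary for the vertical `(p,q)`-energy with
respect to smooth compactly supported variations through sections in `S`. -/
def IsStationary [MeasurableSpace M] (p q : ℝ) (S : Set (Π x : M, V x)) (σ : Π x : M, V x) : Prop :=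
  IsSmoothSection n F σ ∧ σ ∈ S ∧
    ∀ (D : Set M) (s : ℝ → Π x : M, V x), IsCompact D → IsSmoothVariation n F D σ s →
      (∀ t, s t ∈ S) → HasDerivAt (fun t ↦ verticalEnergy nabla p q D (s t)) 0 0

/-- `σ` is a `(p,q)`-harmonic section of the vector bundle `V`. -/
def IsPQHarmonicSection [MeasurableSpace M] (p q : ℝ) (σ : Π x : M, V x) : Prop :=
  IsStationary nabla p q Set.univ σ

/-- `σ` is a harmonic section of the sphere bundle of radius `k`: it is stationary for the vertical
energy of the Sasaki metric `h_{0,0}` among sections of constant length `k`. -/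
def IsHarmonicSphereSection [MeasurableSpace M] (k : ℝ) (σ : Π x : M, V x) : Prop :=
  IsStationary nabla 0 0 {τ | ∀ x, ‖τ x‖ = k} σ

end Bundle

end HarmonicSections

end

/-! Everything reduces to one weak equation. Since `|σ| = k` is constant and the connection is
metric, `⟨∇σ, σ⟩ = 0`. Every term containing `q` in the first variation has this factor and drops
out (`energyVariation_eq_of_norm_eq`). For a variation with velocity `v`, the derivative of the
energy is therefore `(1+k²)^(-p) ∫ (⟨∇σ,∇v⟩ - lam |∇σ|² ⟨σ,v⟩)` with `lam = p/(1+k²)`, that is, a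
positive constant times `weakForm nabla lam σ v`.

Every compactly supported `v` is the velocity of `σ + t v`, so `(p,q)`-harmonicity says that
`weakForm` vanishes for this `lam` and all `v` (`isPQHarmonicSection_iff_weakForm`). On the sphere
bundle the velocities are exactly the `v ⟂ σ`, realised by normalising `σ + t v`, and `lam = 0`.
Replacing an arbitrary `v` by its projection orthogonal to `σ`, and using `⟨∇σ,∇(fσ)⟩ = f |∇σ|²`,
turns this into the weak equation with `lam = 1/k²` for all `v`
(`isHarmonicSphereSection_iff_weakForm`).

Testing with `v = χσ`, for a bump function `χ`, gives `(1 - lam k²) ∫ χ |∇σ|² = 0`. Hence `σ` is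
parallel unless `lam k² = 1`, and for `lam = p/(1+k²)` that exception is `p = 1 + 1/k²`, where the
two weak equations coincide. The pointwise equation follows from integration by parts and the
fundamental lemma of the calculus of variations.

The bulk of the proof is the supporting analysis: differentiation under the integral for smooth
families of sections, the behaviour of `riemannianVolume` in charts, and `∫ ⟨∇σ,∇v⟩ = ∫ ⟨∇*∇σ, v⟩`.
For the last, `roughLaplacian` is compared with the divergence expression `coordLaplacian`: a direct
computation at the centre of a chart, then uniqueness of the weak adjoint on overlaps. -/

noncomputable section

namespace HarmonicSections

open Set Filter Topology

set_option linter.unusedSectionVars false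

local notation "𝔼" n:max => EuclideanSpace ℝ (Fin n)

/-! ### Coordinate vector fields of a chart. -/

section Frame

variable {n : ℕ} {M : Type*} [TopologicalSpace M] [ChartedSpace (EuclideanSpace ℝ (Fin n)) M]
  [IsManifold (𝓡 n) ∞ M]

/-- The vector field on the domain of the preferred chart at `c` with constant components `w`. -/
def chartFrame (c : M) (w : EuclideanSpace ℝ (Fin n)) (x : M) : TangentSpace (𝓡 n) x :=
  (trivializationAt (EuclideanSpace ℝ (Fin n)) (TangentSpace (𝓡 n)) c).symm x w

lemma chartFrame_eq_symmL {c x : M} (w : EuclideanSpace ℝ (Fin n))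
    (hx : x ∈ (chartAt (EuclideanSpace ℝ (Fin n)) c).source) :
    chartFrame c w x =
      (trivializationAt (EuclideanSpace ℝ (Fin n)) (TangentSpace (𝓡 n)) c).symmL ℝ x w :=
  (Trivialization.symmL_apply (R := ℝ)
    (trivializationAt (EuclideanSpace ℝ (Fin n)) (TangentSpace (𝓡 n) (M := M)) c)
    (b := x) (by simpa using hx) w).symm

lemma trivializationAt_chartFrame {c x : M} (w : EuclideanSpace ℝ (Fin n))
    (hx : x ∈ (chartAt (EuclideanSpace ℝ (Fin n)) c).source) :
    (trivializationAt (EuclideanSpace ℝ (Fin n)) (TangentSpace (𝓡 n)) c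
      ⟨x, chartFrame c w x⟩).2 = w := by
  have := (trivializationAt (EuclideanSpace ℝ (Fin n)) (TangentSpace (𝓡 n) (M := M)) c).apply_mk_symm
    (b := x) (by simpa using hx) w
  exact congrArg Prod.snd this

lemma contMDiffAt_chartFrame {c x : M} (w : EuclideanSpace ℝ (Fin n))
    (hx : x ∈ (chartAt (EuclideanSpace ℝ (Fin n)) c).source) :
    ContMDiffAt (𝓡 n) ((𝓡 n).prod 𝓘(ℝ, EuclideanSpace ℝ (Fin n))) ∞
      (fun y ↦ (⟨y, chartFrame c w y⟩ :
        TotalSpace (EuclideanSpace ℝ (Fin n)) (TangentSpace (𝓡 n) (M := M)))) x := by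
  have ht : x ∈ (trivializationAt (EuclideanSpace ℝ (Fin n)) (TangentSpace (𝓡 n) (M := M)) c).baseSet
    := by simpa using hx
  rw [← contMDiffWithinAt_univ, Bundle.Trivialization.contMDiffWithinAt_section univ ht,
    contMDiffWithinAt_univ]
  refine (contMDiffAt_const (c := w)).congr_of_eventuallyEq ?_
  filter_upwards [(chartAt (EuclideanSpace ℝ (Fin n)) c).open_source.mem_nhds hx] with y hy
  exact trivializationAt_chartFrame w hy

lemma mdifferentiableAt_chart_symm {c : M} {y : EuclideanSpace ℝ (Fin n)}
    (hy : y ∈ (chartAt (EuclideanSpace ℝ (Fin n)) c).target) :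
    MDifferentiableAt 𝓘(ℝ, EuclideanSpace ℝ (Fin n)) (𝓡 n)
      (chartAt (EuclideanSpace ℝ (Fin n)) c).symm y :=
  mdifferentiableAt_atlas_symm (I := 𝓡 n) (chart_mem_atlas _ c) hy

/-- Links two descriptions of the coordinate fields: the trivialization gives their smoothness, the
derivative of the inverse chart makes the chain rule available. -/
lemma chartFrame_eq_mfderiv {c x : M} (w : EuclideanSpace ℝ (Fin n))
    (hx : x ∈ (chartAt (EuclideanSpace ℝ (Fin n)) c).source) :
    chartFrame c w x = (mfderiv 𝓘(ℝ, EuclideanSpace ℝ (Fin n)) (𝓡 n)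
      (chartAt (EuclideanSpace ℝ (Fin n)) c).symm (chartAt (EuclideanSpace ℝ (Fin n)) c x) w :
        EuclideanSpace ℝ (Fin n)) := by
  rw [chartFrame_eq_symmL w hx, TangentBundle.symmL_trivializationAt hx]
  rw [ModelWithCorners.range_eq_univ, mfderivWithin_univ]
  have h : ⇑(extChartAt (𝓡 n) c).symm = ⇑(chartAt (EuclideanSpace ℝ (Fin n)) c).symm := by
    ext; simp
  have h' : extChartAt (𝓡 n) c x = chartAt (EuclideanSpace ℝ (Fin n)) c x := by simp
  rw [h, h']
  rfl

lemma coordVector_eq_chartFrame (c : M) {y : EuclideanSpace ℝ (Fin n)}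
    (hy : y ∈ (chartAt (EuclideanSpace ℝ (Fin n)) c).target) (i : Fin n) :
    coordVector c y i = chartFrame c (EuclideanSpace.single i 1)
      ((chartAt (EuclideanSpace ℝ (Fin n)) c).symm y) := by
  rw [chartFrame_eq_mfderiv _ ((chartAt (EuclideanSpace ℝ (Fin n)) c).map_target hy), coordVector]
  have h2 : chartAt (EuclideanSpace ℝ (Fin n)) c ((chartAt (EuclideanSpace ℝ (Fin n)) c).symm y)
    = y := (chartAt (EuclideanSpace ℝ (Fin n)) c).right_inv hy
  rw [h2]

lemma mvfderiv_chartFrame {G : Type*} [NormedAddCommGroup G] [NormedSpace ℝ G] {c x : M}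
    (w : EuclideanSpace ℝ (Fin n)) {f : M → G} (hf : MDifferentiableAt (𝓡 n) 𝓘(ℝ, G) f x)
    (hx : x ∈ (chartAt (EuclideanSpace ℝ (Fin n)) c).source) :
    mvfderiv (𝓡 n) f x (chartFrame c w x) =
      fderiv ℝ (f ∘ (chartAt (EuclideanSpace ℝ (Fin n)) c).symm)
        (chartAt (EuclideanSpace ℝ (Fin n)) c x) w := by
  rw [chartFrame_eq_mfderiv _ hx]
  set φ := chartAt (EuclideanSpace ℝ (Fin n)) c
  have hxe : φ.symm (φ x) = x := φ.left_inv hx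
  have h1 := mdifferentiableAt_chart_symm (c := c) (φ.map_source hx)
  have := mfderiv_comp_of_eq (x := φ x) (y := x) hf h1 hxe
  rw [mfderiv_eq_fderiv] at this
  have h4 := DFunLike.congr_fun this w
  refine Eq.trans ?_ h4.symm
  have : (mfderiv (𝓡 n) 𝓘(ℝ, G) f (φ.symm (φ x)) : EuclideanSpace ℝ (Fin n) →L[ℝ] G)
     = mfderiv (𝓡 n) 𝓘(ℝ, G) f x := by rw [hxe]
  exact (DFunLike.congr_fun this (mfderiv 𝓘(ℝ, EuclideanSpace ℝ (Fin n)) (𝓡 n) φ.symm (φ x) w)).symm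

end Frame

/-! ### Smooth dependence of determinants and inverse matrices. -/

section MatrixSmooth

variable {E H M : Type*} [NormedAddCommGroup E] [NormedSpace ℝ E] [TopologicalSpace H]
  {I : ModelWithCorners ℝ E H} [TopologicalSpace M] [ChartedSpace H M] {ι : Type*} [Fintype ι]
  [DecidableEq ι] {A : M → Matrix ι ι ℝ} {x : M} {m : ℕ∞ω}

lemma contMDiffAt_det (hA : ∀ i j, ContMDiffAt I 𝓘(ℝ, ℝ) m (fun y ↦ A y i j) x) :
    ContMDiffAt I 𝓘(ℝ, ℝ) m (fun y ↦ (A y).det) x := by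
  simp only [Matrix.det_apply']
  exact ContMDiffAt.sum fun s _ ↦ contMDiffAt_const.mul (contMDiffAt_finsetProd fun i _ ↦ hA _ _)

lemma contMDiffAt_matrix_inv (hA : ∀ i j, ContMDiffAt I 𝓘(ℝ, ℝ) m (fun y ↦ A y i j) x)
    (hdet : (A x).det ≠ 0) (i j : ι) :
    ContMDiffAt I 𝓘(ℝ, ℝ) m (fun y ↦ (A y)⁻¹ i j) x := by
  simp only [Matrix.inv_def, Matrix.smul_apply, Ring.inverse_eq_inv', smul_eq_mul]
  refine ((contMDiffAt_det hA).inv₀ hdet).mul ?_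
  simp only [Matrix.adjugate_apply]
  refine contMDiffAt_det fun a b ↦ ?_
  by_cases h : a = j
  · subst h; simp only [Matrix.updateRow_self]; exact contMDiffAt_const
  · simpa only [Matrix.updateRow_ne h] using hA a b

end MatrixSmooth

/-! ### Traces and Gram matrices in arbitrary bases. -/

section Algebra

variable {W : Type*} [NormedAddCommGroup W] [InnerProductSpace ℝ W] {ι κ : Type*}
  [Fintype ι] [Fintype κ] [DecidableEq ι]

/-- The chosen `tangentBasis x` need not depend continuously on `x`. This identity moves traces to
coordinate frames, where smoothness is visible. -/
lemma sum_orthonormalBasis_eq_sum_gram_inv (e : OrthonormalBasis κ ℝ W) (f : Module.Basis ι ℝ W)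
    (B : W →ₗ[ℝ] W →ₗ[ℝ] ℝ) :
    ∑ i, B (e i) (e i) = ∑ a, ∑ b, (Matrix.gram ℝ f)⁻¹ a b * B (f a) (f b) := by
  set Q : Matrix κ ι ℝ := Matrix.of fun i a ↦ f.repr (e i) a
  -- `Q` holds the coordinates of `e` in the basis `f`. Expanding `f c` in the orthonormal basis `e`
  -- shows that `Qᵀ Q` inverts the Gram matrix.
  have hQ : (Q.transpose * Q) * Matrix.gram ℝ f = 1 := by
    ext a c
    rw [Matrix.mul_assoc, Matrix.mul_apply]
    have h1 : ∀ i, (Q * Matrix.gram ℝ f) i c = inner ℝ (e i) (f c) := by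
      intro i
      conv_rhs => rw [← f.sum_repr (e i)]
      simp only [Matrix.mul_apply, Q, Matrix.gram_apply, Matrix.of_apply, sum_inner,
        real_inner_smul_left]
    simp only [h1, Matrix.transpose_apply, Q, Matrix.of_apply]
    have h2 := congrArg (fun v ↦ f.repr v a) (e.sum_repr' (f c))
    simp only [map_sum, map_smul, Finsupp.coe_finsetSum, Finset.sum_apply, Finsupp.smul_apply,
      smul_eq_mul, f.repr_self] at h2
    rw [Matrix.one_apply, Finset.sum_congr rfl fun i _ ↦ mul_comm _ _, h2,
      Finsupp.single_apply]
    simp [eq_comm]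
  rw [Matrix.inv_eq_left_inv hQ]
  have h : ∀ i, B (e i) (e i) = ∑ a, ∑ b, Q i a * Q i b * B (f a) (f b) := by
    intro i
    conv_lhs => rw [← f.sum_repr (e i)]
    simp only [map_sum, LinearMap.sum_apply, map_smul, LinearMap.smul_apply, smul_eq_mul, Q,
      Matrix.of_apply]
    rw [Finset.sum_comm]
    simp only [Finset.mul_sum]
    refine Finset.sum_congr rfl fun a _ ↦ Finset.sum_congr rfl fun b _ ↦ ?_
    ring
  simp only [h, Matrix.mul_apply, Matrix.transpose_apply, Finset.sum_mul]
  rw [Finset.sum_comm]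
  refine Finset.sum_congr rfl fun a _ ↦ Finset.sum_comm

/-- A Gram matrix changes by the congruence `Pᵀ G P`. This serves both for a change of constant
frame in one chart and for a change of chart. -/
lemma gram_det_eq_of_basis (f g : Module.Basis ι ℝ W) :
    (Matrix.gram ℝ f).det = (g.toMatrix f).det ^ 2 * (Matrix.gram ℝ g).det := by
  have : Matrix.gram ℝ f = (g.toMatrix f).transpose * Matrix.gram ℝ g * g.toMatrix f := by
    ext a b
    conv_lhs => rw [Matrix.gram_apply, ← g.sum_toMatrix_smul_self f a,
      ← g.sum_toMatrix_smul_self f b]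
    simp only [sum_inner, inner_sum, inner_smul_left, inner_smul_right, Matrix.mul_apply,
      Matrix.transpose_apply, Matrix.gram_apply, Finset.sum_mul]
    simp only [Finset.mul_sum]
    refine Finset.sum_congr rfl fun i _ ↦ Finset.sum_congr rfl fun j _ ↦ ?_
    simp only [conj_trivial]
    ring
  rw [this, Matrix.det_mul, Matrix.det_mul, Matrix.det_transpose]
  ring

lemma gram_det_pos (f : Module.Basis ι ℝ W) : 0 < (Matrix.gram ℝ f).det :=
  (Matrix.posDef_gram_of_linearIndependent f.linearIndependent).det_pos

end Algebra

/-! ### The metric and its density in a coordinate frame. -/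

section FrameGram

variable {n : ℕ} {M : Type*} [TopologicalSpace M] [ChartedSpace (EuclideanSpace ℝ (Fin n)) M]
  [IsManifold (𝓡 n) ∞ M]

/-- The linear isomorphism from the model space to the tangent space at a point of the domain of
the preferred chart at `c`. -/
def chartFrameEquiv (c : M) {x : M} (hx : x ∈ (chartAt (𝔼 n) c).source) :
    (𝔼 n) ≃L[ℝ] TangentSpace (𝓡 n) x :=
  ((trivializationAt (𝔼 n) (TangentSpace (𝓡 n) (M := M)) c).continuousLinearEquivAt ℝ x
    (by simpa using hx)).symm

lemma chartFrameEquiv_apply {c x : M} (hx : x ∈ (chartAt (𝔼 n) c).source) (w : 𝔼 n) :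
    chartFrameEquiv c hx w = chartFrame c w x := by
  rfl

/-- The frame of the tangent space at `x` with constant components in the chart at `c`. -/
def chartBasis {c x : M} (hx : x ∈ (chartAt (𝔼 n) c).source) (b : Module.Basis (Fin n) ℝ (𝔼 n)) :
    Module.Basis (Fin n) ℝ (TangentSpace (𝓡 n) x) :=
  b.map (chartFrameEquiv c hx).toLinearEquiv

lemma chartBasis_apply {c x : M} (hx : x ∈ (chartAt (𝔼 n) c).source) (b : Module.Basis (Fin n) ℝ (𝔼 n))
    (i : Fin n) : chartBasis hx b i = chartFrame c (b i) x := by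
  simp only [chartBasis, Module.Basis.map_apply]
  exact chartFrameEquiv_apply hx _

lemma coe_chartBasis {c x : M} (hx : x ∈ (chartAt (𝔼 n) c).source) (b : Module.Basis (Fin n) ℝ (𝔼 n)) :
    ⇑(chartBasis hx b) = fun i ↦ chartFrame c (b i) x :=
  funext fun i ↦ chartBasis_apply hx b i

variable [RiemannianBundle (fun x : M ↦ TangentSpace (𝓡 n) x)]

/-- The Gram matrix at `x` of the vector fields with constant components `b i` in the chart
at `c`. -/
def frameGram (c : M) (b : Fin n → (𝔼 n)) (x : M) : Matrix (Fin n) (Fin n) ℝ :=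
  Matrix.gram ℝ fun i ↦ chartFrame c (b i) x

/-- The volume density with respect to the frame with constant components `b i`. -/
def frameDensity (c : M) (b : Fin n → (𝔼 n)) (x : M) : ℝ :=
  Real.sqrt (frameGram c b x).det

lemma frameGram_det_pos {c x : M} (hx : x ∈ (chartAt (𝔼 n) c).source) (b : Module.Basis (Fin n) ℝ (𝔼 n)) :
    0 < (frameGram c b x).det := by
  have := gram_det_pos (chartBasis hx b)
  rwa [coe_chartBasis] at this

lemma frameDensity_pos {c x : M} (hx : x ∈ (chartAt (𝔼 n) c).source) (b : Module.Basis (Fin n) ℝ (𝔼 n)) :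
    0 < frameDensity c b x :=
  Real.sqrt_pos.2 (frameGram_det_pos hx b)

lemma frameDensity_eq_mul {c x : M} (hx : x ∈ (chartAt (𝔼 n) c).source)
    (b b' : Module.Basis (Fin n) ℝ (𝔼 n)) :
    frameDensity c b x = |(b'.toMatrix b).det| * frameDensity c b' x := by
  have h := gram_det_eq_of_basis (chartBasis hx b) (chartBasis hx b')
  have h2 : (chartBasis hx b').toMatrix (chartBasis hx b) = b'.toMatrix b := by
    ext i j
    simp [Module.Basis.toMatrix_apply, chartBasis]
  rw [h2, coe_chartBasis, coe_chartBasis] at h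
  unfold frameDensity frameGram
  rw [h, Real.sqrt_mul (sq_nonneg _), Real.sqrt_sq_eq_abs]

lemma sum_tangentBasis_eq {c x : M} (hx : x ∈ (chartAt (𝔼 n) c).source)
    (b : Module.Basis (Fin n) ℝ (𝔼 n))
    (B : TangentSpace (𝓡 n) x →ₗ[ℝ] TangentSpace (𝓡 n) x →ₗ[ℝ] ℝ) :
    ∑ i, B (tangentBasis x i) (tangentBasis x i) =
      ∑ i, ∑ j, (frameGram c b x)⁻¹ i j * B (chartFrame c (b i) x) (chartFrame c (b j) x) := by
  rw [sum_orthonormalBasis_eq_sum_gram_inv (tangentBasis x) (chartBasis hx b) B]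
  simp only [chartBasis_apply, frameGram, coe_chartBasis]

lemma metricMatrix_eq_frameGram (c : M) {y : 𝔼 n} (hy : y ∈ (chartAt (𝔼 n) c).target) :
    metricMatrix c y = frameGram c (fun i ↦ EuclideanSpace.single i 1) ((chartAt (𝔼 n) c).symm y) := by
  ext i j
  simp only [metricMatrix, frameGram, Matrix.gram_apply, Matrix.of_apply,
    coordVector_eq_chartFrame c hy]

variable [IsContMDiffRiemannianBundle (𝓡 n) ∞ (𝔼 n) (fun x : M ↦ TangentSpace (𝓡 n) x)]

lemma contMDiffAt_frameGram {c x : M} (hx : x ∈ (chartAt (𝔼 n) c).source) (b : Fin n → (𝔼 n))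
    (i j : Fin n) : ContMDiffAt (𝓡 n) 𝓘(ℝ, ℝ) ∞ (fun y ↦ frameGram c b y i j) x := by
  simp only [frameGram, Matrix.gram_apply]
  exact (contMDiffAt_chartFrame (b i) hx).inner_bundle (contMDiffAt_chartFrame (b j) hx)

lemma contMDiffAt_frameGram_inv {c x : M} (hx : x ∈ (chartAt (𝔼 n) c).source)
    (b : Module.Basis (Fin n) ℝ (𝔼 n)) (i j : Fin n) :
    ContMDiffAt (𝓡 n) 𝓘(ℝ, ℝ) ∞ (fun y ↦ (frameGram c b y)⁻¹ i j) x :=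
  contMDiffAt_matrix_inv (contMDiffAt_frameGram hx b) (frameGram_det_pos hx b).ne' i j

lemma contMDiffAt_frameDensity {c x : M} (hx : x ∈ (chartAt (𝔼 n) c).source)
    (b : Module.Basis (Fin n) ℝ (𝔼 n)) :
    ContMDiffAt (𝓡 n) 𝓘(ℝ, ℝ) ∞ (frameDensity c b) x :=
  (Real.contDiffAt_sqrt (frameGram_det_pos hx b).ne').contMDiffAt.comp x
    (contMDiffAt_det (contMDiffAt_frameGram hx b))

end FrameGram

/-! ### Coordinate frames orthonormal at the centre of the chart. -/

section NormalBasis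

variable {n : ℕ} {M : Type*} [TopologicalSpace M] [ChartedSpace (EuclideanSpace ℝ (Fin n)) M]
  [IsManifold (𝓡 n) ∞ M]

lemma finrank_tangentSpace_eq (c : M) : Module.finrank ℝ (TangentSpace (𝓡 n) c) = n := by
  rw [(chartFrameEquiv c (mem_chart_source (𝔼 n) c)).toLinearEquiv.finrank_eq.symm]
  simp

variable [RiemannianBundle (fun x : M ↦ TangentSpace (𝓡 n) x)]

/-- The components, in the chart at `c`, of the orthonormal basis of the tangent space at `c`. -/
def normalBasis (c : M) : Module.Basis (Fin n) ℝ (𝔼 n) :=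
  ((tangentBasis c).toBasis.map (chartFrameEquiv c (mem_chart_source (𝔼 n) c)).symm.toLinearEquiv).reindex
    (finCongr (finrank_tangentSpace_eq c))

/-- The extensions occurring in `roughLaplacian` and `leviCivita` are fields with constant
components in the chart at `c`, so coordinate computations apply to them. -/
lemma extend_tangentBasis (c : M) (i : Fin (Module.finrank ℝ (TangentSpace (𝓡 n) c))) :
    FiberBundle.extend (𝔼 n) (tangentBasis c i) =
      chartFrame c (normalBasis c (finCongr (finrank_tangentSpace_eq c) i)) := by
  simp [normalBasis]
  rfl

lemma chartFrame_normalBasis_self (c : M) (i : Fin (Module.finrank ℝ (TangentSpace (𝓡 n) c))) :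
    chartFrame c (normalBasis c (finCongr (finrank_tangentSpace_eq c) i)) c = tangentBasis c i := by
  rw [← extend_tangentBasis, FiberBundle.extend_apply_self]

/-- The normalisation is to zeroth order only: the first derivatives of the Gram matrix at `c` need
not vanish, and they produce the Christoffel terms below. -/
lemma frameGram_normalBasis_self (c : M) : frameGram c (normalBasis (n := n) c) c = 1 := by
  ext i j
  obtain ⟨i, rfl⟩ := (finCongr (finrank_tangentSpace_eq (n := n) c)).surjective i
  obtain ⟨j, rfl⟩ := (finCongr (finrank_tangentSpace_eq (n := n) c)).surjective j
  rw [frameGram, Matrix.gram_apply, chartFrame_normalBasis_self, chartFrame_normalBasis_self,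
    (tangentBasis c).inner_eq_ite, Matrix.one_apply]
  simp

end NormalBasis

/-! ### Space and time derivatives of functions on `M × ℝ`. -/

section PartialDerivatives

variable {n : ℕ} {M : Type*} [TopologicalSpace M] [ChartedSpace (𝔼 n) M] [IsManifold (𝓡 n) ∞ M]
  {f : M × ℝ → ℝ} {c x : M} {t : ℝ}

/-- The coordinate expression in the chart at `c` of a function depending on time. -/
def timeChart (c : M) (f : M × ℝ → ℝ) (p : 𝔼 n × ℝ) : ℝ :=
  f ((chartAt (𝔼 n) c).symm p.1, p.2)

lemma timeChart_apply_chart (f : M × ℝ → ℝ) (hx : x ∈ (chartAt (𝔼 n) c).source) (s : ℝ) :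
    timeChart c f (chartAt (𝔼 n) c x, s) = f (x, s) := by
  simp [timeChart, (chartAt (𝔼 n) c).left_inv hx]

lemma contDiffAt_timeChart {m : ℕ∞ω} (hm : m ≤ ∞)
    (hf : ContMDiffAt ((𝓡 n).prod 𝓘(ℝ, ℝ)) 𝓘(ℝ, ℝ) m f (x, t))
    (hx : x ∈ (chartAt (𝔼 n) c).source) :
    ContDiffAt ℝ m (timeChart c f) (chartAt (𝔼 n) c x, t) := by
  rw [← contMDiffAt_iff_contDiffAt]
  have h1 : ContMDiffAt 𝓘(ℝ, 𝔼 n × ℝ) (𝓡 n) m (fun p : 𝔼 n × ℝ ↦ (chartAt (𝔼 n) c).symm p.1)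
      (chartAt (𝔼 n) c x, t) :=
    ContMDiffAt.comp (I' := 𝓘(ℝ, 𝔼 n)) _
      (((contMDiffOn_chart_symm (I := 𝓡 n) (n := ∞) (x := c)).contMDiffAt
        ((chartAt (𝔼 n) c).open_target.mem_nhds ((chartAt (𝔼 n) c).map_source hx))).of_le hm)
      contDiffAt_fst.contMDiffAt
  have h2 : ContMDiffAt 𝓘(ℝ, 𝔼 n × ℝ) 𝓘(ℝ, ℝ) m (fun p : 𝔼 n × ℝ ↦ p.2)
      (chartAt (𝔼 n) c x, t) := contDiffAt_snd.contMDiffAt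
  refine ContMDiffAt.comp_of_eq (I' := (𝓡 n).prod 𝓘(ℝ, ℝ)) (g := f) (y := (x, t)) hf
    (h1.prodMk h2) ?_
  simp [(chartAt (𝔼 n) c).left_inv hx]

lemma two_le_infty : (2 : ℕ∞ω) ≤ ∞ := ENat.LEInfty.out

lemma eventually_contMDiffAt_one (hf : ContMDiffAt ((𝓡 n).prod 𝓘(ℝ, ℝ)) 𝓘(ℝ, ℝ) ∞ f (x, t)) :
    ∀ᶠ z in 𝓝 (x, t), ContMDiffAt ((𝓡 n).prod 𝓘(ℝ, ℝ)) 𝓘(ℝ, ℝ) 1 f z :=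
  (contMDiffAt_iff_contMDiffAt_nhds (by simp)).1 (hf.of_le (by norm_num : (1 : ℕ∞ω) ≤ ∞))

lemma hasDerivAt_time (hf : ContMDiffAt ((𝓡 n).prod 𝓘(ℝ, ℝ)) 𝓘(ℝ, ℝ) 1 f (x, t))
    (hx : x ∈ (chartAt (𝔼 n) c).source) :
    HasDerivAt (fun s ↦ f (x, s)) (fderiv ℝ (timeChart c f) (chartAt (𝔼 n) c x, t) (0, 1)) t := by
  have h := ((contDiffAt_timeChart (by norm_num) hf hx).differentiableAt one_ne_zero).hasFDerivAt
  have h2 := h.comp_hasDerivAt t ((hasDerivAt_const t (chartAt (𝔼 n) c x)).prodMk (hasDerivAt_id t))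
  refine h2.congr_of_eventuallyEq (Eventually.of_forall fun s ↦ ?_)
  exact (timeChart_apply_chart f hx s).symm

lemma mvfderiv_space (hf : ContMDiffAt ((𝓡 n).prod 𝓘(ℝ, ℝ)) 𝓘(ℝ, ℝ) 1 f (x, t))
    (hx : x ∈ (chartAt (𝔼 n) c).source) (w : 𝔼 n) :
    mvfderiv (𝓡 n) (fun y ↦ f (y, t)) x (chartFrame c w x) =
      fderiv ℝ (timeChart c f) (chartAt (𝔼 n) c x, t) (w, 0) := by
  have hd : MDifferentiableAt (𝓡 n) 𝓘(ℝ, ℝ) (fun y ↦ f (y, t)) x := by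
    refine ContMDiffAt.mdifferentiableAt (n := 1) ?_ one_ne_zero
    exact ContMDiffAt.comp (I' := (𝓡 n).prod 𝓘(ℝ, ℝ)) (g := f) x hf
      (contMDiffAt_id.prodMk contMDiffAt_const)
  rw [mvfderiv_chartFrame w hd hx]
  have h := ((contDiffAt_timeChart (by norm_num) hf hx).differentiableAt one_ne_zero).hasFDerivAt
  have h2 := h.comp (chartAt (𝔼 n) c x)
    ((hasFDerivAt_id (𝕜 := ℝ) (chartAt (𝔼 n) c x)).prodMk (hasFDerivAt_const t _))
  have h3 : (fun y ↦ f (y, t)) ∘ (chartAt (𝔼 n) c).symm =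
      timeChart c f ∘ fun y ↦ (id y, t) := rfl
  rw [h3, h2.fderiv]
  simp

lemma contMDiffAt_fderiv_timeChart (hf : ContMDiffAt ((𝓡 n).prod 𝓘(ℝ, ℝ)) 𝓘(ℝ, ℝ) ∞ f (x, t))
    (hx : x ∈ (chartAt (𝔼 n) c).source) (w : 𝔼 n × ℝ) :
    ContMDiffAt ((𝓡 n).prod 𝓘(ℝ, ℝ)) 𝓘(ℝ, ℝ) ∞
      (fun z : M × ℝ ↦ fderiv ℝ (timeChart c f) (chartAt (𝔼 n) c z.1, z.2) w) (x, t) := by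
  have h := (contDiffAt_timeChart le_rfl hf hx).fderiv_right (m := ∞) (by simp)
  have h1 : ContMDiffAt ((𝓡 n).prod 𝓘(ℝ, ℝ)) 𝓘(ℝ, 𝔼 n × ℝ) ∞
      (fun z : M × ℝ ↦ (chartAt (𝔼 n) c z.1, z.2)) (x, t) := by
    refine ContMDiffAt.prodMk_space ?_ contMDiffAt_snd
    exact ContMDiffAt.comp (I' := 𝓡 n) (x, t) ((contMDiffOn_chart (I := 𝓡 n) (x := c)).contMDiffAt
      ((chartAt (𝔼 n) c).open_source.mem_nhds hx)) contMDiffAt_fst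
  exact ContMDiffAt.comp (I' := 𝓘(ℝ, 𝔼 n × ℝ)) (x, t)
    (g := fun p ↦ fderiv ℝ (timeChart c f) p w)
    (h.clm_apply contDiffAt_const).contMDiffAt h1

lemma eventually_fst_mem_source (hx : x ∈ (chartAt (𝔼 n) c).source) :
    ∀ᶠ z : M × ℝ in 𝓝 (x, t), z.1 ∈ (chartAt (𝔼 n) c).source :=
  continuousAt_fst.eventually ((chartAt (𝔼 n) c).open_source.mem_nhds hx)

lemma contMDiffAt_deriv_time (hf : ContMDiffAt ((𝓡 n).prod 𝓘(ℝ, ℝ)) 𝓘(ℝ, ℝ) ∞ f (x, t)) :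
    ContMDiffAt ((𝓡 n).prod 𝓘(ℝ, ℝ)) 𝓘(ℝ, ℝ) ∞
      (fun z : M × ℝ ↦ deriv (fun s ↦ f (z.1, s)) z.2) (x, t) := by
  refine (contMDiffAt_fderiv_timeChart hf (mem_chart_source (𝔼 n) x) (0, 1)).congr_of_eventuallyEq ?_
  filter_upwards [eventually_contMDiffAt_one hf,
    eventually_fst_mem_source (mem_chart_source (𝔼 n) x)] with z hz hz'
  exact (hasDerivAt_time hz hz').deriv

lemma contMDiffAt_mvfderiv_space (hf : ContMDiffAt ((𝓡 n).prod 𝓘(ℝ, ℝ)) 𝓘(ℝ, ℝ) ∞ f (x, t))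
    (hx : x ∈ (chartAt (𝔼 n) c).source) (w : 𝔼 n) :
    ContMDiffAt ((𝓡 n).prod 𝓘(ℝ, ℝ)) 𝓘(ℝ, ℝ) ∞
      (fun z : M × ℝ ↦ mvfderiv (𝓡 n) (fun y ↦ f (y, z.2)) z.1 (chartFrame c w z.1)) (x, t) := by
  refine (contMDiffAt_fderiv_timeChart hf hx (w, 0)).congr_of_eventuallyEq ?_
  filter_upwards [eventually_contMDiffAt_one hf, eventually_fst_mem_source hx] with z hz hz'
  exact mvfderiv_space hz hz' w

/-- Read in the chart, both mixed derivatives are values of the second derivative of `timeChart c f`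
on `(w, 0)` and `(0, 1)`, which is symmetric. -/
lemma hasDerivAt_mvfderiv_space (hf : ContMDiffAt ((𝓡 n).prod 𝓘(ℝ, ℝ)) 𝓘(ℝ, ℝ) ∞ f (x, t))
    (hx : x ∈ (chartAt (𝔼 n) c).source) (w : 𝔼 n) :
    HasDerivAt (fun s ↦ mvfderiv (𝓡 n) (fun y ↦ f (y, s)) x (chartFrame c w x))
      (mvfderiv (𝓡 n) (fun y ↦ deriv (fun s ↦ f (y, s)) t) x (chartFrame c w x)) t := by
  set φ := chartAt (𝔼 n) c with hφ
  have hc := contDiffAt_timeChart le_rfl hf hx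
  have hD := ((hc.fderiv_right (m := 1) (one_add_one_eq_two.trans_le two_le_infty)).differentiableAt one_ne_zero).hasFDerivAt
  have hsymm : IsSymmSndFDerivAt ℝ (timeChart c f) (φ x, t) :=
    hc.isSymmSndFDerivAt (by simpa using two_le_infty)
  have h1 : HasDerivAt (fun s ↦ fderiv ℝ (timeChart c f) (φ x, s) (w, 0))
      (fderiv ℝ (fderiv ℝ (timeChart c f)) (φ x, t) (0, 1) (w, 0)) t := by
    have := hD.comp_hasDerivAt t ((hasDerivAt_const t (φ x)).prodMk (hasDerivAt_id t))
    have h := this.clm_apply (hasDerivAt_const t ((w, 0) : 𝔼 n × ℝ))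
    simpa using h
  have h2 : mvfderiv (𝓡 n) (fun y ↦ deriv (fun s ↦ f (y, s)) t) x (chartFrame c w x) =
      fderiv ℝ (fderiv ℝ (timeChart c f)) (φ x, t) (0, 1) (w, 0) := by
    have hd : MDifferentiableAt (𝓡 n) 𝓘(ℝ, ℝ) (fun y ↦ deriv (fun s ↦ f (y, s)) t) x := by
      refine ContMDiffAt.mdifferentiableAt (n := 1) ?_ one_ne_zero
      exact ContMDiffAt.comp (I' := (𝓡 n).prod 𝓘(ℝ, ℝ)) (g := fun z : M × ℝ ↦
        deriv (fun s ↦ f (z.1, s)) z.2) x ((contMDiffAt_deriv_time hf).of_le (by norm_num))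
        (contMDiffAt_id.prodMk contMDiffAt_const)
    rw [mvfderiv_chartFrame w hd hx]
    have he : (fun y ↦ deriv (fun s ↦ f (y, s)) t) ∘ φ.symm =ᶠ[𝓝 (φ x)]
        fun p ↦ fderiv ℝ (timeChart c f) (p, t) (0, 1) := by
      have hcont : ContinuousAt (fun p ↦ (φ.symm p, t)) (φ x) :=
        (φ.continuousAt_symm (φ.map_source hx)).prodMk continuousAt_const
      have hev := hcont.eventually (p := fun z ↦
        ContMDiffAt ((𝓡 n).prod 𝓘(ℝ, ℝ)) 𝓘(ℝ, ℝ) 1 f z)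
        (by simpa [φ.left_inv hx] using eventually_contMDiffAt_one hf)
      filter_upwards [hev, φ.open_target.mem_nhds (φ.map_source hx)] with p hp hp'
      have := (hasDerivAt_time (c := c) hp (φ.map_target hp')).deriv
      rwa [← hφ, φ.right_inv hp'] at this
    rw [he.fderiv_eq]
    have h := (hD.comp (φ x) ((hasFDerivAt_id (𝕜 := ℝ) (φ x)).prodMk
      (hasFDerivAt_const t _))).clm_apply (hasFDerivAt_const ((0, 1) : 𝔼 n × ℝ) (φ x))
    have h' := h.fderiv
    simp only [Function.comp_def, id] at h'
    rw [h']
    simpa using hsymm.eq (w, 0) (0, 1)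
  rw [h2]
  refine h1.congr_of_eventuallyEq ?_
  have hcont : ContinuousAt (fun s : ℝ ↦ (x, s)) t := by fun_prop
  filter_upwards [hcont.eventually (eventually_contMDiffAt_one hf)] with s hs
  exact mvfderiv_space hs hx w

end PartialDerivatives

/-! ### Smooth time-dependent sections. -/

section Families

variable {n : ℕ} {M : Type*} [TopologicalSpace M] [ChartedSpace (𝔼 n) M] [IsManifold (𝓡 n) ∞ M]
  {F : Type*} [NormedAddCommGroup F] [NormedSpace ℝ F]
  {V : M → Type*} [TopologicalSpace (TotalSpace F V)]
  [∀ x, NormedAddCommGroup (V x)] [∀ x, InnerProductSpace ℝ (V x)]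
  [FiberBundle F V]

variable (n F) in
/-- The time-dependent section `τ` is of class `C^m` near the point `x` at time `t`. -/
def IsFamilyAt (m : ℕ∞ω) (τ : ℝ → Π x : M, V x) (x : M) (t : ℝ) : Prop :=
  ContMDiffAt ((𝓡 n).prod 𝓘(ℝ, ℝ)) ((𝓡 n).prod 𝓘(ℝ, F)) m
    (fun z : M × ℝ ↦ (⟨z.1, τ z.2 z.1⟩ : TotalSpace F V)) (x, t)

variable {τ τ' : ℝ → Π x : M, V x} {x : M} {t : ℝ} {m : ℕ∞ω}

lemma IsFamilyAt.of_section {σ : Π x : M, V x} (hσ : ContMDiffAt (𝓡 n) ((𝓡 n).prod 𝓘(ℝ, F)) m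
    (fun y ↦ (⟨y, σ y⟩ : TotalSpace F V)) x) : IsFamilyAt n F m (fun _ ↦ σ) x t :=
  ContMDiffAt.comp (I' := 𝓡 n) (g := fun y ↦ (⟨y, σ y⟩ : TotalSpace F V))
    (f := fun z : M × ℝ ↦ z.1) (x, t) hσ contMDiffAt_fst

lemma IsFamilyAt.section (h : IsFamilyAt n F m τ x t) :
    ContMDiffAt (𝓡 n) ((𝓡 n).prod 𝓘(ℝ, F)) m (fun y ↦ (⟨y, τ t y⟩ : TotalSpace F V)) x :=
  ContMDiffAt.comp (I' := (𝓡 n).prod 𝓘(ℝ, ℝ)) (g := fun z : M × ℝ ↦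
    (⟨z.1, τ z.2 z.1⟩ : TotalSpace F V)) (f := fun y ↦ (y, t)) x h
    (contMDiffAt_id.prodMk contMDiffAt_const)

lemma IsFamilyAt.congr (h : IsFamilyAt n F m τ x t)
    (he : ∀ᶠ z : M × ℝ in 𝓝 (x, t), τ' z.2 z.1 = τ z.2 z.1) : IsFamilyAt n F m τ' x t :=
  ContMDiffAt.congr_of_eventuallyEq h (by filter_upwards [he] with z hz; rw [hz])

variable [VectorBundle ℝ F V]

lemma IsFamilyAt.eventually (h : IsFamilyAt n F ∞ τ x t) [ContMDiffVectorBundle ∞ F V (𝓡 n)] :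
    ∀ᶠ z : M × ℝ in 𝓝 (x, t), IsFamilyAt n F 1 τ z.1 z.2 := by
  have : ContMDiffVectorBundle 1 F V (𝓡 n) := ContMDiffVectorBundle.of_le (n := ∞) (by norm_num)
  exact (contMDiffAt_iff_contMDiffAt_nhds (by simp)).1
    (ContMDiffAt.of_le h (by norm_num : (1 : ℕ∞ω) ≤ ∞))

lemma isFamilyAt_iff : IsFamilyAt n F m τ x t ↔ ContMDiffAt ((𝓡 n).prod 𝓘(ℝ, ℝ)) 𝓘(ℝ, F) m
    (fun z : M × ℝ ↦ (trivializationAt F V x ⟨z.1, τ z.2 z.1⟩).2) (x, t) := by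
  unfold IsFamilyAt
  rw [contMDiffAt_totalSpace, and_iff_right_iff_imp]
  exact fun _ ↦ contMDiffAt_fst

lemma eventually_fst_mem_baseSet (x : M) (t : ℝ) :
    ∀ᶠ z : M × ℝ in 𝓝 (x, t), z.1 ∈ (trivializationAt F V x).baseSet :=
  continuousAt_fst.eventually ((trivializationAt F V x).open_baseSet.mem_nhds
    (FiberBundle.mem_baseSet_trivializationAt' x))

lemma IsFamilyAt.add (h : IsFamilyAt n F m τ x t) (h' : IsFamilyAt n F m τ' x t) :
    IsFamilyAt n F m (fun s y ↦ τ s y + τ' s y) x t := by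
  rw [isFamilyAt_iff] at *
  refine (ContMDiffAt.add h h').congr_of_eventuallyEq ?_
  filter_upwards [eventually_fst_mem_baseSet (F := F) (V := V) x t] with z hz
  exact ((trivializationAt F V x).linear ℝ hz).map_add _ _

lemma IsFamilyAt.smul {f : M × ℝ → ℝ} (hf : ContMDiffAt ((𝓡 n).prod 𝓘(ℝ, ℝ)) 𝓘(ℝ, ℝ) m f (x, t))
    (h : IsFamilyAt n F m τ x t) : IsFamilyAt n F m (fun s y ↦ f (y, s) • τ s y) x t := by
  rw [isFamilyAt_iff] at *
  refine (ContMDiffAt.smul hf h).congr_of_eventuallyEq ?_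
  filter_upwards [eventually_fst_mem_baseSet (F := F) (V := V) x t] with z hz
  exact ((trivializationAt F V x).linear ℝ hz).map_smul _ _

lemma IsFamilyAt.zero : IsFamilyAt n F m (fun _ y ↦ (0 : V y)) x t :=
  .of_section ((contMDiff_zeroSection ℝ V).contMDiffAt (x := x))

lemma IsFamilyAt.sum {ι : Type*} {s : Finset ι} {τ : ι → ℝ → Π x : M, V x}
    (h : ∀ i ∈ s, IsFamilyAt n F m (τ i) x t) :
    IsFamilyAt n F m (fun r y ↦ ∑ i ∈ s, τ i r y) x t := by
  classical
  induction s using Finset.induction_on with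
  | empty => simpa using IsFamilyAt.zero
  | insert a s ha ih =>
    simp only [Finset.sum_insert ha]
    exact (h a (by simp)).add (ih fun i hi ↦ h i (by simp [hi]))

lemma IsFamilyAt.inner_family [IsContMDiffRiemannianBundle (𝓡 n) m F V]
    (h : IsFamilyAt n F m τ x t) (h' : IsFamilyAt n F m τ' x t) :
    ContMDiffAt ((𝓡 n).prod 𝓘(ℝ, ℝ)) 𝓘(ℝ, ℝ) m
      (fun z : M × ℝ ↦ inner ℝ (τ z.2 z.1) (τ' z.2 z.1)) (x, t) :=
  ContMDiffAt.inner_bundle h h'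

/-! ### The connection applied to time-dependent sections. -/

section Connection

variable (nabla : CovariantDerivative (𝓡 n) F V)

lemma nabla_sum_smul {ι : Type*} (s : Finset ι) {f : ι → M → ℝ} {S : ι → Π x : M, V x}
    (hf : ∀ i ∈ s, MDifferentiableAt (𝓡 n) 𝓘(ℝ, ℝ) (f i) x)
    (hS : ∀ i ∈ s, MDifferentiableAt (𝓡 n) ((𝓡 n).prod 𝓘(ℝ, F))
      (fun y ↦ (⟨y, S i y⟩ : TotalSpace F V)) x) :
    nabla (fun y ↦ ∑ i ∈ s, f i y • S i y) x =
      ∑ i ∈ s, (f i x • nabla (S i) x + (mvfderiv (𝓡 n) (f i) x).smulRight (S i x)) := by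
  classical
  induction s using Finset.induction_on with
  | empty =>
    simp only [Finset.sum_empty]
    exact congrFun nabla.zero x
  | insert a s ha ih =>
    simp only [Finset.sum_insert ha]
    have h1 := hf a (by simp)
    have h2 := hS a (by simp)
    rw [← ih (fun i hi ↦ hf i (by simp [hi])) (fun i hi ↦ hS i (by simp [hi])),
      ← nabla.isCovariantDerivativeOnUniv.leibniz h2 h1]
    exact nabla.isCovariantDerivativeOnUniv.add (h1.smul_section h2)
      (MDifferentiableAt.sum_section fun i hi ↦
        (hf i (by simp [hi])).smul_section (hS i (by simp [hi])))

variable [T2Space M] [FiniteDimensional ℝ F] [ContMDiffVectorBundle ∞ F V (𝓡 n)]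

variable (n F V) in
/-- Finitely many global smooth sections which span over an open set, with smooth coefficients. -/
structure LocalSpan where
  /-- The index type. -/
  ι : Type
  /-- The index type is finite. -/
  fintype : Fintype ι
  /-- The spanning sections. -/
  S : ι → Π x : M, V x
  /-- The coefficients of vectors. -/
  κ : ι → Π x : M, V x → ℝ
  /-- The set over which the sections span. -/
  U : Set M
  isOpen : IsOpen U
  smooth : ∀ i, IsSmoothSection n F (S i)
  sum_eq : ∀ x ∈ U, ∀ v : V x, ∑ i, κ i x v • S i x = v
  contMDiffAt : ∀ (τ : ℝ → Π x : M, V x) (x : M) (t : ℝ) (m : ℕ∞ω), m ≤ ∞ → x ∈ U →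
    IsFamilyAt n F m τ x t → ∀ i,
      ContMDiffAt ((𝓡 n).prod 𝓘(ℝ, ℝ)) 𝓘(ℝ, ℝ) m (fun z : M × ℝ ↦ κ i z.1 (τ z.2 z.1)) (x, t)

attribute [instance] LocalSpan.fintype

variable (n F V) in
lemma exists_localSpan (x₀ : M) : ∃ L : LocalSpan n F V, x₀ ∈ L.U := by
  set e := trivializationAt F V x₀ with he
  have hx₀ : x₀ ∈ e.baseSet := FiberBundle.mem_baseSet_trivializationAt' x₀
  let b := Module.finBasis ℝ F
  obtain ⟨χ, -, hχ⟩ := (SmoothBumpFunction.nhds_basis_tsupport (I := 𝓡 n) x₀).mem_iff.1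
    (e.open_baseSet.mem_nhds hx₀)
  -- Multiplying a local frame by `χ` makes its sections global. On `U`, where `χ = 1`, the products
  -- are still the frame itself.
  obtain ⟨U, hU, hUo, hUx⟩ := mem_nhds_iff.1
    (inter_mem (χ.eventuallyEq_one) (e.open_baseSet.mem_nhds hx₀))
  refine ⟨⟨_, inferInstance, fun i ↦ (χ : M → ℝ) • e.localFrame b i,
    fun i x v ↦ b.repr (e ⟨x, v⟩).2 i, U, hUo, fun i ↦ ?_, fun x hx v ↦ ?_,
    fun τ x t m hm hx h i ↦ ?_⟩, hUx⟩
  · exact ContMDiffOn.smul_section_of_tsupport χ.contMDiff.contMDiffOn e.open_baseSet hχ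
      (e.contMDiffOn_localFrame_baseSet ∞ b i)
  · have h1 : χ x = 1 := (hU hx).1
    have h2 := (hU hx).2
    refine Eq.trans (Finset.sum_congr rfl fun i _ ↦ ?_) ((e.basisAt b h2).sum_repr v)
    change b.repr (e ⟨x, v⟩).2 i • (χ x • e.localFrame b i x) = _
    rw [h1, one_smul, e.localFrame_apply_of_mem_baseSet b h2]
    rfl
  · have h2 := (hU hx).2
    have : ContMDiffVectorBundle m F V (𝓡 n) := ContMDiffVectorBundle.of_le (n := ∞) hm
    have h3 : ContMDiffAt ((𝓡 n).prod 𝓘(ℝ, ℝ)) 𝓘(ℝ, F) m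
        (fun z : M × ℝ ↦ (e ⟨z.1, τ z.2 z.1⟩).2) (x, t) := by
      have h4 := (Bundle.Trivialization.contMDiffAt_iff (IB := 𝓡 n) (e := e)
        (f := fun z : M × ℝ ↦ (⟨z.1, τ z.2 z.1⟩ : TotalSpace F V)) (x₀ := (x, t))
        (e.mem_source.2 h2)).1 h
      exact h4.2
    exact ContMDiffAt.comp (I' := 𝓘(ℝ, F)) (x, t)
      (((b.coord i).toContinuousLinearMap.contDiff).contMDiff.contMDiffAt) h3

variable [CovariantDerivative.ContMDiffCovariantDerivative nabla ∞]

lemma contMDiffAt_nabla_chartFrame {S : Π x : M, V x} (hS : IsSmoothSection n F S) {c : M}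
    (hx : x ∈ (chartAt (𝔼 n) c).source) (w : 𝔼 n) :
    ContMDiffAt (𝓡 n) ((𝓡 n).prod 𝓘(ℝ, F)) ∞
      (fun y ↦ (⟨y, nabla S y (chartFrame c w y)⟩ : TotalSpace F V)) x := by
  have h := (CovariantDerivative.ContMDiffCovariantDerivative.contMDiff (cov := nabla)
    (k := ∞)).contMDiff (σ := S) (by simpa using hS.contMDiffOn)
  exact ContMDiffAt.clm_bundle_apply (h.contMDiffAt univ_mem) (contMDiffAt_chartFrame w hx)

lemma LocalSpan.mdifferentiableAt (L : LocalSpan n F V) (hx : x ∈ L.U)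
    (h : IsFamilyAt n F 1 τ x t) (i : L.ι) :
    MDifferentiableAt (𝓡 n) 𝓘(ℝ, ℝ) (fun y ↦ L.κ i y (τ t y)) x :=
  ContMDiffAt.mdifferentiableAt (n := 1) (ContMDiffAt.comp (I' := (𝓡 n).prod 𝓘(ℝ, ℝ))
    (g := fun z : M × ℝ ↦ L.κ i z.1 (τ z.2 z.1)) (f := fun y ↦ (y, t)) x
    (L.contMDiffAt τ x t 1 (by norm_num) hx h i) (contMDiffAt_id.prodMk contMDiffAt_const))
    one_ne_zero

/-- Since the sections `L.S i` do not depend on time, the Leibniz rule puts all time dependence into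
scalar coefficients, to which the results on functions apply. -/
lemma LocalSpan.nabla_eq (L : LocalSpan n F V) (hx : x ∈ L.U) (h : IsFamilyAt n F 1 τ x t) :
    nabla (τ t) x = ∑ i, (L.κ i x (τ t x) • nabla (L.S i) x +
      (mvfderiv (𝓡 n) (fun y ↦ L.κ i y (τ t y)) x).smulRight (L.S i x)) := by
  have hκd := L.mdifferentiableAt hx h
  have hSd : ∀ i, MDifferentiableAt (𝓡 n) ((𝓡 n).prod 𝓘(ℝ, F))
      (fun y ↦ (⟨y, L.S i y⟩ : TotalSpace F V)) x := fun i ↦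
    (L.smooth i).contMDiffAt.mdifferentiableAt (by simp)
  rw [← nabla_sum_smul nabla Finset.univ (fun i _ ↦ hκd i) (fun i _ ↦ hSd i)]
  refine nabla.isCovariantDerivativeOnUniv.congr_of_eventuallyEq
    (ContMDiffAt.mdifferentiableAt h.section one_ne_zero)
    (MDifferentiableAt.sum_section fun i _ ↦ (hκd i).smul_section (hSd i)) univ_mem ?_
  filter_upwards [L.isOpen.mem_nhds hx] with y hy
  exact (L.sum_eq y hy _).symm

/-- The covariant derivative of a smooth family along a coordinate field is a smooth family. -/
lemma IsFamilyAt.nabla_chartFrame (h : IsFamilyAt n F ∞ τ x t) {c : M}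
    (hx : x ∈ (chartAt (𝔼 n) c).source) (w : 𝔼 n) :
    IsFamilyAt n F ∞ (fun s y ↦ nabla (τ s) y (chartFrame c w y)) x t := by
  obtain ⟨L, hL⟩ := exists_localSpan n F V x
  have h1 : IsFamilyAt n F ∞ (fun s y ↦ ∑ i, (L.κ i y (τ s y) • nabla (L.S i) y (chartFrame c w y) +
      mvfderiv (𝓡 n) (fun y ↦ L.κ i y (τ s y)) y (chartFrame c w y) • L.S i y)) x t := by
    refine IsFamilyAt.sum fun i _ ↦ IsFamilyAt.add ?_ ?_
    · exact IsFamilyAt.smul (f := fun z : M × ℝ ↦ L.κ i z.1 (τ z.2 z.1))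
        (L.contMDiffAt τ x t ∞ le_rfl hL h i)
        (IsFamilyAt.of_section (contMDiffAt_nabla_chartFrame nabla (L.smooth i) hx w))
    · exact IsFamilyAt.smul (f := fun z : M × ℝ ↦
        mvfderiv (𝓡 n) (fun y ↦ L.κ i y (τ z.2 y)) z.1 (chartFrame c w z.1))
        (contMDiffAt_mvfderiv_space (L.contMDiffAt τ x t ∞ le_rfl hL h i) hx w)
        (IsFamilyAt.of_section (L.smooth i).contMDiffAt)
  refine h1.congr ?_
  filter_upwards [h.eventually, continuousAt_fst.eventually (L.isOpen.mem_nhds hL)] with z hz hz'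
  rw [L.nabla_eq nabla hz' hz]
  simp

/-- The velocity of a time-dependent section. -/
def velocity (τ : ℝ → Π x : M, V x) (t : ℝ) (x : M) : V x :=
  deriv (fun s ↦ τ s x) t

lemma LocalSpan.velocity_eq (L : LocalSpan n F V) (hx : x ∈ L.U) (h : IsFamilyAt n F 1 τ x t) :
    HasDerivAt (fun s ↦ τ s x) (∑ i, deriv (fun s ↦ L.κ i x (τ s x)) t • L.S i x) t := by
  have h1 : ∀ i, HasDerivAt (fun s ↦ L.κ i x (τ s x)) (deriv (fun s ↦ L.κ i x (τ s x)) t) t :=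
    fun i ↦ (hasDerivAt_time (f := fun z : M × ℝ ↦ L.κ i z.1 (τ z.2 z.1))
      (L.contMDiffAt τ x t 1 (by norm_num) hx h i)
      (mem_chart_source (𝔼 n) x)).differentiableAt.hasDerivAt
  have h2 := HasDerivAt.fun_sum fun i (_ : i ∈ Finset.univ) ↦ (h1 i).smul_const (L.S i x)
  refine h2.congr_of_eventuallyEq (Eventually.of_forall fun s ↦ ?_)
  exact (L.sum_eq x hx _).symm

lemma IsFamilyAt.hasDerivAt (h : IsFamilyAt n F 1 τ x t) :
    HasDerivAt (fun s ↦ τ s x) (velocity τ t x) t := by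
  obtain ⟨L, hL⟩ := exists_localSpan n F V x
  exact (L.velocity_eq hL h).differentiableAt.hasDerivAt

lemma IsFamilyAt.velocity_family (h : IsFamilyAt n F ∞ τ x t) : IsFamilyAt n F ∞ (velocity τ) x t := by
  obtain ⟨L, hL⟩ := exists_localSpan n F V x
  have h1 : IsFamilyAt n F ∞ (fun r y ↦ ∑ i, deriv (fun s ↦ L.κ i y (τ s y)) r • L.S i y) x t :=
    IsFamilyAt.sum fun i _ ↦ IsFamilyAt.smul
      (f := fun z : M × ℝ ↦ deriv (fun s ↦ L.κ i z.1 (τ s z.1)) z.2)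
      (contMDiffAt_deriv_time (L.contMDiffAt τ x t ∞ le_rfl hL h i))
      (IsFamilyAt.of_section (L.smooth i).contMDiffAt)
  refine h1.congr ?_
  filter_upwards [h.eventually, continuousAt_fst.eventually (L.isOpen.mem_nhds hL)] with z hz hz'
  exact (L.velocity_eq hz' hz).deriv

/-- The covariant derivative commutes with the time derivative. -/
lemma IsFamilyAt.hasDerivAt_nabla (h : IsFamilyAt n F ∞ τ x t) (u : TangentSpace (𝓡 n) x) :
    HasDerivAt (fun s ↦ nabla (τ s) x u) (nabla (velocity τ t) x u) t := by
  obtain ⟨L, hL⟩ := exists_localSpan n F V x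
  obtain ⟨w, rfl⟩ := (chartFrameEquiv x (mem_chart_source (𝔼 n) x)).surjective u
  rw [chartFrameEquiv_apply]
  have hc := mem_chart_source (𝔼 n) x
  have hκ := L.contMDiffAt τ x t ∞ le_rfl hL h
  have h1 : ∀ i, HasDerivAt (fun s ↦ L.κ i x (τ s x)) (deriv (fun s ↦ L.κ i x (τ s x)) t) t :=
    fun i ↦ (hasDerivAt_time (f := fun z : M × ℝ ↦ L.κ i z.1 (τ z.2 z.1))
      ((hκ i).of_le (by norm_num)) hc).differentiableAt.hasDerivAt
  -- Only the scalar coefficients move with time, so the commutation reduces to the symmetry of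
  -- mixed partial derivatives.
  have h2 := fun i ↦ hasDerivAt_mvfderiv_space (hκ i) hc w
  have h3 := HasDerivAt.fun_sum fun i (_ : i ∈ Finset.univ) ↦
    ((h1 i).smul_const (nabla (L.S i) x (chartFrame x w x))).add ((h2 i).smul_const (L.S i x))
  have h4 : nabla (velocity τ t) x (chartFrame x w x) =
      ∑ i, (deriv (fun s ↦ L.κ i x (τ s x)) t • nabla (L.S i) x (chartFrame x w x) +
        mvfderiv (𝓡 n) (fun y ↦ deriv (fun s ↦ L.κ i y (τ s y)) t) x (chartFrame x w x) •
          L.S i x) := by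
    have hd : ∀ i, MDifferentiableAt (𝓡 n) 𝓘(ℝ, ℝ) (fun y ↦ deriv (fun s ↦ L.κ i y (τ s y)) t) x :=
      fun i ↦ ContMDiffAt.mdifferentiableAt (n := 1) (ContMDiffAt.comp
        (I' := (𝓡 n).prod 𝓘(ℝ, ℝ)) (g := fun z : M × ℝ ↦ deriv (fun s ↦ L.κ i z.1 (τ s z.1)) z.2)
        (f := fun y ↦ (y, t)) x ((contMDiffAt_deriv_time (hκ i)).of_le (by norm_num))
        (contMDiffAt_id.prodMk contMDiffAt_const)) one_ne_zero
    have hSd : ∀ i, MDifferentiableAt (𝓡 n) ((𝓡 n).prod 𝓘(ℝ, F))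
        (fun y ↦ (⟨y, L.S i y⟩ : TotalSpace F V)) x := fun i ↦
      (L.smooth i).contMDiffAt.mdifferentiableAt (by simp)
    have h5 := nabla_sum_smul nabla Finset.univ (fun i _ ↦ hd i) (fun i _ ↦ hSd i)
    have h6 : nabla (velocity τ t) x =
        nabla (fun y ↦ ∑ i, deriv (fun s ↦ L.κ i y (τ s y)) t • L.S i y) x := by
      refine nabla.isCovariantDerivativeOnUniv.congr_of_eventuallyEq
        (ContMDiffAt.mdifferentiableAt h.velocity_family.section (by simp))
        (MDifferentiableAt.sum_section fun i _ ↦ (hd i).smul_section (hSd i)) univ_mem ?_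
      have hcont : ContinuousAt (fun y : M ↦ (y, t)) x := by fun_prop
      filter_upwards [L.isOpen.mem_nhds hL, hcont.eventually h.eventually] with y hy hy'
      exact (L.velocity_eq hy hy').deriv
    rw [h6, h5]
    simp
  rw [h4]
  refine h3.congr_of_eventuallyEq ?_
  have hcont : ContinuousAt (fun s : ℝ ↦ (x, s)) t := by fun_prop
  filter_upwards [hcont.eventually h.eventually] with s hs
  rw [L.nabla_eq nabla hL hs]
  simp

end Connection

end Families

/-! ### Differentiation under the integral sign over a compact set. -/

section ParametricIntegral

variable {M : Type*} [TopologicalSpace M] [T2Space M] [SecondCountableTopology M]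
  [MeasurableSpace M] [BorelSpace M]

lemma hasDerivAt_setIntegral_of_continuous (μ : Measure M) [IsFiniteMeasureOnCompacts μ] {D : Set M}
    (hD : IsCompact D) {f f' : M × ℝ → ℝ} (hf : Continuous f) (hf' : Continuous f')
    (hderiv : ∀ x t, HasDerivAt (fun s ↦ f (x, s)) (f' (x, t)) t) (t₀ : ℝ) :
    HasDerivAt (fun t ↦ ∫ x in D, f (x, t) ∂μ) (∫ x in D, f' (x, t₀) ∂μ) t₀ := by
  have hfin : IsFiniteMeasure (μ.restrict D) := ⟨by simpa using hD.measure_lt_top⟩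
  -- The dominating function is a constant: a bound for `f'` on the compact set `D × [t₀ - 1, t₀ +
  -- 1]`.
  obtain ⟨C, hC⟩ := ((hD.prod (isCompact_closedBall t₀ 1)).exists_bound_of_continuousOn
    hf'.continuousOn)
  have hmeas : ∀ t, AEStronglyMeasurable (fun x ↦ f (x, t)) (μ.restrict D) := fun t ↦
    (hf.comp (by fun_prop : Continuous fun x : M ↦ (x, t))).aestronglyMeasurable
  refine (hasDerivAt_integral_of_dominated_loc_of_deriv_le (F := fun t x ↦ f (x, t))
    (F' := fun t x ↦ f' (x, t)) (bound := fun _ ↦ C) (Metric.ball_mem_nhds t₀ one_pos)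
    (Eventually.of_forall hmeas) ?_ ?_ ?_ (integrable_const C) ?_).2
  · exact ((hf.comp (by fun_prop : Continuous fun x : M ↦ (x, t₀))).continuousOn).integrableOn_compact
      hD
  · exact (hf'.comp (by fun_prop : Continuous fun x : M ↦ (x, t₀))).aestronglyMeasurable
  · filter_upwards [ae_restrict_mem hD.measurableSet] with x hx t ht
    exact hC (x, t) ⟨hx, Metric.ball_subset_closedBall ht⟩
  · exact Eventually.of_forall fun x t _ ↦ hderiv x t

end ParametricIntegral

/-! ### The first variation of the energy along a smooth family. -/

section FirstVariation

variable {n : ℕ} {M : Type*} [TopologicalSpace M] [ChartedSpace (𝔼 n) M] [IsManifold (𝓡 n) ∞ M]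
  [RiemannianBundle (fun x : M ↦ TangentSpace (𝓡 n) x)]
  {F : Type*} [NormedAddCommGroup F] [NormedSpace ℝ F]
  {V : M → Type*} [TopologicalSpace (TotalSpace F V)]
  [∀ x, NormedAddCommGroup (V x)] [∀ x, InnerProductSpace ℝ (V x)]
  [FiberBundle F V] (nabla : CovariantDerivative (𝓡 n) F V)

/-- `⟨∇σ, ∇τ⟩` at `x`. -/
def nablaInner (σ τ : Π x : M, V x) (x : M) : ℝ :=
  ∑ i, inner ℝ (nabla σ x (tangentBasis x i)) (nabla τ x (tangentBasis x i))

/-- The inner product of the one-forms `⟨∇σ, σ'⟩` and `⟨∇τ, τ'⟩` at `x`. -/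
def nablaContraction (σ σ' τ τ' : Π x : M, V x) (x : M) : ℝ :=
  ∑ i, inner ℝ (nabla σ x (tangentBasis x i)) (σ' x) * inner ℝ (nabla τ x (tangentBasis x i)) (τ' x)

lemma normSqNabla_eq_nablaInner (σ : Π x : M, V x) (x : M) :
    normSqNabla nabla σ x = nablaInner nabla σ σ x := by
  simp [normSqNabla, nablaInner]

lemma verticalEnergyDensity_eq (p q : ℝ) (σ : Π x : M, V x) (x : M) :
    verticalEnergyDensity nabla p q σ x =
      (1 / (1 + ‖σ x‖ ^ 2)) ^ p * (nablaInner nabla σ σ x + q * nablaContraction nabla σ σ σ σ x) := by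
  simp only [verticalEnergyDensity, verticalMetric, nablaInner, nablaContraction, Finset.mul_sum,
    ← Finset.sum_add_distrib]
  refine Finset.sum_congr rfl fun i _ ↦ by ring

/-- The derivative of the `(p,q)`-energy density at `σ` in the direction `v`. -/
def energyVariation (p q : ℝ) (σ v : Π x : M, V x) (x : M) : ℝ :=
  -(2 * inner ℝ (σ x) (v x)) / (1 + ‖σ x‖ ^ 2) ^ 2 * p * (1 / (1 + ‖σ x‖ ^ 2)) ^ (p - 1) *
      (nablaInner nabla σ σ x + q * nablaContraction nabla σ σ σ σ x) +
    (1 / (1 + ‖σ x‖ ^ 2)) ^ p * (2 * nablaInner nabla σ v x +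
      q * (2 * (nablaContraction nabla v σ σ σ x + nablaContraction nabla σ v σ σ x)))

/-- Each `q`-term has a factor `⟨∇σ, σ⟩`, hence vanishes. What remains is the product rule for the
weight `(1+|σ|²)^(-p)` and `|∇σ|²`; the quotient `p / (1 + k²)` is the logarithmic derivative of the
weight. -/
lemma energyVariation_eq_of_norm_eq (p q : ℝ) {σ v : Π x : M, V x} {x : M} {k : ℝ}
    (hσ : ‖σ x‖ = k) (hperp : ∀ u, inner ℝ (nabla σ x u) (σ x) = 0) :
    energyVariation nabla p q σ v x = 2 * ((1 / (1 + k ^ 2)) ^ p *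
      (nablaInner nabla σ v x - p / (1 + k ^ 2) * (nablaInner nabla σ σ x * inner ℝ (σ x) (v x)))) := by
  have hk : 0 < 1 + k ^ 2 := by positivity
  simp only [energyVariation, nablaContraction, hperp, hσ]
  rw [Real.rpow_sub_one (by positivity)]
  simp only [mul_zero, Finset.sum_const_zero, add_zero]
  field_simp
  ring

variable {τ τ' τ'' τ''' : ℝ → Π x : M, V x} {x : M} {t : ℝ}

/-- Near `x` the trace is rewritten in the frame of the chart at `x`, with the inverse Gram matrix
as coefficients; every ingredient is then smooth. -/
lemma contMDiffAt_trace [IsContMDiffRiemannianBundle (𝓡 n) ∞ (𝔼 n) (fun x : M ↦ TangentSpace (𝓡 n) x)]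
    (B : ∀ z : M × ℝ, TangentSpace (𝓡 n) z.1 →ₗ[ℝ] TangentSpace (𝓡 n) z.1 →ₗ[ℝ] ℝ)
    (hB : ∀ w w', ContMDiffAt ((𝓡 n).prod 𝓘(ℝ, ℝ)) 𝓘(ℝ, ℝ) ∞
      (fun z : M × ℝ ↦ B z (chartFrame x w z.1) (chartFrame x w' z.1)) (x, t)) :
    ContMDiffAt ((𝓡 n).prod 𝓘(ℝ, ℝ)) 𝓘(ℝ, ℝ) ∞
      (fun z : M × ℝ ↦ ∑ i, B z (tangentBasis z.1 i) (tangentBasis z.1 i)) (x, t) := by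
  have hx := mem_chart_source (𝔼 n) x
  have h : ContMDiffAt ((𝓡 n).prod 𝓘(ℝ, ℝ)) 𝓘(ℝ, ℝ) ∞ (fun z : M × ℝ ↦ ∑ i, ∑ j,
      (frameGram x (normalBasis (n := n) x) z.1)⁻¹ i j * B z (chartFrame x (normalBasis x i) z.1)
        (chartFrame x (normalBasis x j) z.1)) (x, t) := by
    refine ContMDiffAt.sum fun i _ ↦ ContMDiffAt.sum fun j _ ↦ ContMDiffAt.mul ?_ (hB _ _)
    exact ContMDiffAt.comp (I' := 𝓡 n) (g := fun y ↦ (frameGram x (normalBasis (n := n) x) y)⁻¹ i j)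
      (f := fun z : M × ℝ ↦ z.1) (x, t) (contMDiffAt_frameGram_inv hx (normalBasis x) i j)
      contMDiffAt_fst
  refine h.congr_of_eventuallyEq ?_
  filter_upwards [eventually_fst_mem_source hx] with z hz
  exact sum_tangentBasis_eq hz (normalBasis x) (B z)

variable [VectorBundle ℝ F V] [T2Space M] [FiniteDimensional ℝ F] [ContMDiffVectorBundle ∞ F V (𝓡 n)]
  [CovariantDerivative.ContMDiffCovariantDerivative nabla ∞]

section Smooth

variable [IsContMDiffRiemannianBundle (𝓡 n) ∞ F V]
  [IsContMDiffRiemannianBundle (𝓡 n) ∞ (𝔼 n) (fun x : M ↦ TangentSpace (𝓡 n) x)]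

lemma contMDiffAt_nablaInner (h : IsFamilyAt n F ∞ τ x t) (h' : IsFamilyAt n F ∞ τ' x t) :
    ContMDiffAt ((𝓡 n).prod 𝓘(ℝ, ℝ)) 𝓘(ℝ, ℝ) ∞
      (fun z : M × ℝ ↦ nablaInner nabla (τ z.2) (τ' z.2) z.1) (x, t) := by
  have hx := mem_chart_source (𝔼 n) x
  exact contMDiffAt_trace (fun z ↦ (innerₗ (V z.1)).compl₁₂ (nabla (τ z.2) z.1).toLinearMap
    (nabla (τ' z.2) z.1).toLinearMap) fun w w' ↦
      (h.nabla_chartFrame nabla hx w).inner_family (h'.nabla_chartFrame nabla hx w')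

lemma contMDiffAt_nablaContraction (h : IsFamilyAt n F ∞ τ x t) (h' : IsFamilyAt n F ∞ τ' x t)
    (h'' : IsFamilyAt n F ∞ τ'' x t) (h''' : IsFamilyAt n F ∞ τ''' x t) :
    ContMDiffAt ((𝓡 n).prod 𝓘(ℝ, ℝ)) 𝓘(ℝ, ℝ) ∞
      (fun z : M × ℝ ↦ nablaContraction nabla (τ z.2) (τ' z.2) (τ'' z.2) (τ''' z.2) z.1) (x, t) := by
  have hx := mem_chart_source (𝔼 n) x
  exact contMDiffAt_trace (fun z ↦ LinearMap.mk₂ ℝ (fun u w ↦ inner ℝ (nabla (τ z.2) z.1 u) (τ' z.2 z.1)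
    * inner ℝ (nabla (τ'' z.2) z.1 w) (τ''' z.2 z.1))
    (fun _ _ _ ↦ by rw [map_add, inner_add_left, add_mul])
    (fun _ _ _ ↦ by rw [map_smul, real_inner_smul_left, mul_assoc, smul_eq_mul])
    (fun _ _ _ ↦ by rw [map_add, inner_add_left, mul_add])
    (fun _ _ _ ↦ by rw [map_smul, real_inner_smul_left, mul_left_comm, smul_eq_mul])) fun w w' ↦
      ((h.nabla_chartFrame nabla hx w).inner_family h').mul ((h''.nabla_chartFrame nabla hx w').inner_family h''')

end Smooth

lemma IsFamilyAt.hasDerivAt_nablaInner (h : IsFamilyAt n F ∞ τ x t) :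
    HasDerivAt (fun s ↦ nablaInner nabla (τ s) (τ s) x)
      (2 * nablaInner nabla (τ t) (velocity τ t) x) t := by
  have h1 := HasDerivAt.fun_sum fun i (_ : i ∈ Finset.univ) ↦
    (h.hasDerivAt_nabla nabla (tangentBasis x i)).inner ℝ (h.hasDerivAt_nabla nabla (tangentBasis x i))
  refine h1.congr_deriv ?_
  rw [nablaInner, Finset.mul_sum]
  refine Finset.sum_congr rfl fun i _ ↦ ?_
  rw [real_inner_comm (nabla (τ t) x (tangentBasis x i)) (nabla (velocity τ t) x (tangentBasis x i))]
  ring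

lemma IsFamilyAt.hasDerivAt_nablaContraction (h : IsFamilyAt n F ∞ τ x t) :
    HasDerivAt (fun s ↦ nablaContraction nabla (τ s) (τ s) (τ s) (τ s) x)
      (2 * (nablaContraction nabla (velocity τ t) (τ t) (τ t) (τ t) x +
        nablaContraction nabla (τ t) (velocity τ t) (τ t) (τ t) x)) t := by
  have h0 := ContMDiffAt.of_le h (by norm_num : (1 : ℕ∞ω) ≤ ∞)
  have h1 := fun i ↦ (h.hasDerivAt_nabla nabla (tangentBasis x i)).inner ℝ
    (IsFamilyAt.hasDerivAt h0)
  have h2 := HasDerivAt.fun_sum fun i (_ : i ∈ Finset.univ) ↦ (h1 i).mul (h1 i)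
  refine h2.congr_deriv ?_
  rw [nablaContraction, nablaContraction, ← Finset.sum_add_distrib, Finset.mul_sum]
  refine Finset.sum_congr rfl fun i _ ↦ by ring

lemma IsFamilyAt.hasDerivAt_verticalEnergyDensity (p q : ℝ) (h : IsFamilyAt n F ∞ τ x t) :
    HasDerivAt (fun s ↦ verticalEnergyDensity nabla p q (τ s) x)
      (energyVariation nabla p q (τ t) (velocity τ t) x) t := by
  have h0 := IsFamilyAt.hasDerivAt (ContMDiffAt.of_le h (by norm_num : (1 : ℕ∞ω) ≤ ∞))
  have h1 : HasDerivAt (fun s ↦ 1 / (1 + ‖τ s x‖ ^ 2))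
      (-(2 * inner ℝ (τ t x) (velocity τ t x)) / (1 + ‖τ t x‖ ^ 2) ^ 2) t := by
    have h2 := (h0.norm_sq.const_add 1).inv (by positivity)
    simp only [one_div]
    exact h2
  have h2 := h1.rpow_const (p := p) (Or.inl (by positivity))
  simp only [verticalEnergyDensity_eq]
  exact (h2.mul ((h.hasDerivAt_nablaInner nabla).add
    ((h.hasDerivAt_nablaContraction nabla).const_mul q)))

variable [IsContMDiffRiemannianBundle (𝓡 n) ∞ F V]
  [IsContMDiffRiemannianBundle (𝓡 n) ∞ (𝔼 n) (fun x : M ↦ TangentSpace (𝓡 n) x)]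

lemma continuous_verticalEnergyDensity (p q : ℝ) (h : ∀ x t, IsFamilyAt n F ∞ τ x t) :
    Continuous fun z : M × ℝ ↦ verticalEnergyDensity nabla p q (τ z.2) z.1 := by
  simp only [verticalEnergyDensity_eq]
  have h1 : Continuous fun z : M × ℝ ↦ ‖τ z.2 z.1‖ ^ 2 := by
    simp only [← real_inner_self_eq_norm_sq]
    exact continuous_iff_continuousAt.2 fun z ↦ ((h z.1 z.2).inner_family (h z.1 z.2)).continuousAt
  have h2 : Continuous fun z : M × ℝ ↦ nablaInner nabla (τ z.2) (τ z.2) z.1 :=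
    continuous_iff_continuousAt.2 fun z ↦
      (contMDiffAt_nablaInner nabla (h z.1 z.2) (h z.1 z.2)).continuousAt
  have h3 : Continuous fun z : M × ℝ ↦ nablaContraction nabla (τ z.2) (τ z.2) (τ z.2) (τ z.2) z.1 :=
    continuous_iff_continuousAt.2 fun z ↦ (contMDiffAt_nablaContraction nabla (h z.1 z.2)
      (h z.1 z.2) (h z.1 z.2) (h z.1 z.2)).continuousAt
  refine Continuous.mul (Continuous.rpow_const ?_ fun z ↦ Or.inl (by positivity)) (by fun_prop)
  exact continuous_const.div (by fun_prop) fun z ↦ by positivity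

lemma continuous_energyVariation (p q : ℝ) (h : ∀ x t, IsFamilyAt n F ∞ τ x t)
    (h' : ∀ x t, IsFamilyAt n F ∞ τ' x t) :
    Continuous fun z : M × ℝ ↦ energyVariation nabla p q (τ z.2) (τ' z.2) z.1 := by
  simp only [energyVariation]
  have h1 : Continuous fun z : M × ℝ ↦ ‖τ z.2 z.1‖ ^ 2 := by
    simp only [← real_inner_self_eq_norm_sq]
    exact continuous_iff_continuousAt.2 fun z ↦ ((h z.1 z.2).inner_family (h z.1 z.2)).continuousAt
  have h1' : Continuous fun z : M × ℝ ↦ inner ℝ (τ z.2 z.1) (τ' z.2 z.1) :=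
    continuous_iff_continuousAt.2 fun z ↦ ((h z.1 z.2).inner_family (h' z.1 z.2)).continuousAt
  have h2 : Continuous fun z : M × ℝ ↦ nablaInner nabla (τ z.2) (τ z.2) z.1 :=
    continuous_iff_continuousAt.2 fun z ↦
      (contMDiffAt_nablaInner nabla (h z.1 z.2) (h z.1 z.2)).continuousAt
  have h2' : Continuous fun z : M × ℝ ↦ nablaInner nabla (τ z.2) (τ' z.2) z.1 :=
    continuous_iff_continuousAt.2 fun z ↦
      (contMDiffAt_nablaInner nabla (h z.1 z.2) (h' z.1 z.2)).continuousAt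
  have h3 : Continuous fun z : M × ℝ ↦ nablaContraction nabla (τ z.2) (τ z.2) (τ z.2) (τ z.2) z.1 :=
    continuous_iff_continuousAt.2 fun z ↦ (contMDiffAt_nablaContraction nabla (h z.1 z.2)
      (h z.1 z.2) (h z.1 z.2) (h z.1 z.2)).continuousAt
  have h4 : Continuous fun z : M × ℝ ↦ nablaContraction nabla (τ' z.2) (τ z.2) (τ z.2) (τ z.2) z.1 :=
    continuous_iff_continuousAt.2 fun z ↦ (contMDiffAt_nablaContraction nabla (h' z.1 z.2)
      (h z.1 z.2) (h z.1 z.2) (h z.1 z.2)).continuousAt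
  have h5 : Continuous fun z : M × ℝ ↦ nablaContraction nabla (τ z.2) (τ' z.2) (τ z.2) (τ z.2) z.1 :=
    continuous_iff_continuousAt.2 fun z ↦ (contMDiffAt_nablaContraction nabla (h z.1 z.2)
      (h' z.1 z.2) (h z.1 z.2) (h z.1 z.2)).continuousAt
  have h6 : Continuous fun z : M × ℝ ↦ 1 / (1 + ‖τ z.2 z.1‖ ^ 2) :=
    continuous_const.div (by fun_prop) fun z ↦ by positivity
  have h7 : ∀ r : ℝ, Continuous fun z : M × ℝ ↦ (1 / (1 + ‖τ z.2 z.1‖ ^ 2)) ^ r := fun r ↦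
    h6.rpow_const fun z ↦ Or.inl (by positivity)
  have h8 : Continuous fun z : M × ℝ ↦
      -(2 * inner ℝ (τ z.2 z.1) (τ' z.2 z.1)) / (1 + ‖τ z.2 z.1‖ ^ 2) ^ 2 :=
    Continuous.div (by fun_prop) (by fun_prop) fun z ↦ by positivity
  have h9 := h7 p
  have h10 := h7 (p - 1)
  fun_prop

/-- The first variation of the `(p,q)`-energy. -/
lemma hasDerivAt_verticalEnergy [SecondCountableTopology M] [MeasurableSpace M] [BorelSpace M]
    [IsFiniteMeasureOnCompacts (riemannianVolume n M)] (p q : ℝ) {D : Set M} (hD : IsCompact D)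
    (h : ∀ x t, IsFamilyAt n F ∞ τ x t) (t : ℝ) :
    HasDerivAt (fun t ↦ verticalEnergy nabla p q D (τ t))
      (1 / 2 * ∫ x in D, energyVariation nabla p q (τ t) (velocity τ t) x ∂(riemannianVolume n M)) t :=
  (hasDerivAt_setIntegral_of_continuous (riemannianVolume n M) hD
    (f := fun z : M × ℝ ↦ verticalEnergyDensity nabla p q (τ z.2) z.1)
    (f' := fun z : M × ℝ ↦ energyVariation nabla p q (τ z.2) (velocity τ z.2) z.1)
    (continuous_verticalEnergyDensity nabla p q h)
    (continuous_energyVariation nabla p q h fun x t ↦ (h x t).velocity_family)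
    (fun x t ↦ (h x t).hasDerivAt_verticalEnergyDensity nabla p q) t).const_mul (1 / 2)

end FirstVariation

/-! ### The Riemannian measure in charts. -/

section Volume

variable {n : ℕ} {M : Type*} [TopologicalSpace M] [ChartedSpace (𝔼 n) M] [IsManifold (𝓡 n) ∞ M]

variable (n) in
/-- The standard basis of Euclidean space. -/
def stdFrame : Module.Basis (Fin n) ℝ (𝔼 n) := (EuclideanSpace.basisFun (Fin n) ℝ).toBasis

lemma coe_stdFrame : ⇑(stdFrame n) = fun i ↦ EuclideanSpace.single i 1 := by
  ext1 i
  simp [stdFrame]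

lemma differentiableAt_transition {c c' : M} {y : 𝔼 n} (hy : y ∈ (chartAt (𝔼 n) c).target)
    (hy' : (chartAt (𝔼 n) c).symm y ∈ (chartAt (𝔼 n) c').source) :
    DifferentiableAt ℝ (chartAt (𝔼 n) c' ∘ (chartAt (𝔼 n) c).symm) y := by
  rw [← mdifferentiableAt_iff_differentiableAt]
  exact MDifferentiableAt.comp (I' := 𝓡 n) y
    (mdifferentiableAt_atlas (I := 𝓡 n) (chart_mem_atlas _ c') hy') (mdifferentiableAt_chart_symm hy)

lemma chartFrame_change {c c' : M} {y : 𝔼 n} (hy : y ∈ (chartAt (𝔼 n) c).target)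
    (hy' : (chartAt (𝔼 n) c).symm y ∈ (chartAt (𝔼 n) c').source) (w : 𝔼 n) :
    chartFrame c w ((chartAt (𝔼 n) c).symm y) =
      chartFrame c' (fderiv ℝ (chartAt (𝔼 n) c' ∘ (chartAt (𝔼 n) c).symm) y w)
        ((chartAt (𝔼 n) c).symm y) := by
  set φ := chartAt (𝔼 n) c
  set ψ := chartAt (𝔼 n) c'
  have hx : φ.symm y ∈ φ.source := φ.map_target hy
  rw [chartFrame_eq_mfderiv _ hx, chartFrame_eq_mfderiv _ hy']
  have h1 : φ (φ.symm y) = y := φ.right_inv hy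
  have h2 := differentiableAt_transition hy hy'
  have h3 : MDifferentiableAt 𝓘(ℝ, 𝔼 n) (𝓡 n) ψ.symm ((ψ ∘ φ.symm) y) :=
    mdifferentiableAt_chart_symm (c := c') (ψ.map_source hy')
  have h4 := mfderiv_comp (I' := 𝓘(ℝ, 𝔼 n)) y h3 h2.mdifferentiableAt
  have h5 : ψ.symm ∘ ψ ∘ φ.symm =ᶠ[𝓝 y] φ.symm := by
    filter_upwards [(φ.continuousAt_symm hy).eventually (ψ.open_source.mem_nhds hy')] with z hz
    exact ψ.left_inv hz
  rw [h5.mfderiv_eq, mfderiv_eq_fderiv] at h4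
  have h6 := DFunLike.congr_fun h4 w
  rw [h1]
  exact h6

variable [RiemannianBundle (fun x : M ↦ TangentSpace (𝓡 n) x)]

/-- The coordinate frames differ by the Jacobian matrix of the transition map, so the square root of
the Gram determinant changes by exactly the factor in the change of variables formula. -/
lemma frameDensity_change {c c' : M} {y : 𝔼 n} (hy : y ∈ (chartAt (𝔼 n) c).target)
    (hy' : (chartAt (𝔼 n) c).symm y ∈ (chartAt (𝔼 n) c').source) :
    frameDensity c (stdFrame n) ((chartAt (𝔼 n) c).symm y) =
      |(fderiv ℝ (chartAt (𝔼 n) c' ∘ (chartAt (𝔼 n) c).symm) y).det| *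
        frameDensity c' (stdFrame n) ((chartAt (𝔼 n) c).symm y) := by
  set D := fderiv ℝ (chartAt (𝔼 n) c' ∘ (chartAt (𝔼 n) c).symm) y with hD
  have hx := (chartAt (𝔼 n) c).map_target hy
  have h := gram_det_eq_of_basis (chartBasis hx (stdFrame n)) (chartBasis hy' (stdFrame n))
  have h2 : ((chartBasis hy' (stdFrame n)).toMatrix (chartBasis hx (stdFrame n))).det = D.det := by
    rw [ContinuousLinearMap.det, ← LinearMap.det_toMatrix (stdFrame n)]
    congr 1
    ext i j
    rw [Module.Basis.toMatrix_apply, chartBasis_apply, chartFrame_change hy hy', ← hD,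
      LinearMap.toMatrix_apply, ← chartFrameEquiv_apply hy']
    simp [chartBasis]
  rw [h2, coe_chartBasis, coe_chartBasis] at h
  unfold frameDensity frameGram
  rw [h, Real.sqrt_mul (sq_nonneg _), Real.sqrt_sq_eq_abs]

lemma sqrt_det_metricMatrix (c : M) {y : 𝔼 n} (hy : y ∈ (chartAt (𝔼 n) c).target) :
    Real.sqrt (metricMatrix c y).det =
      frameDensity c (stdFrame n) ((chartAt (𝔼 n) c).symm y) := by
  rw [metricMatrix_eq_frameGram c hy, frameDensity, coe_stdFrame]

variable [MeasurableSpace M] [BorelSpace M]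

omit [IsManifold (𝓡 n) ∞ M] [RiemannianBundle (fun x : M ↦ TangentSpace (𝓡 n) x)] in
lemma measurableSet_target_inter (c : M) {A : Set M} (hA : MeasurableSet A) :
    MeasurableSet ((chartAt (𝔼 n) c).target ∩ (chartAt (𝔼 n) c).symm ⁻¹' A) := by
  have h := (chartAt (𝔼 n) c).continuousOn_symm.domRestrict.measurable hA
  have h2 := (chartAt (𝔼 n) c).open_target.measurableSet.subtype_image h
  convert h2 using 1
  ext y
  simp [and_comm]

omit [IsManifold (𝓡 n) ∞ M] [RiemannianBundle (fun x : M ↦ TangentSpace (𝓡 n) x)] in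
lemma aemeasurable_chart_symm (c : M) :
    AEMeasurable (chartAt (𝔼 n) c).symm (volume.restrict (chartAt (𝔼 n) c).target) :=
  (chartAt (𝔼 n) c).continuousOn_symm.aemeasurable (chartAt (𝔼 n) c).open_target.measurableSet

lemma chartVolume_apply (c : M) {A : Set M} (hA : MeasurableSet A) :
    chartVolume (n := n) c A = ∫⁻ y in (chartAt (𝔼 n) c).target ∩ (chartAt (𝔼 n) c).symm ⁻¹' A,
      ENNReal.ofReal (frameDensity c (stdFrame n) ((chartAt (𝔼 n) c).symm y)) := by
  have hm := measurableSet_target_inter (n := n) c hA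
  rw [chartVolume, Measure.map_apply_of_aemeasurable
    ((aemeasurable_chart_symm c).mono_ac (withDensity_absolutelyContinuous _ _)) hA,
    withDensity_apply', Measure.restrict_restrict' (chartAt (𝔼 n) c).open_target.measurableSet,
    inter_comm]
  exact setLIntegral_congr_fun hm fun _ hy ↦ by
    simp only [sqrt_det_metricMatrix c hy.1]

lemma chartVolume_eq_of_subset {c c' : M} {A : Set M} (hA : MeasurableSet A)
    (h : A ⊆ (chartAt (𝔼 n) c).source) (h' : A ⊆ (chartAt (𝔼 n) c').source) :
    chartVolume (n := n) c A = chartVolume (n := n) c' A := by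
  rw [chartVolume_apply c hA, chartVolume_apply c' hA]
  set φ := chartAt (𝔼 n) c
  set ψ := chartAt (𝔼 n) c'
  have himg : ψ.target ∩ ψ.symm ⁻¹' A = (ψ ∘ φ.symm) '' (φ.target ∩ φ.symm ⁻¹' A) := by
    ext y
    constructor
    · rintro ⟨hy, hyA⟩
      refine ⟨φ (ψ.symm y), ⟨φ.map_source (h hyA), ?_⟩, ?_⟩
      · simpa [φ.left_inv (h hyA)] using hyA
      · simp [φ.left_inv (h hyA), ψ.right_inv hy]
    · rintro ⟨z, ⟨hz, hzA⟩, rfl⟩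
      refine ⟨ψ.map_source (h' hzA), ?_⟩
      simpa [ψ.left_inv (h' hzA)] using hzA
  rw [himg, lintegral_image_eq_lintegral_abs_det_fderiv_mul volume
    (measurableSet_target_inter (n := n) c hA)
    (fun y hy ↦ (differentiableAt_transition hy.1 (h' hy.2)).hasFDerivAt.hasFDerivWithinAt)]
  · refine setLIntegral_congr_fun (measurableSet_target_inter (n := n) c hA) fun y hy ↦ ?_
    have := frameDensity_change hy.1 (h' hy.2)
    simp only [Function.comp_apply]
    rw [this, ψ.left_inv (h' hy.2), ENNReal.ofReal_mul (abs_nonneg _)]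
  · intro y hy z hz hyz
    have := ψ.injOn (h' hy.2) (h' hz.2) hyz
    exact φ.symm.injOn hy.1 hz.1 this

lemma chartVolume_inter_source (c : M) {A : Set M} (hA : MeasurableSet A) :
    chartVolume (n := n) c (A ∩ (chartAt (𝔼 n) c).source) = chartVolume (n := n) c A := by
  rw [chartVolume_apply c hA, chartVolume_apply c
    (hA.inter (chartAt (𝔼 n) c).open_source.measurableSet)]
  congr 2
  ext y
  constructor
  · rintro ⟨h1, h2⟩; exact ⟨h1, h2.1⟩
  · rintro ⟨h1, h2⟩; exact ⟨h1, h2, (chartAt (𝔼 n) c).map_target h1⟩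

/-- A supremum of measures is not computed set by set, so the upper bound needs a comparison measure
that dominates every `chartVolume c'`. -/
lemma riemannianVolume_apply_of_subset (c : M) {A : Set M} (hA : MeasurableSet A)
    (h : A ⊆ (chartAt (𝔼 n) c).source) : riemannianVolume n M A = chartVolume (n := n) c A := by
  have hle : ∀ c', chartVolume (n := n) c' ≤ riemannianVolume n M :=
    fun c' ↦ le_iSup (fun c : M ↦ chartVolume (n := n) c) c'
  have hs := (chartAt (𝔼 n) c).open_source.measurableSet
  refine le_antisymm ?_ (hle c A)
  -- The comparison measure is `chartVolume c` on the source of the chart and the Riemannian measure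
  -- itself off it. On the source, `chartVolume c'` is controlled by agreement on overlaps.
  have hν : riemannianVolume n M ≤ chartVolume (n := n) c +
      (riemannianVolume n M).restrict (chartAt (𝔼 n) c).sourceᶜ := by
    refine iSup_le fun c' ↦ Measure.le_iff.2 fun B hB ↦ ?_
    rw [← measure_inter_add_sdiff B hs, Measure.add_apply, Measure.restrict_apply hB]
    refine add_le_add ?_ (hle c' _)
    have hs' := (chartAt (𝔼 n) c').open_source.measurableSet
    rw [← chartVolume_inter_source c' (hB.inter hs),
      chartVolume_eq_of_subset (c := c') (c' := c) ((hB.inter hs).inter hs') inter_subset_right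
        (inter_subset_left.trans inter_subset_right)]
    exact measure_mono (inter_subset_left.trans inter_subset_left)
  refine (hν A).trans ?_
  rw [Measure.add_apply, Measure.restrict_apply hA]
  have : A ∩ (chartAt (𝔼 n) c).sourceᶜ = ∅ := by
    rw [← Set.sdiff_eq, sdiff_eq_empty.2 h]
  rw [this, measure_empty, add_zero]

lemma riemannianVolume_restrict_source (c : M) :
    (riemannianVolume n M).restrict (chartAt (𝔼 n) c).source = chartVolume (n := n) c := by
  ext A hA
  rw [Measure.restrict_apply hA, riemannianVolume_apply_of_subset c
    (hA.inter (chartAt (𝔼 n) c).open_source.measurableSet) inter_subset_right,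
    chartVolume_inter_source c hA]

variable [IsContMDiffRiemannianBundle (𝓡 n) ∞ (𝔼 n) (fun x : M ↦ TangentSpace (𝓡 n) x)]

omit [MeasurableSpace M] [BorelSpace M] in
lemma continuousOn_frameDensity_symm (c : M) (b : Module.Basis (Fin n) ℝ (𝔼 n)) :
    ContinuousOn (fun y ↦ frameDensity c b ((chartAt (𝔼 n) c).symm y)) (chartAt (𝔼 n) c).target :=
  fun _ hy ↦ (ContinuousAt.comp (g := frameDensity c b)
    (contMDiffAt_frameDensity ((chartAt (𝔼 n) c).map_target hy) b).continuousAt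
    ((chartAt (𝔼 n) c).continuousAt_symm hy)).continuousWithinAt

/-- The density is continuous, hence bounded on a small closed coordinate ball. -/
instance isLocallyFiniteMeasure_riemannianVolume :
    IsLocallyFiniteMeasure (riemannianVolume n M) := by
  refine ⟨fun x ↦ ?_⟩
  set φ := chartAt (𝔼 n) x with hφ
  have hx := mem_chart_source (𝔼 n) x
  obtain ⟨r, hr, hball⟩ := Metric.nhds_basis_closedBall.mem_iff.1
    (φ.open_target.mem_nhds (φ.map_source hx))
  have hU : IsOpen (φ.source ∩ φ ⁻¹' Metric.ball (φ x) r) := φ.isOpen_inter_preimage Metric.isOpen_ball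
  refine ⟨_, hU.mem_nhds ⟨hx, Metric.mem_ball_self hr⟩, ?_⟩
  rw [riemannianVolume_apply_of_subset x hU.measurableSet inter_subset_left,
    chartVolume_apply x hU.measurableSet]
  obtain ⟨C, hC⟩ := (isCompact_closedBall (φ x) r).exists_bound_of_continuousOn
    ((continuousOn_frameDensity_symm x (stdFrame n)).mono hball)
  have hsub : φ.target ∩ φ.symm ⁻¹' (φ.source ∩ φ ⁻¹' Metric.ball (φ x) r) ⊆
      Metric.closedBall (φ x) r := by
    rintro y ⟨hy, -, hy'⟩
    rw [mem_preimage, φ.right_inv hy] at hy'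
    exact Metric.ball_subset_closedBall hy'
  calc _ ≤ ∫⁻ y in Metric.closedBall (φ x) r,
        ENNReal.ofReal (frameDensity x (stdFrame n) (φ.symm y)) := lintegral_mono_set hsub
    _ ≤ ∫⁻ y in Metric.closedBall (φ x) r, ENNReal.ofReal C :=
        setLIntegral_mono measurable_const fun y hy ↦
          ENNReal.ofReal_le_ofReal ((le_abs_self _).trans (hC y hy))
    _ < ⊤ := by
        rw [setLIntegral_const]
        exact ENNReal.mul_lt_top ENNReal.ofReal_lt_top measure_closedBall_lt_top

/-- The density is strictly positive, and nonempty open sets have positive Lebesgue measure. -/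
instance isOpenPosMeasure_riemannianVolume : (riemannianVolume n M).IsOpenPosMeasure := by
  refine ⟨fun U hU ⟨x, hxU⟩ h0 ↦ ?_⟩
  set φ := chartAt (𝔼 n) x with hφ
  have hx := mem_chart_source (𝔼 n) x
  have hU' : IsOpen (U ∩ φ.source) := hU.inter φ.open_source
  have h1 := measure_mono_null (inter_subset_left : U ∩ φ.source ⊆ U) h0
  rw [riemannianVolume_apply_of_subset x hU'.measurableSet inter_subset_right,
    chartVolume_apply x hU'.measurableSet, lintegral_eq_zero_iff'] at h1
  · have ho : IsOpen (φ.target ∩ φ.symm ⁻¹' (U ∩ φ.source)) := φ.isOpen_inter_preimage_symm hU'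
    have h2 : ∀ᵐ y ∂(volume.restrict (φ.target ∩ φ.symm ⁻¹' (U ∩ φ.source))), False := by
      filter_upwards [h1, ae_restrict_mem ho.measurableSet] with y hy hy'
      have := frameDensity_pos hy'.2.2 (stdFrame n)
      rw [Pi.zero_apply, ENNReal.ofReal_eq_zero] at hy
      exact absurd this (not_lt.2 hy)
    rw [eventually_false_iff_eq_bot, ae_eq_bot, Measure.restrict_eq_zero] at h2
    refine (ho.measure_pos volume ⟨φ x, φ.map_source hx, ?_⟩).ne' h2
    rw [mem_preimage, φ.left_inv hx]
    exact ⟨hxU, hx⟩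
  · exact (((continuousOn_frameDensity_symm x (stdFrame n)).mono inter_subset_left).aemeasurable
      (measurableSet_target_inter x hU'.measurableSet)).ennreal_ofReal

lemma integral_riemannianVolume_eq (c : M) {f : M → ℝ} (hf : ∀ x ∉ (chartAt (𝔼 n) c).source, f x = 0)
    (hfc : ContinuousOn f (chartAt (𝔼 n) c).source) :
    ∫ x, f x ∂(riemannianVolume n M) = ∫ y in (chartAt (𝔼 n) c).target,
      frameDensity c (stdFrame n) ((chartAt (𝔼 n) c).symm y) * f ((chartAt (𝔼 n) c).symm y) := by
  rw [← setIntegral_eq_integral_of_forall_compl_eq_zero hf]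
  have hs := (chartAt (𝔼 n) c).open_source.measurableSet
  have ht := (chartAt (𝔼 n) c).open_target.measurableSet
  have hac := aemeasurable_chart_symm (n := n) c
  have hfm : AEStronglyMeasurable f (chartVolume (n := n) c) := by
    rw [← riemannianVolume_restrict_source]
    exact hfc.aestronglyMeasurable hs
  have hd : AEMeasurable (fun y ↦ ENNReal.ofReal (Real.sqrt (metricMatrix c y).det))
      (volume.restrict (chartAt (𝔼 n) c).target) := by
    have h1 := ((continuousOn_frameDensity_symm c (stdFrame n)).aemeasurable
      ht (μ := volume)).ennreal_ofReal
    refine h1.congr ?_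
    filter_upwards [ae_restrict_mem ht] with y hy
    rw [sqrt_det_metricMatrix c hy]
  rw [riemannianVolume_restrict_source]
  unfold chartVolume at hfm ⊢
  rw [integral_map (hac.mono_ac (withDensity_absolutelyContinuous _ _)) hfm,
    integral_withDensity_eq_integral_toReal_smul₀ hd (Eventually.of_forall fun _ ↦
      ENNReal.ofReal_lt_top)]
  refine setIntegral_congr_fun ht fun y hy ↦ ?_
  simp only [sqrt_det_metricMatrix c hy, smul_eq_mul]
  rw [ENNReal.toReal_ofReal (show 0 ≤ frameDensity c (stdFrame n) _ from Real.sqrt_nonneg _)]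

end Volume

/-! ### Derivatives of determinant and inverse at the identity matrix. -/

section Calculus

variable {ι : Type*} [Fintype ι] [DecidableEq ι]

lemma hasDerivAt_det_of_eq_one {A : ℝ → Matrix ι ι ℝ} {A' : Matrix ι ι ℝ} (h0 : A 0 = 1)
    (h : ∀ i j, HasDerivAt (fun t ↦ A t i j) (A' i j) 0) :
    HasDerivAt (fun t ↦ (A t).det) A'.trace 0 := by
  simp only [Matrix.det_apply']
  have h1 := HasDerivAt.fun_sum fun s (_ : s ∈ (Finset.univ : Finset (Equiv.Perm ι))) ↦
    (HasDerivAt.fun_finsetProd fun i (_ : i ∈ Finset.univ) ↦ h (s i) i).const_mul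
      ((Equiv.Perm.sign s : ℤ) : ℝ)
  refine h1.congr_deriv ?_
  simp only [h0, Finset.mul_sum]
  rw [Finset.sum_comm, Matrix.trace]
  refine Finset.sum_congr rfl fun i _ ↦ ?_
  -- Differentiating the `i`-th factors of the Leibniz expansion gives the determinant of the
  -- identity with column `i` replaced; Cramer's rule evaluates it.
  have h2 : ((1 : Matrix ι ι ℝ).updateCol i (fun j ↦ A' j i)).det = A' i i := by
    rw [← Matrix.cramer_apply, Matrix.cramer_one]
    rfl
  rw [Matrix.diag_apply, ← h2, Matrix.det_apply']
  refine Finset.sum_congr rfl fun s _ ↦ ?_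
  rw [← Finset.mul_prod_erase _ _ (Finset.mem_univ i), Matrix.updateCol_self, smul_eq_mul,
    mul_comm (A' (s i) i)]
  congr 2
  refine Finset.prod_congr rfl fun j hj ↦ ?_
  rw [Matrix.updateCol_ne (Finset.ne_of_mem_erase hj)]

/-- Differentiate `A A⁻¹ = 1`, which holds near `0` because the determinant stays nonzero there. -/
lemma hasDerivAt_inv_of_eq_one {A : ℝ → Matrix ι ι ℝ} {A' B' : Matrix ι ι ℝ} (h0 : A 0 = 1)
    (h : ∀ i j, HasDerivAt (fun t ↦ A t i j) (A' i j) 0)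
    (hB : ∀ i j, HasDerivAt (fun t ↦ (A t)⁻¹ i j) (B' i j) 0) : B' = -A' := by
  ext i j
  have h1 := HasDerivAt.fun_sum fun k (_ : k ∈ Finset.univ) ↦ (h i k).mul (hB k j)
  have h2 : (fun t ↦ ∑ k, A t i k * (A t)⁻¹ k j) =ᶠ[𝓝 0] fun _ ↦ (1 : Matrix ι ι ℝ) i j := by
    have hdet := (hasDerivAt_det_of_eq_one h0 h).continuousAt.eventually_ne (y := 0)
      (by simp [h0])
    filter_upwards [hdet] with t ht
    rw [← Matrix.mul_apply, Matrix.mul_nonsing_inv _ (isUnit_iff_ne_zero.2 ht)]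
  have h3 := h1.unique ((hasDerivAt_const (0 : ℝ) ((1 : Matrix ι ι ℝ) i j)).congr_of_eventuallyEq h2)
  simp only [h0, inv_one, Matrix.one_apply, Finset.sum_add_distrib, mul_ite, mul_one, mul_zero,
    ite_mul, one_mul, zero_mul, Finset.sum_ite_eq, Finset.sum_ite_eq', Finset.mem_univ,
    if_true] at h3
  rw [Matrix.neg_apply]
  linarith

lemma hasDerivAt_sqrt_det_mul_inv_of_eq_one {A : ℝ → Matrix ι ι ℝ} {A' B' : Matrix ι ι ℝ}
    (h0 : A 0 = 1) (h : ∀ i j, HasDerivAt (fun t ↦ A t i j) (A' i j) 0)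
    (hB : ∀ i j, HasDerivAt (fun t ↦ (A t)⁻¹ i j) (B' i j) 0) (i j : ι) :
    HasDerivAt (fun t ↦ Real.sqrt (A t).det * (A t)⁻¹ i j)
      (1 / 2 * A'.trace * (1 : Matrix ι ι ℝ) i j - A' i j) 0 := by
  have h1 := ((hasDerivAt_det_of_eq_one h0 h).sqrt (by simp [h0])).mul (hB i j)
  refine h1.congr_deriv ?_
  rw [hasDerivAt_inv_of_eq_one h0 h hB]
  simp [h0]
  ring

end Calculus

/-! ### Coordinate derivatives of `√g gⁱʲ` and the divergence theorem in a chart. -/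

section Divergence

variable {n : ℕ} {M : Type*} [TopologicalSpace M] [ChartedSpace (𝔼 n) M] [IsManifold (𝓡 n) ∞ M]

lemma hasDerivAt_chart_line {c x : M} (hx : x ∈ (chartAt (𝔼 n) c).source) {f : M → ℝ}
    (hf : MDifferentiableAt (𝓡 n) 𝓘(ℝ, ℝ) f x) (w : 𝔼 n) :
    HasDerivAt (fun t : ℝ ↦ f ((chartAt (𝔼 n) c).symm (chartAt (𝔼 n) c x + t • w)))
      (mvfderiv (𝓡 n) f x (chartFrame c w x)) 0 := by
  set φ := chartAt (𝔼 n) c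
  have h1 : DifferentiableAt ℝ (f ∘ φ.symm) (φ x) := by
    rw [← mdifferentiableAt_iff_differentiableAt]
    refine MDifferentiableAt.comp (I' := 𝓡 n) (φ x) ?_
      (mdifferentiableAt_chart_symm (φ.map_source hx))
    rwa [φ.left_inv hx]
  rw [mvfderiv_chartFrame w hf hx]
  have h2 : HasDerivAt (fun t : ℝ ↦ φ x + t • w) w 0 := by
    simpa using ((hasDerivAt_id (0 : ℝ)).smul_const w).const_add (φ x)
  exact h1.hasFDerivAt.comp_hasDerivAt_of_eq 0 h2 (by simp)

variable [RiemannianBundle (fun x : M ↦ TangentSpace (𝓡 n) x)]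
  [IsContMDiffRiemannianBundle (𝓡 n) ∞ (𝔼 n) (fun x : M ↦ TangentSpace (𝓡 n) x)]

/-- The coefficients of the divergence in the frame with constant components `b i`. -/
def cometricDensity (c : M) (b : Fin n → 𝔼 n) (i j : Fin n) (x : M) : ℝ :=
  frameDensity c b x * (frameGram c b x)⁻¹ i j

omit [IsContMDiffRiemannianBundle (𝓡 n) ∞ (𝔼 n) (fun x : M ↦ TangentSpace (𝓡 n) x)] in
lemma cometricDensity_normalBasis_self (c : M) (i j : Fin n) :
    cometricDensity c (normalBasis (n := n) c) i j c = (1 : Matrix (Fin n) (Fin n) ℝ) i j := by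
  simp [cometricDensity, frameDensity, frameGram_normalBasis_self]

lemma contMDiffAt_cometricDensity {c x : M} (hx : x ∈ (chartAt (𝔼 n) c).source)
    (b : Module.Basis (Fin n) ℝ (𝔼 n)) (i j : Fin n) :
    ContMDiffAt (𝓡 n) 𝓘(ℝ, ℝ) ∞ (cometricDensity c b i j) x :=
  (contMDiffAt_frameDensity hx b).mul (contMDiffAt_frameGram_inv hx b i j)

/-- Restricting to the coordinate line through `c` in direction `w` reduces this to matrices
depending on one variable and equal to the identity at time `0`. -/
lemma mvfderiv_cometricDensity_self (c : M) (i j : Fin n) (w : 𝔼 n) :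
    mvfderiv (𝓡 n) (cometricDensity c (normalBasis (n := n) c) i j) c (chartFrame c w c) =
      1 / 2 * (∑ k, mvfderiv (𝓡 n) (fun y ↦ frameGram c (normalBasis (n := n) c) y k k) c
        (chartFrame c w c)) * (1 : Matrix (Fin n) (Fin n) ℝ) i j -
      mvfderiv (𝓡 n) (fun y ↦ frameGram c (normalBasis (n := n) c) y i j) c (chartFrame c w c) := by
  have hc := mem_chart_source (𝔼 n) c
  set b := normalBasis (n := n) c
  have hG := fun i j ↦ hasDerivAt_chart_line hc
    ((contMDiffAt_frameGram hc b i j).mdifferentiableAt (by simp)) w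
  have hI := fun i j ↦ hasDerivAt_chart_line hc
    ((contMDiffAt_frameGram_inv hc b i j).mdifferentiableAt (by simp)) w
  have hR := hasDerivAt_chart_line hc
    ((contMDiffAt_cometricDensity hc b i j).mdifferentiableAt (by simp)) w
  have h0 : frameGram c b ((chartAt (𝔼 n) c).symm (chartAt (𝔼 n) c c + (0 : ℝ) • w)) = 1 := by
    rw [zero_smul, add_zero, (chartAt (𝔼 n) c).left_inv hc, frameGram_normalBasis_self]
  exact hR.unique (hasDerivAt_sqrt_det_mul_inv_of_eq_one
    (A' := Matrix.of fun i j ↦ mvfderiv (𝓡 n) (fun y ↦ frameGram c b y i j) c (chartFrame c w c))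
    (B' := Matrix.of fun i j ↦ mvfderiv (𝓡 n) (fun y ↦ (frameGram c b y)⁻¹ i j) c (chartFrame c w c))
    h0 hG hI i j)

omit [RiemannianBundle (fun x : M ↦ TangentSpace (𝓡 n) x)]
  [IsContMDiffRiemannianBundle (𝓡 n) ∞ (𝔼 n) (fun x : M ↦ TangentSpace (𝓡 n) x)] in
-- In coordinates `h`, extended by zero, is a compactly supported `C¹` function on Euclidean space,
-- and a directional derivative of such a function integrates to zero: integrate by parts against
-- the constant `1`.
lemma integrableOn_mvfderiv_chartFrame_and_integral_eq_zero [T2Space M] {c : M} {h : M → ℝ}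
    (hh : ContMDiff (𝓡 n) 𝓘(ℝ, ℝ) ∞ h) (hc : HasCompactSupport h)
    (hs : tsupport h ⊆ (chartAt (𝔼 n) c).source) (w : 𝔼 n) :
    IntegrableOn (fun y ↦ (mvfderiv (𝓡 n) h ((chartAt (𝔼 n) c).symm y)
      (chartFrame c w ((chartAt (𝔼 n) c).symm y)) : ℝ)) (chartAt (𝔼 n) c).target ∧
    ∫ y in (chartAt (𝔼 n) c).target, (mvfderiv (𝓡 n) h ((chartAt (𝔼 n) c).symm y)
      (chartFrame c w ((chartAt (𝔼 n) c).symm y)) : ℝ) = 0 := by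
  set φ := chartAt (𝔼 n) c with hφ
  set H : 𝔼 n → ℝ := φ.target.indicator (h ∘ φ.symm) with hH
  have hK : IsCompact (φ '' tsupport h) :=
    IsCompact.image_of_continuousOn hc (φ.continuousOn.mono hs)
  have hsupp : ∀ y, y ∉ φ '' tsupport h → H y = 0 := by
    intro y hy
    by_cases hyt : y ∈ φ.target
    · rw [hH, indicator_of_mem hyt]
      exact image_eq_zero_of_notMem_tsupport (f := h) fun hm ↦ hy ⟨_, hm, φ.right_inv hyt⟩
    · rw [hH, indicator_of_notMem hyt]
  have heq : ∀ y ∈ φ.target, H =ᶠ[𝓝 y] h ∘ φ.symm := fun y hy ↦ by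
    filter_upwards [φ.open_target.mem_nhds hy] with z hz
    rw [hH, indicator_of_mem hz]
  have hd : ContDiff ℝ 1 H := by
    rw [contDiff_iff_contDiffAt]
    intro y
    by_cases hy : y ∈ φ '' tsupport h
    · have hyt : y ∈ φ.target := by
        obtain ⟨x, hx, rfl⟩ := hy
        exact φ.map_source (hs hx)
      refine ContDiffAt.congr_of_eventuallyEq ?_ (heq y hyt)
      rw [← contMDiffAt_iff_contDiffAt]
      refine ContMDiffAt.comp (I' := 𝓡 n) y (hh.contMDiffAt.of_le (by norm_num)) ?_
      exact (contMDiffOn_chart_symm.of_le (by norm_num : (1 : ℕ∞ω) ≤ ∞)).contMDiffAt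
        (φ.open_target.mem_nhds hyt)
    · refine (contDiffAt_const (c := (0 : ℝ))).congr_of_eventuallyEq ?_
      filter_upwards [hK.isClosed.isOpen_compl.mem_nhds hy] with z hz
      exact hsupp z hz
  have hHc : HasCompactSupport H := HasCompactSupport.intro hK hsupp
  have hI : Integrable fun y ↦ fderiv ℝ H y w :=
    ((hd.continuous_fderiv one_ne_zero).clm_apply continuous_const).integrable_of_hasCompactSupport
      (hHc.fderiv_apply ℝ w)
  have h1 : ∫ y, fderiv ℝ H y w = 0 := by
    have := integral_mul_fderiv_eq_neg_fderiv_mul_of_integrable (μ := (volume : Measure (𝔼 n)))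
      (f := fun _ ↦ (1 : ℝ)) (g := H) (v := w)
      (by simp)
      (by simpa only [one_mul] using hI)
      (by simpa using hd.continuous.integrable_of_hasCompactSupport hHc)
      (fun _ _ ↦ differentiableAt_const _) (fun y _ ↦ hd.differentiable one_ne_zero y)
    simpa using this
  have h2 : EqOn (fun y ↦ (mvfderiv (𝓡 n) h (φ.symm y) (chartFrame c w (φ.symm y)) : ℝ))
      (fun y ↦ fderiv ℝ H y w) φ.target := fun y hy ↦ by
    have h3 := mvfderiv_chartFrame (c := c) (x := φ.symm y) w
      (hh.contMDiffAt.mdifferentiableAt (by simp)) (φ.map_target hy)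
    change mvfderiv (𝓡 n) h (φ.symm y) (chartFrame c w (φ.symm y)) = fderiv ℝ H y w
    rw [h3, (heq y hy).fderiv_eq]
    congr 2
    exact φ.right_inv hy
  refine ⟨(integrableOn_congr_fun h2 φ.open_target.measurableSet).2 hI.integrableOn, ?_⟩
  rw [← h1, ← setIntegral_eq_integral_of_forall_compl_eq_zero (s := φ.target)
    (f := fun y ↦ fderiv ℝ H y w)]
  · exact setIntegral_congr_fun φ.open_target.measurableSet h2
  · intro y hy
    have : H =ᶠ[𝓝 y] fun _ ↦ 0 := by
      have : y ∉ φ '' tsupport h := by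
        rintro ⟨x, hx, rfl⟩
        exact hy (φ.map_source (hs hx))
      filter_upwards [hK.isClosed.isOpen_compl.mem_nhds this] with z hz
      exact hsupp z hz
    rw [this.fderiv_eq]
    simp

end Divergence

/-! ### The Levi-Civita connection at the centre of a chart. -/

section Koszul

variable {n : ℕ} {M : Type*} [TopologicalSpace M] [ChartedSpace (𝔼 n) M] [IsManifold (𝓡 n) ∞ M]

lemma mpullbackWithin_chartFrame (c : M) (w : 𝔼 n) :
    VectorField.mpullbackWithin 𝓘(ℝ, 𝔼 n) (𝓡 n) (extChartAt (𝓡 n) c).symm (chartFrame c w)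
      (range (𝓡 n)) =ᶠ[𝓝 (extChartAt (𝓡 n) c c)] fun _ ↦ w := by
  have ht : (chartAt (𝔼 n) c).target ∈ 𝓝 (extChartAt (𝓡 n) c c) := by
    have := (chartAt (𝔼 n) c).open_target.mem_nhds
      ((chartAt (𝔼 n) c).map_source (mem_chart_source (𝔼 n) c))
    simpa using this
  filter_upwards [ht] with y hy
  have hy' : y ∈ (extChartAt (𝓡 n) c).target := by simpa using hy
  have hinv := isInvertible_mfderivWithin_extChartAt_symm (I := 𝓡 n) hy'
  have h1 : chartFrame c w ((extChartAt (𝓡 n) c).symm y) =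
      mfderivWithin 𝓘(ℝ, 𝔼 n) (𝓡 n) (extChartAt (𝓡 n) c).symm (range (𝓡 n)) y w := by
    have hs : (chartAt (𝔼 n) c).symm y ∈ (chartAt (𝔼 n) c).source := (chartAt (𝔼 n) c).map_target hy
    have h2 := chartFrame_eq_mfderiv w hs
    have hr : chartAt (𝔼 n) c ((chartAt (𝔼 n) c).symm y) = y := (chartAt (𝔼 n) c).right_inv hy
    rw [hr] at h2
    have h3 : ⇑(extChartAt (𝓡 n) c).symm = ⇑(chartAt (𝔼 n) c).symm := by ext; simp
    rw [ModelWithCorners.range_eq_univ, mfderivWithin_univ, h3]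
    exact h2
  rw [VectorField.mpullbackWithin_apply, h1]
  exact hinv.inverse_apply_eq.2 rfl

lemma lieBracketWithin_eq_zero_of_eventuallyEq_const {E : Type*} [NormedAddCommGroup E]
    [NormedSpace ℝ E] {A B : E → E} {a b x : E} {s : Set E} (hA : A =ᶠ[𝓝 x] fun _ ↦ a)
    (hB : B =ᶠ[𝓝 x] fun _ ↦ b) (hs : s = univ) :
    VectorField.lieBracketWithin ℝ A B s x = 0 := by
  rw [hs, VectorField.lieBracketWithin_univ, hA.lieBracket_vectorField_eq hB]
  simp [VectorField.lieBracket]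

/-- The bracket at `c` is computed in the chart at `c`, where both fields are constant. -/
lemma mlieBracket_chartFrame_self (c : M) (w w' : 𝔼 n) :
    VectorField.mlieBracket (𝓡 n) (chartFrame c w) (chartFrame c w') c = 0 := by
  rw [← VectorField.mlieBracketWithin_univ, VectorField.mlieBracketWithin_apply]
  exact (congrArg _ (lieBracketWithin_eq_zero_of_eventuallyEq_const (mpullbackWithin_chartFrame c w)
    (mpullbackWithin_chartFrame c w') (by simp))).trans (map_zero _)

variable [RiemannianBundle (fun x : M ↦ TangentSpace (𝓡 n) x)]

/-- With vanishing brackets the Koszul formula leaves the Christoffel symbol of the first kind `∂ᵢ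
gᵢⱼ - ½ ∂ⱼ gᵢᵢ`. -/
lemma koszul_chartFrame_self (c : M) (i j : Fin n) :
    koszul (chartFrame c (normalBasis (n := n) c i)) (chartFrame c (normalBasis (n := n) c i))
      (chartFrame c (normalBasis (n := n) c j)) c =
    mvfderiv (𝓡 n) (fun y ↦ frameGram c (normalBasis (n := n) c) y i j) c
        (chartFrame c (normalBasis (n := n) c i) c) -
      1 / 2 * mvfderiv (𝓡 n) (fun y ↦ frameGram c (normalBasis (n := n) c) y i i) c
        (chartFrame c (normalBasis (n := n) c j) c) := by
  have h : (fun y ↦ inner ℝ (chartFrame c (normalBasis (n := n) c j) y)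
      (chartFrame c (normalBasis (n := n) c i) y)) =
      fun y ↦ inner ℝ (chartFrame c (normalBasis (n := n) c i) y)
      (chartFrame c (normalBasis (n := n) c j) y) := by
    ext y; exact real_inner_comm _ _
  simp only [koszul, mlieBracket_chartFrame_self, inner_zero_left, h, frameGram, Matrix.gram_apply]
  ring

lemma leviCivita_chartFrame_self (c : M) (i : Fin n) :
    leviCivita (chartFrame c (normalBasis (n := n) c i)) (chartFrame c (normalBasis (n := n) c i)) c =
    ∑ j, (mvfderiv (𝓡 n) (fun y ↦ frameGram c (normalBasis (n := n) c) y i j) c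
        (chartFrame c (normalBasis (n := n) c i) c) -
      1 / 2 * mvfderiv (𝓡 n) (fun y ↦ frameGram c (normalBasis (n := n) c) y i i) c
        (chartFrame c (normalBasis (n := n) c j) c)) • chartFrame c (normalBasis (n := n) c j) c := by
  rw [leviCivita, ← (finCongr (finrank_tangentSpace_eq (n := n) c)).sum_comp]
  refine Finset.sum_congr rfl fun j _ ↦ ?_
  rw [extend_tangentBasis, koszul_chartFrame_self, chartFrame_normalBasis_self]

end Koszul

/-! ### The rough Laplacian in divergence form. -/

section Flux

/-- The index bookkeeping for the comparison of Laplacians: `N j i` stands for `∇ᵢ∇ⱼσ`, `E j` for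
`∇ⱼσ`, and `T i j k` for `∂ₖ gᵢⱼ`, at a point where `g` is the identity. -/
lemma sum_sub_sum_smul_eq {ι W : Type*} [Fintype ι] [DecidableEq ι] [AddCommGroup W] [Module ℝ W]
    (N : ι → ι → W) (E : ι → W) (T : ι → ι → ι → ℝ)
    (hT : ∀ i j k, T i j k = T j i k) :
    ∑ k, (N k k - ∑ j, (T k j k - 1 / 2 * T k k j) • E j) =
      ∑ i, ∑ j, ((1 : Matrix ι ι ℝ) j i • N j i +
        (1 / 2 * (∑ k, T k k i) * (1 : Matrix ι ι ℝ) j i - T j i i) • E j) := by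
  have h1 : ∀ i, ∑ j, ((1 : Matrix ι ι ℝ) j i • N j i +
      (1 / 2 * (∑ k, T k k i) * (1 : Matrix ι ι ℝ) j i - T j i i) • E j) =
      N i i + ((1 / 2 * ∑ k, T k k i) • E i - ∑ j, T j i i • E j) := fun i ↦ by
    simp only [Matrix.one_apply, Finset.sum_add_distrib, sub_smul, Finset.sum_sub_distrib, ite_smul,
      one_smul, zero_smul, mul_ite, mul_one, mul_zero, Finset.sum_ite_eq', Finset.mem_univ, if_true]
  have h2 : ∑ k, ∑ j, (1 / 2 * T k k j) • E j = ∑ i, (1 / 2 * ∑ k, T k k i) • E i := by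
    rw [Finset.sum_comm]
    exact Finset.sum_congr rfl fun i _ ↦ by rw [Finset.mul_sum, Finset.sum_smul]
  have h3 : ∑ k, ∑ j, T k j k • E j = ∑ i, ∑ j, T j i i • E j :=
    Finset.sum_congr rfl fun i _ ↦ Finset.sum_congr rfl fun j _ ↦ by rw [hT]
  rw [Finset.sum_congr rfl fun i _ ↦ h1 i]
  simp only [sub_smul, Finset.sum_add_distrib, Finset.sum_sub_distrib]
  rw [h2, h3]
  abel

variable {n : ℕ} {M : Type*} [TopologicalSpace M] [ChartedSpace (𝔼 n) M] [IsManifold (𝓡 n) ∞ M]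
  [RiemannianBundle (fun x : M ↦ TangentSpace (𝓡 n) x)]
  {F : Type*} [NormedAddCommGroup F] [NormedSpace ℝ F]
  {V : M → Type*} [TopologicalSpace (TotalSpace F V)]
  [∀ x, NormedAddCommGroup (V x)] [∀ x, InnerProductSpace ℝ (V x)]
  [FiberBundle F V] (nabla : CovariantDerivative (𝓡 n) F V)

/-- The components of `√(det g) ∇σ`, with raised index, in the frame with constant components
`b i`. -/
def flux (c : M) (b : Fin n → 𝔼 n) (σ : Π x : M, V x) (i : Fin n) (x : M) : V x :=
  ∑ j, cometricDensity c b j i x • nabla σ x (chartFrame c (b j) x)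

/-- The rough Laplacian in divergence form, in the frame with constant components `b i`. -/
def coordLaplacian (c : M) (b : Fin n → 𝔼 n) (σ : Π x : M, V x) (x : M) : V x :=
  -((frameDensity c b x)⁻¹ • ∑ i, nabla (flux nabla c b σ i) x (chartFrame c (b i) x))

variable [VectorBundle ℝ F V] [T2Space M] [FiniteDimensional ℝ F] [ContMDiffVectorBundle ∞ F V (𝓡 n)]
  [CovariantDerivative.ContMDiffCovariantDerivative nabla ∞]

lemma contMDiffAt_nabla_chartFrame_section {σ : Π x : M, V x} (hσ : IsSmoothSection n F σ) {c x : M}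
    (hx : x ∈ (chartAt (𝔼 n) c).source) (w : 𝔼 n) :
    ContMDiffAt (𝓡 n) ((𝓡 n).prod 𝓘(ℝ, F)) ∞
      (fun y ↦ (⟨y, nabla σ y (chartFrame c w y)⟩ : TotalSpace F V)) x :=
  ((IsFamilyAt.of_section (t := 0) (hσ x)).nabla_chartFrame nabla hx w).section

variable [IsContMDiffRiemannianBundle (𝓡 n) ∞ (𝔼 n) (fun x : M ↦ TangentSpace (𝓡 n) x)]

lemma isFamilyAt_flux {σ : Π x : M, V x} (hσ : IsSmoothSection n F σ) {c x : M}
    (hx : x ∈ (chartAt (𝔼 n) c).source) (b : Module.Basis (Fin n) ℝ (𝔼 n)) (i : Fin n) (t : ℝ) :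
    IsFamilyAt n F ∞ (fun _ ↦ flux nabla c b σ i) x t :=
  IsFamilyAt.sum fun j _ ↦ IsFamilyAt.smul (f := fun z : M × ℝ ↦ cometricDensity c b j i z.1)
    (ContMDiffAt.comp (I' := 𝓡 n) (g := cometricDensity c b j i) (f := fun z : M × ℝ ↦ z.1) (x, t)
      (contMDiffAt_cometricDensity hx b j i) contMDiffAt_fst)
    ((IsFamilyAt.of_section (hσ x)).nabla_chartFrame nabla hx (b j))

lemma isFamilyAt_coordLaplacian {σ : Π x : M, V x} (hσ : IsSmoothSection n F σ) {c x : M}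
    (hx : x ∈ (chartAt (𝔼 n) c).source) (b : Module.Basis (Fin n) ℝ (𝔼 n)) (t : ℝ) :
    IsFamilyAt n F ∞ (fun _ ↦ coordLaplacian nabla c b σ) x t := by
  have h1 : IsFamilyAt n F ∞ (fun _ y ↦ (-(frameDensity c b y)⁻¹) • ∑ i,
      nabla (flux nabla c b σ i) y (chartFrame c (b i) y)) x t :=
    IsFamilyAt.smul (f := fun z : M × ℝ ↦ -(frameDensity c b z.1)⁻¹)
      (ContMDiffAt.comp (I' := 𝓡 n) (g := fun y ↦ -(frameDensity c b y)⁻¹)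
        (f := fun z : M × ℝ ↦ z.1) (x, t)
        ((contMDiffAt_frameDensity hx b).inv₀ (frameDensity_pos hx b).ne').neg contMDiffAt_fst)
      (IsFamilyAt.sum fun i _ ↦ (isFamilyAt_flux nabla hσ hx b i t).nabla_chartFrame nabla hx (b i))
  refine h1.congr (Eventually.of_forall fun z ↦ ?_)
  rw [coordLaplacian, neg_smul]

lemma nabla_flux {σ : Π x : M, V x} (hσ : IsSmoothSection n F σ) {c x : M}
    (hx : x ∈ (chartAt (𝔼 n) c).source) (b : Module.Basis (Fin n) ℝ (𝔼 n)) (i : Fin n)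
    (u : TangentSpace (𝓡 n) x) :
    nabla (flux nabla c b σ i) x u = ∑ j, (cometricDensity c b j i x •
      nabla (fun y ↦ nabla σ y (chartFrame c (b j) y)) x u +
      (mvfderiv (𝓡 n) (cometricDensity c b j i) x u : ℝ) • nabla σ x (chartFrame c (b j) x)) := by
  have := nabla_sum_smul (x := x) nabla Finset.univ (f := fun j ↦ cometricDensity c b j i)
    (S := fun j y ↦ nabla σ y (chartFrame c (b j) y))
    (fun j _ ↦ (contMDiffAt_cometricDensity hx b j i).mdifferentiableAt (by simp))
    (fun j _ ↦ (contMDiffAt_nabla_chartFrame_section nabla hσ hx (b j)).mdifferentiableAt (by simp))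
  have h2 := congrArg (fun L : TangentSpace (𝓡 n) x →L[ℝ] V x ↦ L u) this
  simp only [sum_apply, add_apply, smul_apply, ContinuousLinearMap.smulRight_apply] at h2
  exact h2

/-- At the centre `√g = 1` and `g` is the identity, so the derivatives of `√g gⁱʲ` in the divergence
are exactly the Christoffel corrections `∇_{∇_{Eᵢ} Eᵢ} σ` of the trace. -/
lemma roughLaplacian_eq_coordLaplacian_self {σ : Π x : M, V x} (hσ : IsSmoothSection n F σ) (c : M) :
    roughLaplacian nabla σ c = coordLaplacian nabla c (normalBasis (n := n) c) σ c := by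
  have hc := mem_chart_source (𝔼 n) c
  have hd : frameDensity c (normalBasis (n := n) c) c = 1 := by
    simp [frameDensity, frameGram_normalBasis_self]
  rw [roughLaplacian, coordLaplacian, hd, inv_one, one_smul]
  congr 1
  obtain ⟨N, hN⟩ : ∃ N : Fin n → Fin n → V c, N = fun j i ↦
      nabla (fun y ↦ nabla σ y (chartFrame c (normalBasis (n := n) c j) y)) c
        (chartFrame c (normalBasis (n := n) c i) c) := ⟨_, rfl⟩
  obtain ⟨T, hT⟩ : ∃ T : Fin n → Fin n → Fin n → ℝ, T = fun i j k ↦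
    mvfderiv (𝓡 n) (fun y ↦ frameGram c (normalBasis (n := n) c) y i j) c
      (chartFrame c (normalBasis (n := n) c k) c) := ⟨_, rfl⟩
  obtain ⟨E, hE⟩ : ∃ E : Fin n → V c, E = fun j ↦
    nabla σ c (chartFrame c (normalBasis (n := n) c j) c) := ⟨_, rfl⟩
  obtain ⟨g, hg⟩ : ∃ g : Fin n → V c, g = fun k ↦
    N k k - ∑ j, (T k j k - 1 / 2 * T k k j) • E j := ⟨_, rfl⟩
  have h1 : ∀ i, (let X : Π y : M, TangentSpace (𝓡 n) y :=
      FiberBundle.extend (𝔼 n) (tangentBasis c i)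
      nabla (fun y ↦ nabla σ y (X y)) c (X c) - nabla σ c (leviCivita X X c)) =
      g (finCongr (finrank_tangentSpace_eq c) i) := by
    intro i
    simp only [extend_tangentBasis]
    rw [leviCivita_chartFrame_self, map_sum]
    simp only [map_smul, hg, hN, hT, hE]
  refine (Finset.sum_congr rfl fun i _ ↦ h1 i).trans
    ((Equiv.sum_comp (finCongr (finrank_tangentSpace_eq c)) g).trans ?_)
  have hsymm : ∀ i j k, T i j k = T j i k := fun i j k ↦ by
    simp only [hT, frameGram, Matrix.gram_apply, real_inner_comm]
  rw [hg, sum_sub_sum_smul_eq N E T hsymm]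
  refine Finset.sum_congr rfl fun i _ ↦ ?_
  rw [nabla_flux nabla hσ hc]
  refine Finset.sum_congr rfl fun j _ ↦ ?_
  rw [cometricDensity_normalBasis_self, mvfderiv_cometricDensity_self, hN, hT, hE]

end Flux

/-! ### Functions vanishing off a closed or compact set. -/

section Support

variable {X : Type*} [TopologicalSpace X]

lemma continuous_of_forall_mem {f : X → ℝ} {K : Set X} (hK : IsClosed K)
    (hf : ∀ x ∈ K, ContinuousAt f x) (h0 : ∀ x ∉ K, f x = 0) : Continuous f := by
  rw [continuous_iff_continuousAt]
  intro x
  by_cases hx : x ∈ K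
  · exact hf x hx
  · refine (continuousAt_const (y := (0 : ℝ))).congr ?_
    filter_upwards [hK.isOpen_compl.mem_nhds hx] with y hy
    exact (h0 y hy).symm

lemma integrable_of_forall_mem [T2Space X] [MeasurableSpace X] [OpensMeasurableSpace X]
    {μ : Measure X} [IsFiniteMeasureOnCompacts μ] {f : X → ℝ} {K : Set X} (hK : IsCompact K)
    (hf : ∀ x ∈ K, ContinuousAt f x) (h0 : ∀ x ∉ K, f x = 0) : Integrable f μ :=
  (continuous_of_forall_mem hK.isClosed hf h0).integrable_of_hasCompactSupport
    (HasCompactSupport.intro hK h0)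

end Support

/-! ### Integration by parts within one chart. -/

section WeakFormula

variable {n : ℕ} {M : Type*} [TopologicalSpace M] [ChartedSpace (𝔼 n) M] [IsManifold (𝓡 n) ∞ M]

/-- The fundamental lemma: if `g x₀ > 0`, a bump function supported where `g` is positive gives a
positive integral, because the measure charges open sets. The case `g x₀ < 0` is the same for `-g`.
-/
lemma eq_zero_of_forall_bump [T2Space M] [MeasurableSpace M] [BorelSpace M] (μ : Measure M)
    [IsFiniteMeasureOnCompacts μ] [μ.IsOpenPosMeasure] {g : M → ℝ} {U : Set M} {x₀ : M}
    (hU : U ∈ 𝓝 x₀) (hg : ∀ x ∈ U, ContinuousAt g x)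
    (h : ∀ χ : SmoothBumpFunction (𝓡 n) x₀, tsupport χ ⊆ U → ∫ x, χ x * g x ∂μ = 0) :
    g x₀ = 0 := by
  have key : ∀ g : M → ℝ, (∀ x ∈ U, ContinuousAt g x) →
      (∀ χ : SmoothBumpFunction (𝓡 n) x₀, tsupport χ ⊆ U → ∫ x, χ x * g x ∂μ = 0) →
      ¬ 0 < g x₀ := by
    intro g hg h hpos
    obtain ⟨χ, -, hχ⟩ := (SmoothBumpFunction.nhds_basis_tsupport (I := 𝓡 n) x₀).mem_iff.1
      (inter_mem hU ((hg x₀ (mem_of_mem_nhds hU)).eventually (lt_mem_nhds hpos)))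
    have hc : Continuous fun x ↦ χ x * g x :=
      continuous_of_forall_mem (isClosed_tsupport χ)
        (fun x hx ↦ χ.contMDiff.continuous.continuousAt.mul (hg x (hχ hx).1))
        (fun x hx ↦ by rw [image_eq_zero_of_notMem_tsupport hx, zero_mul])
    have h1 := hc.integral_pos_of_hasCompactSupport_nonneg_nonzero (μ := μ) (x := x₀)
      (HasCompactSupport.intro χ.hasCompactSupport
        (fun x hx ↦ by rw [image_eq_zero_of_notMem_tsupport hx, zero_mul]))
      (fun x ↦ by
        by_cases hx : x ∈ tsupport χ
        · exact mul_nonneg χ.nonneg (hχ hx).2.le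
        · simp [image_eq_zero_of_notMem_tsupport hx])
      (by simp [hpos.ne'])
    exact h1.ne' (h χ fun x hx ↦ (hχ hx).1)
  refine le_antisymm (not_lt.1 (key g hg h)) ?_
  have := not_lt.1 (key (fun x ↦ -g x) (fun x hx ↦ (hg x hx).neg) fun χ hχ ↦ by
    simp [integral_neg, h χ hχ])
  linarith

variable {F : Type*} [NormedAddCommGroup F] [NormedSpace ℝ F]
  {V : M → Type*} [TopologicalSpace (TotalSpace F V)]
  [∀ x, NormedAddCommGroup (V x)] [∀ x, InnerProductSpace ℝ (V x)]
  [FiberBundle F V] (nabla : CovariantDerivative (𝓡 n) F V) [VectorBundle ℝ F V]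

lemma isSmoothSection_of_forall_mem {v : Π x : M, V x} {K : Set M} (hK : IsClosed K)
    (hv : ∀ x ∈ K, ContMDiffAt (𝓡 n) ((𝓡 n).prod 𝓘(ℝ, F)) ∞ (fun y ↦ (⟨y, v y⟩ : TotalSpace F V)) x)
    (h0 : ∀ x ∉ K, v x = 0) : IsSmoothSection n F v := by
  intro x
  by_cases hx : x ∈ K
  · exact hv x hx
  · refine ((contMDiff_zeroSection ℝ V).contMDiffAt (x := x)).congr_of_eventuallyEq ?_
    filter_upwards [hK.isOpen_compl.mem_nhds hx] with y hy
    rw [h0 y hy]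
    rfl

lemma nabla_eq_zero_of_notMem {v : Π x : M, V x} (hv : IsSmoothSection n F v) {K : Set M}
    (hK : IsClosed K) (h0 : ∀ x ∉ K, v x = 0) {x : M} (hx : x ∉ K) : nabla v x = 0 := by
  refine Eq.trans ?_ (congrFun nabla.zero x)
  refine nabla.isCovariantDerivativeOnUniv.congr_of_eventuallyEq
    (hv.contMDiffAt.mdifferentiableAt (by simp)) (mdifferentiableAt_zeroSection ..) univ_mem ?_
  filter_upwards [hK.isOpen_compl.mem_nhds hx] with y hy
  exact h0 y hy

variable [RiemannianBundle (fun x : M ↦ TangentSpace (𝓡 n) x)]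

lemma nablaInner_eq_zero_of_notMem (σ : Π x : M, V x) {v : Π x : M, V x} (hv : IsSmoothSection n F v)
    {K : Set M} (hK : IsClosed K) (h0 : ∀ x ∉ K, v x = 0) {x : M} (hx : x ∉ K) :
    nablaInner nabla σ v x = 0 := by
  simp [nablaInner, nabla_eq_zero_of_notMem nabla hv hK h0 hx]

variable [FiniteDimensional ℝ F] [ContMDiffVectorBundle ∞ F V (𝓡 n)]
  [IsContMDiffRiemannianBundle (𝓡 n) ∞ F V]

lemma mvfderiv_inner_eq {nabla : CovariantDerivative (𝓡 n) F V} (hnabla : nabla.IsMetricCompatible)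
    {σ τ : Π x : M, V x} {x : M}
    (hσ : ContMDiffAt (𝓡 n) ((𝓡 n).prod 𝓘(ℝ, F)) ∞ (fun y ↦ (⟨y, σ y⟩ : TotalSpace F V)) x)
    (hτ : ContMDiffAt (𝓡 n) ((𝓡 n).prod 𝓘(ℝ, F)) ∞ (fun y ↦ (⟨y, τ y⟩ : TotalSpace F V)) x)
    (u : TangentSpace (𝓡 n) x) :
    mvfderiv (𝓡 n) (fun y ↦ inner ℝ (σ y) (τ y)) x u =
      inner ℝ (nabla σ x u) (τ x) + inner ℝ (σ x) (nabla τ x u) := by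
  have := hnabla.mvfderiv_inner_eq (FiberBundle.extend (𝔼 n) u)
    (hσ.mdifferentiableAt (by simp)) (hτ.mdifferentiableAt (by simp))
  simpa only [FiberBundle.extend_apply_self] using this

/-- Differentiate the constant function `|σ|²`. -/
lemma inner_nabla_self_eq_zero {nabla : CovariantDerivative (𝓡 n) F V}
    (hnabla : nabla.IsMetricCompatible) {σ : Π x : M, V x} (hσ : IsSmoothSection n F σ) {k : ℝ}
    (hk : ∀ x, ‖σ x‖ = k) (x : M) (u : TangentSpace (𝓡 n) x) :
    inner ℝ (nabla σ x u) (σ x) = 0 := by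
  have h1 := mvfderiv_inner_eq hnabla (hσ x) (hσ x) u
  have h2 : (fun y ↦ inner ℝ (σ y) (σ y)) = fun _ ↦ k ^ 2 := by
    ext y; rw [real_inner_self_eq_norm_sq, hk]
  rw [h2, real_inner_comm (σ x)] at h1
  have h3 : mvfderiv (𝓡 n) (fun _ : M ↦ k ^ 2) x u = 0 := by
    rw [mvfderiv_const]
    rfl
  have h4 : inner ℝ (nabla σ x u) (σ x) + inner ℝ (nabla σ x u) (σ x) = 0 := by
    rw [← h3, h1, real_inner_comm]
  linarith

variable [T2Space M] [CovariantDerivative.ContMDiffCovariantDerivative nabla ∞]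
  [IsContMDiffRiemannianBundle (𝓡 n) ∞ (𝔼 n) (fun x : M ↦ TangentSpace (𝓡 n) x)]

lemma continuousAt_nablaInner {σ τ : Π x : M, V x} (hσ : IsSmoothSection n F σ)
    (hτ : IsSmoothSection n F τ) (x : M) : ContinuousAt (nablaInner nabla σ τ) x :=
  ContinuousAt.comp (g := fun z : M × ℝ ↦ nablaInner nabla σ τ z.1) (f := fun y : M ↦ (y, (0 : ℝ)))
    (contMDiffAt_nablaInner nabla (IsFamilyAt.of_section (hσ x)) (IsFamilyAt.of_section (hτ x)) :
      ContMDiffAt _ _ ∞ (fun z : M × ℝ ↦ nablaInner nabla σ τ z.1) (x, 0)).continuousAt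
    (by fun_prop)

omit [T2Space M] [CovariantDerivative.ContMDiffCovariantDerivative nabla ∞]
  [IsContMDiffRiemannianBundle (𝓡 n) ∞ (𝔼 n) (fun x : M ↦ TangentSpace (𝓡 n) x)]
  [RiemannianBundle (fun x : M ↦ TangentSpace (𝓡 n) x)]
  [FiniteDimensional ℝ F] [ContMDiffVectorBundle ∞ F V (𝓡 n)] in
lemma continuousAt_inner {σ τ : Π x : M, V x} {x : M}
    (hσ : ContMDiffAt (𝓡 n) ((𝓡 n).prod 𝓘(ℝ, F)) ∞ (fun y ↦ (⟨y, σ y⟩ : TotalSpace F V)) x)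
    (hτ : ContMDiffAt (𝓡 n) ((𝓡 n).prod 𝓘(ℝ, F)) ∞ (fun y ↦ (⟨y, τ y⟩ : TotalSpace F V)) x) :
    ContinuousAt (fun y ↦ (inner ℝ (σ y) (τ y) : ℝ)) x :=
  (ContMDiffAt.inner_bundle hσ hτ).continuousAt

/-- The coordinate divergence of `⟨flux, v⟩` splits by metric compatibility: differentiating `v`
yields `√g ⟨∇σ,∇v⟩`, differentiating the flux yields `-√g ⟨coordLaplacian, v⟩`. -/
lemma sum_mvfderiv_inner_flux {nabla : CovariantDerivative (𝓡 n) F V}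
    [CovariantDerivative.ContMDiffCovariantDerivative nabla ∞]
    (hnabla : nabla.IsMetricCompatible) {σ v : Π x : M, V x} (hσ : IsSmoothSection n F σ)
    (hv : IsSmoothSection n F v) {c x : M}
    (hx : x ∈ (chartAt (𝔼 n) c).source) (b : Module.Basis (Fin n) ℝ (𝔼 n)) :
    ∑ i, (mvfderiv (𝓡 n) (fun y ↦ inner ℝ (flux nabla c b σ i y) (v y)) x (chartFrame c (b i) x) : ℝ) =
      frameDensity c b x *
        (nablaInner nabla σ v x - inner ℝ (coordLaplacian nabla c b σ x) (v x)) := by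
  have hρ := (frameDensity_pos hx b).ne'
  have h1 := fun i ↦ mvfderiv_inner_eq hnabla ((isFamilyAt_flux nabla hσ hx b i 0).section) (hv x)
    (chartFrame c (b i) x)
  rw [Finset.sum_congr rfl fun i _ ↦ h1 i, Finset.sum_add_distrib, ← sum_inner]
  have h2 : ∑ i, nabla (flux nabla c b σ i) x (chartFrame c (b i) x) =
      -(frameDensity c b x • coordLaplacian nabla c b σ x) := by
    rw [coordLaplacian, smul_neg, neg_neg, smul_inv_smul₀ hρ]
  have h3 : nablaInner nabla σ v x = ∑ i, ∑ j, (frameGram c b x)⁻¹ i j *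
      inner ℝ (nabla σ x (chartFrame c (b i) x)) (nabla v x (chartFrame c (b j) x)) :=
    sum_tangentBasis_eq hx b ((innerₗ (V x)).compl₁₂ (nabla σ x).toLinearMap (nabla v x).toLinearMap)
  have h4 : ∑ i, inner ℝ (flux nabla c b σ i x) (nabla v x (chartFrame c (b i) x)) =
      frameDensity c b x * nablaInner nabla σ v x := by
    rw [h3, Finset.sum_comm, Finset.mul_sum]
    refine Finset.sum_congr rfl fun i _ ↦ ?_
    rw [flux, sum_inner, Finset.mul_sum]
    refine Finset.sum_congr rfl fun j _ ↦ ?_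
    rw [real_inner_smul_left, cometricDensity, mul_assoc]
  rw [h2, h4, inner_neg_left, real_inner_smul_left]
  ring

variable [MeasurableSpace M] [BorelSpace M]

lemma integral_nablaInner_sub_coordLaplacian {nabla : CovariantDerivative (𝓡 n) F V}
    [CovariantDerivative.ContMDiffCovariantDerivative nabla ∞]
    (hnabla : nabla.IsMetricCompatible) {σ v : Π x : M, V x} (hσ : IsSmoothSection n F σ)
    (hv : IsSmoothSection n F v) {K : Set M} (hK : IsCompact K) (h0 : ∀ x ∉ K, v x = 0) {c : M}
    (hKc : K ⊆ (chartAt (𝔼 n) c).source) (b : Module.Basis (Fin n) ℝ (𝔼 n)) :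
    ∫ x, (nablaInner nabla σ v x - inner ℝ (coordLaplacian nabla c b σ x) (v x))
      ∂(riemannianVolume n M) = 0 := by
  set φ := chartAt (𝔼 n) c
  rw [integral_riemannianVolume_eq c
    (f := fun x ↦ nablaInner nabla σ v x - inner ℝ (coordLaplacian nabla c b σ x) (v x))
    (fun x hx ↦ by
      have hxK : x ∉ K := fun h ↦ hx (hKc h)
      rw [nablaInner_eq_zero_of_notMem nabla σ hv hK.isClosed h0 hxK, h0 x hxK, inner_zero_right,
        sub_zero])
    (fun x hx ↦ ((continuousAt_nablaInner nabla hσ hv x).sub (continuousAt_inner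
      (isFamilyAt_coordLaplacian nabla hσ hx b 0).section (hv x))).continuousWithinAt)]
  have hi := fun i ↦ integrableOn_mvfderiv_chartFrame_and_integral_eq_zero (c := c)
    (h := fun y ↦ (inner ℝ (flux nabla c b σ i y) (v y) : ℝ))
    (fun x ↦ by
      by_cases hx : x ∈ K
      · exact ContMDiffAt.inner_bundle (isFamilyAt_flux nabla hσ (hKc hx) b i 0).section (hv x)
      · refine (contMDiffAt_const (c := (0 : ℝ))).congr_of_eventuallyEq ?_
        filter_upwards [hK.isClosed.isOpen_compl.mem_nhds hx] with y hy
        rw [h0 y hy, inner_zero_right])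
    (HasCompactSupport.intro hK fun x hx ↦ by rw [h0 x hx, inner_zero_right])
    ((closure_minimal (fun x hx ↦ by
      by_contra hxK
      exact hx (by simp only [h0 x hxK, inner_zero_right])) hK.isClosed).trans hKc) (b i)
  -- The measure uses the density of the standard frame and the divergence that of `b`; within one
  -- chart they differ by a constant factor.
  have h1 : EqOn (fun y ↦ frameDensity c (stdFrame n) (φ.symm y) * (nablaInner nabla σ v (φ.symm y) -
      inner ℝ (coordLaplacian nabla c b σ (φ.symm y)) (v (φ.symm y))))
      (fun y ↦ |(b.toMatrix (stdFrame n)).det| * ∑ i, (mvfderiv (𝓡 n)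
        (fun y ↦ inner ℝ (flux nabla c b σ i y) (v y)) (φ.symm y)
        (chartFrame c (b i) (φ.symm y)) : ℝ)) φ.target := fun y hy ↦ by
    have hx : φ.symm y ∈ φ.source := φ.map_target hy
    have h2 := sum_mvfderiv_inner_flux hnabla hσ hv hx b
    have h3 := frameDensity_eq_mul hx (stdFrame n) b
    refine Eq.trans ?_ (congrArg _ h2.symm)
    simp only [h3]
    ring
  rw [setIntegral_congr_fun φ.open_target.measurableSet h1, integral_const_mul,
    integral_finsetSum _ fun i _ ↦ (hi i).1, Finset.sum_eq_zero fun i _ ↦ (hi i).2, mul_zero]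

end WeakFormula

/-! ### The rough Laplacian as global formal adjoint. -/

section RoughLaplacian

variable {n : ℕ} {M : Type*} [TopologicalSpace M] [T2Space M] [ChartedSpace (𝔼 n) M]
  [IsManifold (𝓡 n) ∞ M]
  [MeasurableSpace M] [BorelSpace M]
  [RiemannianBundle (fun x : M ↦ TangentSpace (𝓡 n) x)]
  [IsContMDiffRiemannianBundle (𝓡 n) ∞ (𝔼 n) (fun x : M ↦ TangentSpace (𝓡 n) x)]
  {F : Type*} [NormedAddCommGroup F] [NormedSpace ℝ F] [FiniteDimensional ℝ F]
  {V : M → Type*} [TopologicalSpace (TotalSpace F V)]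
  [∀ x, NormedAddCommGroup (V x)] [∀ x, InnerProductSpace ℝ (V x)]
  [FiberBundle F V] [VectorBundle ℝ F V] [ContMDiffVectorBundle ∞ F V (𝓡 n)]
  [IsContMDiffRiemannianBundle (𝓡 n) ∞ F V]
  {nabla : CovariantDerivative (𝓡 n) F V}
  [CovariantDerivative.ContMDiffCovariantDerivative nabla ∞]

/-- A section which is smooth near `x₀` and orthogonal, in the `L²` sense, to its products with bump
functions, vanishes at `x₀`. -/
lemma eq_zero_of_forall_bump_smul {A : Π x : M, V x} {U : Set M} {x₀ : M} (hU : U ∈ 𝓝 x₀)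
    (hA : ∀ x ∈ U, ContMDiffAt (𝓡 n) ((𝓡 n).prod 𝓘(ℝ, F)) ∞ (fun y ↦ (⟨y, A y⟩ : TotalSpace F V)) x)
    (h : ∀ (v : Π x : M, V x) (K : Set M), IsCompact K → K ⊆ U → IsSmoothSection n F v →
      (∀ x ∉ K, v x = 0) → ∫ x, inner ℝ (A x) (v x) ∂(riemannianVolume n M) = 0) : A x₀ = 0 := by
  have h1 : inner ℝ (A x₀) (A x₀) = (0 : ℝ) := by
    refine eq_zero_of_forall_bump (n := n) (riemannianVolume n M) (g := fun x ↦ inner ℝ (A x) (A x)) hU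
      (fun x hx ↦ continuousAt_inner (hA x hx) (hA x hx)) fun χ hχ ↦ ?_
    have h0 : ∀ x ∉ tsupport χ, χ x • A x = 0 := fun x hx ↦ by
      rw [image_eq_zero_of_notMem_tsupport hx, zero_smul]
    have h2 := h (fun x ↦ χ x • A x) (tsupport χ) χ.hasCompactSupport hχ
      (isSmoothSection_of_forall_mem (n := n) (isClosed_tsupport χ)
        (fun x hx ↦ χ.contMDiff.contMDiffAt.smul_section (hA x (hχ hx))) h0) h0
    simpa only [real_inner_smul_right] using h2
  exact inner_self_eq_zero.1 h1

lemma integrable_nablaInner {σ v : Π x : M, V x} (hσ : IsSmoothSection n F σ)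
    (hv : IsSmoothSection n F v) {K : Set M} (hK : IsCompact K) (h0 : ∀ x ∉ K, v x = 0) :
    Integrable (nablaInner nabla σ v) (riemannianVolume n M) :=
  integrable_of_forall_mem hK (fun x _ ↦ continuousAt_nablaInner nabla hσ hv x)
    (fun _ hx ↦ nablaInner_eq_zero_of_notMem nabla σ hv hK.isClosed h0 hx)

lemma integrable_inner {A v : Π x : M, V x} {K : Set M} (hK : IsCompact K)
    (hA : ∀ x ∈ K, ContMDiffAt (𝓡 n) ((𝓡 n).prod 𝓘(ℝ, F)) ∞ (fun y ↦ (⟨y, A y⟩ : TotalSpace F V)) x)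
    (hv : IsSmoothSection n F v) (h0 : ∀ x ∉ K, v x = 0) :
    Integrable (fun x ↦ (inner ℝ (A x) (v x) : ℝ)) (riemannianVolume n M) :=
  integrable_of_forall_mem hK (fun x hx ↦ continuousAt_inner (hA x hx) (hv x))
    (fun x hx ↦ by rw [h0 x hx, inner_zero_right])

lemma integral_nablaInner_eq_coordLaplacian (hnabla : nabla.IsMetricCompatible) {σ v : Π x : M, V x}
    (hσ : IsSmoothSection n F σ)
    (hv : IsSmoothSection n F v) {K : Set M} (hK : IsCompact K) (h0 : ∀ x ∉ K, v x = 0) {c : M}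
    (hKc : K ⊆ (chartAt (𝔼 n) c).source) (b : Module.Basis (Fin n) ℝ (𝔼 n)) :
    ∫ x, nablaInner nabla σ v x ∂(riemannianVolume n M) =
      ∫ x, inner ℝ (coordLaplacian nabla c b σ x) (v x) ∂(riemannianVolume n M) := by
  rw [← sub_eq_zero, ← integral_sub (integrable_nablaInner hσ hv hK h0)
    (integrable_inner hK (fun x hx ↦ (isFamilyAt_coordLaplacian nabla hσ (hKc hx) b 0).section) hv h0)]
  exact integral_nablaInner_sub_coordLaplacian hnabla hσ hv hK h0 hKc b

/-- In the domain of a chart, the rough Laplacian is given by the divergence formula. -/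
lemma roughLaplacian_eq_coordLaplacian (hnabla : nabla.IsMetricCompatible) {σ : Π x : M, V x}
    (hσ : IsSmoothSection n F σ) {c x : M} (hx : x ∈ (chartAt (𝔼 n) c).source)
    (b : Module.Basis (Fin n) ℝ (𝔼 n)) :
    roughLaplacian nabla σ x = coordLaplacian nabla c b σ x := by
  rw [roughLaplacian_eq_coordLaplacian_self nabla hσ, ← sub_eq_zero]
  have hU : (chartAt (𝔼 n) x).source ∩ (chartAt (𝔼 n) c).source ∈ 𝓝 x :=
    inter_mem (chart_source_mem_nhds _ x) ((chartAt (𝔼 n) c).open_source.mem_nhds hx)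
  have h1 := fun y (hy : y ∈ (chartAt (𝔼 n) x).source) ↦
    (isFamilyAt_coordLaplacian nabla hσ hy (normalBasis (n := n) x) 0).section
  have h2 := fun y (hy : y ∈ (chartAt (𝔼 n) c).source) ↦
    (isFamilyAt_coordLaplacian nabla hσ hy b 0).section
  -- On the overlap both coordinate expressions represent the functional `v ↦ ∫ ⟨∇σ,∇v⟩`, so they
  -- agree. This avoids transforming the formula between charts.
  refine eq_zero_of_forall_bump_smul (A := fun y ↦ coordLaplacian nabla x (normalBasis (n := n) x) σ y -
    coordLaplacian nabla c b σ y) hU (fun y hy ↦ (h1 y hy.1).sub_section (h2 y hy.2)) ?_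
  intro v K hK hKU hv h0
  simp only [inner_sub_left]
  rw [integral_sub (integrable_inner hK (fun y hy ↦ h1 y (hKU hy).1) hv h0)
    (integrable_inner hK (fun y hy ↦ h2 y (hKU hy).2) hv h0),
    ← integral_nablaInner_eq_coordLaplacian hnabla hσ hv hK h0 (fun y hy ↦ (hKU hy).1),
    ← integral_nablaInner_eq_coordLaplacian hnabla hσ hv hK h0 (fun y hy ↦ (hKU hy).2), sub_self]

/-- The definition uses a separate choice of basis and extensions at each point; smoothness becomes
visible only through one coordinate expression valid on a whole chart. -/
lemma isSmoothSection_roughLaplacian (hnabla : nabla.IsMetricCompatible) {σ : Π x : M, V x}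
    (hσ : IsSmoothSection n F σ) : IsSmoothSection n F (roughLaplacian nabla σ) := by
  intro x
  refine (isFamilyAt_coordLaplacian nabla hσ (mem_chart_source (𝔼 n) x)
    (normalBasis (n := n) x) 0).section.congr_of_eventuallyEq ?_
  filter_upwards [chart_source_mem_nhds (𝔼 n) x] with y hy
  rw [roughLaplacian_eq_coordLaplacian hnabla hσ hy (normalBasis (n := n) x)]

omit [T2Space M] [MeasurableSpace M] [BorelSpace M] [IsContMDiffRiemannianBundle (𝓡 n) ∞ F V]
  [IsContMDiffRiemannianBundle (𝓡 n) ∞ (𝔼 n) (fun x : M ↦ TangentSpace (𝓡 n) x)]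
  [CovariantDerivative.ContMDiffCovariantDerivative nabla ∞] [FiniteDimensional ℝ F]
  [ContMDiffVectorBundle ∞ F V (𝓡 n)] in
lemma nablaInner_add (σ : Π x : M, V x) {v w : Π x : M, V x} (hv : IsSmoothSection n F v)
    (hw : IsSmoothSection n F w) (x : M) :
    nablaInner nabla σ (fun y ↦ v y + w y) x = nablaInner nabla σ v x + nablaInner nabla σ w x := by
  have h : nabla (fun y ↦ v y + w y) x = nabla v x + nabla w x :=
    nabla.isCovariantDerivativeOnUniv.add (hv.contMDiffAt.mdifferentiableAt (by simp))
      (hw.contMDiffAt.mdifferentiableAt (by simp))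
  simp only [nablaInner, h, add_apply, inner_add_right, Finset.sum_add_distrib]

/-- The rough Laplacian is the formal adjoint of the connection composed with the connection. -/
theorem integral_nablaInner_eq_roughLaplacian [SecondCountableTopology M]
    (hnabla : nabla.IsMetricCompatible) {σ v : Π x : M, V x} (hσ : IsSmoothSection n F σ)
    (hv : IsSmoothSection n F v) {K : Set M} (hK : IsCompact K) (h0 : ∀ x ∉ K, v x = 0) :
    ∫ x, nablaInner nabla σ v x ∂(riemannianVolume n M) =
      ∫ x, inner ℝ (roughLaplacian nabla σ x) (v x) ∂(riemannianVolume n M) := by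
  classical
  have : LocallyCompactSpace M := ChartedSpace.locallyCompactSpace (𝔼 n) M
  have hL := isSmoothSection_roughLaplacian hnabla hσ
  obtain ⟨ρ, hρ⟩ := SmoothPartitionOfUnity.exists_isSubordinate_chartAt_source (𝓡 n) M
  -- Only finitely many `ρ i` meet `K`, so `v` is a finite sum of the sections `ρ i • v`, each
  -- supported in one chart.
  have hfin := ρ.locallyFinite.finite_nonempty_inter_compact hK
  have key : ∀ s : Finset M, IsSmoothSection n F (fun x ↦ ∑ i ∈ s, ρ i x • v x) ∧
      ∫ x, nablaInner nabla σ (fun x ↦ ∑ i ∈ s, ρ i x • v x) x ∂(riemannianVolume n M) =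
      ∫ x, inner ℝ (roughLaplacian nabla σ x) (∑ i ∈ s, ρ i x • v x) ∂(riemannianVolume n M) := by
    intro s
    induction s using Finset.induction_on with
    | empty =>
      have hz : IsSmoothSection n F fun x : M ↦ (0 : V x) := contMDiff_zeroSection ℝ V
      have h1 : ∀ x, nablaInner nabla σ (fun x ↦ (0 : V x)) x = 0 := fun x ↦
        nablaInner_eq_zero_of_notMem nabla σ hz isClosed_empty (fun _ _ ↦ rfl) (notMem_empty x)
      simp only [Finset.sum_empty, h1, inner_zero_right]
      exact ⟨hz, trivial⟩
    | insert i s hi ih =>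
      simp only [Finset.sum_insert hi]
      have hi0 : ∀ x ∉ tsupport (ρ i) ∩ K, ρ i x • v x = 0 := by
        intro x hx
        by_cases hxK : x ∈ K
        · rw [image_eq_zero_of_notMem_tsupport fun h ↦ hx ⟨h, hxK⟩, zero_smul]
        · rw [h0 x hxK, smul_zero]
      have hs0 : ∀ x ∉ K, ∑ i ∈ s, ρ i x • v x = 0 := fun x hx ↦ by simp [h0 x hx]
      have hiv : IsSmoothSection n F fun x ↦ ρ i x • v x := fun x ↦
        ((ρ i).contMDiff.contMDiffAt (x := x)).smul_section (hv x)
      have hiK : IsCompact (tsupport (ρ i) ∩ K) := hK.inter_left (isClosed_tsupport _)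
      refine ⟨fun x ↦ (hiv x).add_section (ih.1 x), ?_⟩
      simp only [nablaInner_add σ hiv ih.1, inner_add_right]
      rw [integral_add (integrable_nablaInner hσ hiv hiK hi0) (integrable_nablaInner hσ ih.1 hK hs0),
        integral_add (integrable_inner hiK (fun x _ ↦ hL x) hiv hi0)
          (integrable_inner hK (fun x _ ↦ hL x) ih.1 hs0), ih.2,
        integral_nablaInner_eq_coordLaplacian hnabla hσ hiv hiK hi0
          (fun x hx ↦ hρ i hx.1) (normalBasis (n := n) i)]
      congr 2
      ext x
      by_cases hx : x ∈ (chartAt (𝔼 n) i).source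
      · rw [roughLaplacian_eq_coordLaplacian hnabla hσ hx (normalBasis (n := n) i)]
      · rw [hi0 x fun h ↦ hx (hρ i h.1), inner_zero_right, inner_zero_right]
  have hsum : (fun x ↦ ∑ i ∈ hfin.toFinset, ρ i x • v x) = v := by
    ext x
    by_cases hx : x ∈ K
    · rw [← Finset.sum_smul, ← finsum_eq_sum_of_support_subset, ρ.sum_eq_one (mem_univ x), one_smul]
      intro i hi
      simp only [Finite.coe_toFinset, mem_ofPred_eq]
      exact ⟨x, hi, hx⟩
    · simp [h0 x hx]
  have := (key hfin.toFinset).2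
  rw [hsum] at this
  rw [this]
  refine integral_congr_ae (Eventually.of_forall fun x ↦ ?_)
  exact congrArg _ (congrFun hsum x)

end RoughLaplacian

/-! ### Normalised curves in a sphere. -/

section Normalized

variable {W : Type*} [NormedAddCommGroup W] [InnerProductSpace ℝ W] {k : ℝ}

/-- By Pythagoras the radicand is `|a + t b|²`. Written in this form it is visibly positive for all
`t`, so the curve is defined for all times. -/
lemma norm_normalized {a b : W}
    (hk : 0 < k) (ha : ‖a‖ = k) (hab : inner ℝ a b = (0 : ℝ)) (t : ℝ) :
    ‖(k / Real.sqrt (k ^ 2 + t ^ 2 * inner ℝ b b)) • (a + t • b)‖ = k := by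
  have hpos : 0 < k ^ 2 + t ^ 2 * inner ℝ b b := by
    have := real_inner_self_nonneg (x := b)
    positivity
  have h1 : ‖a + t • b‖ = Real.sqrt (k ^ 2 + t ^ 2 * inner ℝ b b) := by
    rw [norm_eq_sqrt_real_inner, real_inner_add_add_self, real_inner_self_eq_norm_sq, ha,
      real_inner_smul_right, hab, real_inner_smul_left, real_inner_smul_right]
    congr 1
    ring
  rw [norm_smul, h1, Real.norm_eq_abs, abs_of_pos (div_pos hk (Real.sqrt_pos.2 hpos)),
    div_mul_cancel₀ _ (Real.sqrt_pos.2 hpos).ne']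

/-- The scalar factor depends on `t` only through `t²`, so it does not contribute to first order. -/
lemma hasDerivAt_normalized (a b : W)
    (hk : 0 < k) :
    HasDerivAt (fun t : ℝ ↦ (k / Real.sqrt (k ^ 2 + t ^ 2 * inner ℝ b b)) • (a + t • b)) b 0 := by
  have h1 : HasDerivAt (fun t : ℝ ↦ k ^ 2 + t ^ 2 * (inner ℝ b b : ℝ)) 0 0 := by
    simpa using ((hasDerivAt_pow 2 (0 : ℝ)).mul_const (inner ℝ b b : ℝ)).const_add (k ^ 2)
  have h2 : HasDerivAt (fun t : ℝ ↦ k / Real.sqrt (k ^ 2 + t ^ 2 * inner ℝ b b)) 0 0 := by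
    have := (hasDerivAt_const (0 : ℝ) k).div (h1.sqrt (by simp [hk.ne']))
      (by simp [Real.sqrt_sq hk.le, hk.ne'])
    exact this.congr_deriv (by simp)
  have h3 : HasDerivAt (fun t : ℝ ↦ a + t • b) b 0 := by
    simpa using ((hasDerivAt_id (0 : ℝ)).smul_const b).const_add a
  refine (h2.smul h3).congr_deriv ?_
  simp [Real.sqrt_sq hk.le, hk.ne']

end Normalized

/-! ### Stationarity as a weak equation. -/

section FirstVariation

variable {n : ℕ} {M : Type*} [TopologicalSpace M] [T2Space M] [SecondCountableTopology M]
  [ChartedSpace (𝔼 n) M] [IsManifold (𝓡 n) ∞ M]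
  [MeasurableSpace M] [BorelSpace M]
  [RiemannianBundle (fun x : M ↦ TangentSpace (𝓡 n) x)]
  [IsContMDiffRiemannianBundle (𝓡 n) ∞ (𝔼 n) (fun x : M ↦ TangentSpace (𝓡 n) x)]
  {F : Type*} [NormedAddCommGroup F] [NormedSpace ℝ F] [FiniteDimensional ℝ F]
  {V : M → Type*} [TopologicalSpace (TotalSpace F V)]
  [∀ x, NormedAddCommGroup (V x)] [∀ x, InnerProductSpace ℝ (V x)]
  [FiberBundle F V] [VectorBundle ℝ F V] [ContMDiffVectorBundle ∞ F V (𝓡 n)]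
  [IsContMDiffRiemannianBundle (𝓡 n) ∞ F V]
  {nabla : CovariantDerivative (𝓡 n) F V}
  [CovariantDerivative.ContMDiffCovariantDerivative nabla ∞]

variable (nabla) in
/-- The weak form of `∇*∇σ = lam |∇σ|² σ`, tested on `v`. -/
def weakForm (lam : ℝ) (σ v : Π x : M, V x) : ℝ :=
  ∫ x, (nablaInner nabla σ v x - lam * (nablaInner nabla σ σ x * inner ℝ (σ x) (v x)))
    ∂(riemannianVolume n M)

variable (n F) in
/-- `v` is a smooth section vanishing outside the compact set `K`. -/
structure IsTestSection (K : Set M) (v : Π x : M, V x) : Prop where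
  isCompact : IsCompact K
  smooth : IsSmoothSection n F v
  eq_zero : ∀ x ∉ K, v x = 0

variable {σ v : Π x : M, V x} {K : Set M} {k : ℝ}

omit [T2Space M] [SecondCountableTopology M] [MeasurableSpace M] [BorelSpace M]
  [RiemannianBundle (fun x : M ↦ TangentSpace (𝓡 n) x)]
  [IsContMDiffRiemannianBundle (𝓡 n) ∞ (𝔼 n) (fun x : M ↦ TangentSpace (𝓡 n) x)]
  [FiniteDimensional ℝ F] [VectorBundle ℝ F V] [ContMDiffVectorBundle ∞ F V (𝓡 n)]
  [IsContMDiffRiemannianBundle (𝓡 n) ∞ F V] in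
lemma IsSmoothVariation.isFamilyAt {D : Set M} {s : ℝ → Π x : M, V x}
    (hs : IsSmoothVariation n F D σ s) (x : M) (t : ℝ) : IsFamilyAt n F ∞ s x t :=
  hs.smooth (x, t)

lemma IsSmoothVariation.isTestSection_velocity {D : Set M} {s : ℝ → Π x : M, V x}
    (hD : IsCompact D) (hs : IsSmoothVariation n F D σ s) : IsTestSection n F D (velocity s 0) where
  isCompact := hD
  smooth := fun x ↦ (hs.isFamilyAt x 0).velocity_family.section
  eq_zero := fun x hx ↦ by
    have : (fun t ↦ s t x) = fun _ ↦ σ x := funext fun t ↦ hs.eq_of_notMem t x hx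
    rw [velocity, this, deriv_const]

/-- The first variation formula for the `(p,q)`-energy at a section of constant length. -/
lemma IsSmoothVariation.hasDerivAt_verticalEnergy (hnabla : nabla.IsMetricCompatible)
    (hσ : IsSmoothSection n F σ) (hσk : ∀ x, ‖σ x‖ = k) (p q : ℝ) {D : Set M}
    {s : ℝ → Π x : M, V x} (hD : IsCompact D) (hs : IsSmoothVariation n F D σ s) :
    HasDerivAt (fun t ↦ verticalEnergy nabla p q D (s t))
      ((1 / (1 + k ^ 2)) ^ p * weakForm nabla (p / (1 + k ^ 2)) σ (velocity s 0)) 0 := by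
  refine (HarmonicSections.hasDerivAt_verticalEnergy nabla p q hD hs.isFamilyAt 0).congr_deriv ?_
  have hv := hs.isTestSection_velocity hD
  rw [hs.zero]
  simp only [fun x ↦ energyVariation_eq_of_norm_eq nabla p q (v := velocity s 0) (hσk x)
    (inner_nabla_self_eq_zero hnabla hσ hσk x)]
  rw [integral_const_mul, integral_const_mul, setIntegral_eq_integral_of_forall_compl_eq_zero, weakForm]
  · ring
  · intro x hx
    rw [nablaInner_eq_zero_of_notMem nabla σ hv.smooth hD.isClosed hv.eq_zero hx, hv.eq_zero x hx,
      inner_zero_right]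
    ring

/-- The variation `σ + t v`. -/
lemma IsTestSection.isSmoothVariation_add_smul (hσ : IsSmoothSection n F σ)
    (hv : IsTestSection n F K v) : IsSmoothVariation n F K σ fun t x ↦ σ x + t • v x where
  smooth := fun z ↦ (IsFamilyAt.of_section (t := z.2) (hσ z.1)).add
    (IsFamilyAt.smul (f := fun z : M × ℝ ↦ z.2) contMDiffAt_snd
      (IsFamilyAt.of_section (t := z.2) (hv.smooth z.1)))
  zero := by simp
  eq_of_notMem := fun t x hx ↦ by simp [hv.eq_zero x hx]

/-- Every test section is the velocity of `σ + t v`, every velocity is a test section, and the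
weight in front of `weakForm` is positive. -/
lemma isPQHarmonicSection_iff_weakForm (hnabla : nabla.IsMetricCompatible)
    (hσ : IsSmoothSection n F σ) (hσk : ∀ x, ‖σ x‖ = k) (p q : ℝ) :
    IsPQHarmonicSection nabla p q σ ↔
      ∀ K v, IsTestSection n F K v → weakForm nabla (p / (1 + k ^ 2)) σ v = 0 := by
  constructor
  · rintro ⟨-, -, h⟩ K v hv
    have hs := hv.isSmoothVariation_add_smul hσ
    have h1 := (hs.hasDerivAt_verticalEnergy hnabla hσ hσk p q hv.isCompact).unique
      (h K _ hv.isCompact hs fun _ ↦ mem_univ _)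
    have h2 : velocity (fun t x ↦ σ x + t • v x) 0 = v := by
      ext x
      have : HasDerivAt (fun t : ℝ ↦ σ x + t • v x) (v x) 0 := by
        simpa using ((hasDerivAt_id (0 : ℝ)).smul_const (v x)).const_add (σ x)
      exact this.deriv
    rw [h2] at h1
    exact (mul_eq_zero.1 h1).resolve_left (by positivity)
  · intro h
    refine ⟨hσ, mem_univ _, fun D s hD hs _ ↦ ?_⟩
    have h1 := hs.hasDerivAt_verticalEnergy hnabla hσ hσk p q hD
    rwa [h _ _ (hs.isTestSection_velocity hD), mul_zero] at h1

/-- The variation `k (σ + t v) / |σ + t v|` through sections of constant length. -/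
lemma IsTestSection.isSmoothVariation_normalized (hσ : IsSmoothSection n F σ) (hk : 0 < k)
    (hv : IsTestSection n F K v) :
    IsSmoothVariation n F K σ
      fun t x ↦ (k / Real.sqrt (k ^ 2 + t ^ 2 * inner ℝ (v x) (v x))) • (σ x + t • v x) where
  smooth := fun z ↦ by
    have hpos : 0 < k ^ 2 + z.2 ^ 2 * inner ℝ (v z.1) (v z.1) := by
      have := real_inner_self_nonneg (x := v z.1)
      positivity
    have h1 : ContMDiffAt ((𝓡 n).prod 𝓘(ℝ, ℝ)) 𝓘(ℝ, ℝ) ∞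
        (fun z : M × ℝ ↦ k ^ 2 + z.2 ^ 2 * inner ℝ (v z.1) (v z.1)) z :=
      contMDiffAt_const.add ((contMDiffAt_snd.pow 2).mul
        ((IsFamilyAt.of_section (t := z.2) (hv.smooth z.1)).inner_family
          (IsFamilyAt.of_section (t := z.2) (hv.smooth z.1))))
    have h2 := (Real.contDiffAt_sqrt (n := ∞) hpos.ne').contMDiffAt.comp z h1
    exact IsFamilyAt.smul (f := fun z : M × ℝ ↦ k / Real.sqrt (k ^ 2 + z.2 ^ 2 * inner ℝ (v z.1) (v z.1)))
      (contMDiffAt_const.div₀ h2 (Real.sqrt_pos.2 hpos).ne')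
      ((hv.isSmoothVariation_add_smul hσ).isFamilyAt z.1 z.2)
  zero := by
    ext x
    simp [Real.sqrt_sq hk.le, hk.ne']
  eq_of_notMem := fun t x hx ↦ by
    simp [hv.eq_zero x hx, Real.sqrt_sq hk.le, hk.ne']

/-- Differentiating `|s t x|² = k²` makes velocities orthogonal to `σ`; conversely an orthogonal `v`
is the velocity of the normalised variation. The constant is `0` because `p = 0`. -/
lemma isHarmonicSphereSection_iff_orthogonal (hnabla : nabla.IsMetricCompatible)
    (hσ : IsSmoothSection n F σ) (hk : 0 < k) (hσk : ∀ x, ‖σ x‖ = k) :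
    IsHarmonicSphereSection nabla k σ ↔
      ∀ K v, IsTestSection n F K v → (∀ x, inner ℝ (σ x) (v x) = (0 : ℝ)) →
        weakForm nabla 0 σ v = 0 := by
  constructor
  · rintro ⟨-, -, h⟩ K v hv hperp
    have hs := hv.isSmoothVariation_normalized hσ hk
    have h1 := (hs.hasDerivAt_verticalEnergy hnabla hσ hσk 0 0 hv.isCompact).unique
      (h K _ hv.isCompact hs fun t x ↦ norm_normalized hk (hσk x) (hperp x) t)
    have h2 : velocity (fun t x ↦ (k / Real.sqrt (k ^ 2 + t ^ 2 * inner ℝ (v x) (v x))) •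
        (σ x + t • v x)) 0 = v :=
      funext fun x ↦ (hasDerivAt_normalized (σ x) (v x) hk).deriv
    rwa [h2, Real.rpow_zero, one_mul, zero_div] at h1
  · intro h
    refine ⟨hσ, hσk, fun D s hD hs hsk ↦ ?_⟩
    have h1 := hs.hasDerivAt_verticalEnergy hnabla hσ hσk 0 0 hD
    rwa [zero_div, h _ _ (hs.isTestSection_velocity hD), mul_zero] at h1
    intro x
    have h2 := (IsFamilyAt.hasDerivAt (ContMDiffAt.of_le (hs.isFamilyAt x 0)
      (by norm_num : (1 : ℕ∞ω) ≤ ∞))).norm_sq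
    have h3 : (fun t ↦ ‖s t x‖ ^ 2) = fun _ ↦ k ^ 2 := funext fun t ↦ by rw [hsk t x]
    rw [h3, hs.zero] at h2
    have := h2.unique (hasDerivAt_const _ _)
    linarith

end FirstVariation

/-! ### From the weak equation to the three characterisations. -/

section Equivalences

variable {n : ℕ} {M : Type*} [TopologicalSpace M] [T2Space M] [SecondCountableTopology M]
  [ChartedSpace (𝔼 n) M] [IsManifold (𝓡 n) ∞ M]
  [MeasurableSpace M] [BorelSpace M]
  [RiemannianBundle (fun x : M ↦ TangentSpace (𝓡 n) x)]
  [IsContMDiffRiemannianBundle (𝓡 n) ∞ (𝔼 n) (fun x : M ↦ TangentSpace (𝓡 n) x)]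
  {F : Type*} [NormedAddCommGroup F] [NormedSpace ℝ F] [FiniteDimensional ℝ F]
  {V : M → Type*} [TopologicalSpace (TotalSpace F V)]
  [∀ x, NormedAddCommGroup (V x)] [∀ x, InnerProductSpace ℝ (V x)]
  [FiberBundle F V] [VectorBundle ℝ F V] [ContMDiffVectorBundle ∞ F V (𝓡 n)]
  [IsContMDiffRiemannianBundle (𝓡 n) ∞ F V]
  {nabla : CovariantDerivative (𝓡 n) F V}
  [CovariantDerivative.ContMDiffCovariantDerivative nabla ∞]
  {σ v : Π x : M, V x} {K : Set M} {k : ℝ}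

/-- The Leibniz term `df ⊗ σ` is orthogonal to `∇σ`. -/
lemma nablaInner_smul_self (hnabla : nabla.IsMetricCompatible)
    (hσ : IsSmoothSection n F σ) (hσk : ∀ x, ‖σ x‖ = k) {f : M → ℝ}
    (hf : ContMDiff (𝓡 n) 𝓘(ℝ, ℝ) ∞ f) (x : M) :
    nablaInner nabla σ (fun y ↦ f y • σ y) x = f x * nablaInner nabla σ σ x := by
  have h : nabla (fun y ↦ f y • σ y) x = f x • nabla σ x + (mvfderiv (𝓡 n) f x).smulRight (σ x) := by
    simpa using nabla_sum_smul (x := x) nabla (Finset.univ : Finset Unit) (f := fun _ ↦ f)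
      (S := fun _ ↦ σ) (fun _ _ ↦ hf.contMDiffAt.mdifferentiableAt (by simp))
      (fun _ _ ↦ hσ.contMDiffAt.mdifferentiableAt (by simp))
  simp only [nablaInner, h, add_apply, smul_apply, ContinuousLinearMap.smulRight_apply,
    inner_add_right, real_inner_smul_right, inner_nabla_self_eq_zero hnabla hσ hσk, mul_zero, add_zero,
    Finset.mul_sum]

lemma isHarmonicSphereSection_iff_weakForm (hnabla : nabla.IsMetricCompatible)
    (hσ : IsSmoothSection n F σ) (hk : 0 < k) (hσk : ∀ x, ‖σ x‖ = k) :
    IsHarmonicSphereSection nabla k σ ↔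
      ∀ K v, IsTestSection n F K v → weakForm nabla (1 / k ^ 2) σ v = 0 := by
  rw [isHarmonicSphereSection_iff_orthogonal hnabla hσ hk hσk]
  constructor
  · intro h K v hv
    have hf : ContMDiff (𝓡 n) 𝓘(ℝ, ℝ) ∞ fun x ↦ -(1 / k ^ 2 * inner ℝ (σ x) (v x)) := fun x ↦
      (contMDiffAt_const.mul (ContMDiffAt.inner_bundle (hσ x) (hv.smooth x))).neg
    have hfσ : IsSmoothSection n F fun x ↦ (-(1 / k ^ 2 * inner ℝ (σ x) (v x))) • σ x :=
      fun x ↦ (hf x).smul_section (hσ x)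
    -- The projection of `v` orthogonal to `σ`. The part removed, a multiple of `σ`, is what
    -- produces the constant `1 / k ^ 2`.
    have hw : IsTestSection n F K fun x ↦ v x + (-(1 / k ^ 2 * inner ℝ (σ x) (v x))) • σ x :=
      ⟨hv.isCompact, fun x ↦ (hv.smooth x).add_section (hfσ x), fun x hx ↦ by simp [hv.eq_zero x hx]⟩
    have h1 := h K _ hw fun x ↦ by
      rw [inner_add_right, real_inner_smul_right, real_inner_self_eq_norm_sq, hσk]
      field_simp
      ring
    rw [← h1, weakForm, weakForm]
    congr 1
    ext x
    rw [nablaInner_add σ hv.smooth hfσ, nablaInner_smul_self hnabla hσ hσk hf]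
    ring
  · intro h K v hv hperp
    rw [← h K v hv]
    simp [weakForm, hperp]

lemma isParallel_of_normSqNabla_eq_zero (h : ∀ x, nablaInner nabla σ σ x = 0) :
    IsParallel nabla σ := by
  intro x
  have h1 := h x
  rw [nablaInner, Finset.sum_eq_zero_iff_of_nonneg fun _ _ ↦ real_inner_self_nonneg] at h1
  refine ContinuousLinearMap.coe_injective ((tangentBasis x).toBasis.ext fun i ↦ ?_)
  simpa using h1 i (Finset.mem_univ i)

lemma forall_weakForm_eq_zero_iff_isParallel (hnabla : nabla.IsMetricCompatible)
    (hσ : IsSmoothSection n F σ) (hσk : ∀ x, ‖σ x‖ = k) {lam : ℝ} (hlam : lam * k ^ 2 ≠ 1) :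
    (∀ K v, IsTestSection n F K v → weakForm nabla lam σ v = 0) ↔ IsParallel nabla σ := by
  constructor
  · intro h
    refine isParallel_of_normSqNabla_eq_zero fun x₀ ↦ ?_
    have h1 : (1 - lam * k ^ 2) * nablaInner nabla σ σ x₀ = 0 := by
      refine eq_zero_of_forall_bump (n := n) (riemannianVolume n M)
        (g := fun x ↦ (1 - lam * k ^ 2) * nablaInner nabla σ σ x) univ_mem
        (fun x _ ↦ continuousAt_const.mul (continuousAt_nablaInner nabla hσ hσ x)) fun χ _ ↦ ?_
      -- Testing radially, with `χ σ`, isolates `(1 - lam k²) |∇σ|²`.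
      have hχ : IsTestSection n F (tsupport χ) fun x ↦ χ x • σ x :=
        ⟨χ.hasCompactSupport, fun x ↦ (χ.contMDiff x).smul_section (hσ x), fun x hx ↦ by
          rw [image_eq_zero_of_notMem_tsupport hx, zero_smul]⟩
      rw [← h _ _ hχ, weakForm]
      congr 1
      ext x
      rw [nablaInner_smul_self hnabla hσ hσk χ.contMDiff, real_inner_smul_right,
        real_inner_self_eq_norm_sq, hσk]
      ring
    exact (mul_eq_zero.1 h1).resolve_left (sub_ne_zero.2 hlam.symm)
  · intro h K v _
    simp [weakForm, nablaInner, h _]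

/-- Integration by parts makes `weakForm` the `L²` pairing of `v` with `∇*∇σ - lam |∇σ|² σ`; this
section is smooth, so the fundamental lemma applies to it. -/
lemma forall_weakForm_eq_zero_iff_roughLaplacian (hnabla : nabla.IsMetricCompatible)
    (hσ : IsSmoothSection n F σ) (lam : ℝ) :
    (∀ K v, IsTestSection n F K v → weakForm nabla lam σ v = 0) ↔
      ∀ x, roughLaplacian nabla σ x = (lam * normSqNabla nabla σ x) • σ x := by
  have hL := isSmoothSection_roughLaplacian hnabla hσ
  have hN : IsSmoothSection n F fun x ↦ (lam * nablaInner nabla σ σ x) • σ x := fun x ↦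
    ContMDiffAt.smul_section (contMDiffAt_const.mul (ContMDiffAt.comp (I' := (𝓡 n).prod 𝓘(ℝ, ℝ))
      (g := fun z : M × ℝ ↦ nablaInner nabla σ σ z.1) (f := fun y : M ↦ (y, (0 : ℝ))) x
      (contMDiffAt_nablaInner nabla (IsFamilyAt.of_section (hσ x)) (IsFamilyAt.of_section (hσ x)))
      (contMDiffAt_id.prodMk contMDiffAt_const))) (hσ x)
  have key : ∀ K v, IsTestSection n F K v → weakForm nabla lam σ v =
      ∫ x, inner ℝ (roughLaplacian nabla σ x - (lam * nablaInner nabla σ σ x) • σ x) (v x)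
        ∂(riemannianVolume n M) := fun K v hv ↦ by
    simp only [inner_sub_left]
    rw [integral_sub (integrable_inner hv.isCompact (fun x _ ↦ hL x) hv.smooth hv.eq_zero)
      (integrable_inner hv.isCompact (fun x _ ↦ hN x) hv.smooth hv.eq_zero),
      ← integral_nablaInner_eq_roughLaplacian hnabla hσ hv.smooth hv.isCompact hv.eq_zero,
      ← integral_sub (integrable_nablaInner hσ hv.smooth hv.isCompact hv.eq_zero)
      (integrable_inner hv.isCompact (fun x _ ↦ hN x) hv.smooth hv.eq_zero), weakForm]
    simp only [real_inner_smul_left, mul_assoc]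
  constructor
  · intro h x
    rw [normSqNabla_eq_nablaInner, ← sub_eq_zero]
    exact eq_zero_of_forall_bump_smul
      (A := fun x ↦ roughLaplacian nabla σ x - (lam * nablaInner nabla σ σ x) • σ x) univ_mem
      (fun y _ ↦ (hL y).sub_section (hN y)) fun v K hK _ hv h0 ↦ by
        rw [← key K v ⟨hK, hv, h0⟩, h K v ⟨hK, hv, h0⟩]
  · intro h K v hv
    rw [key K v hv]
    simp only [h, normSqNabla_eq_nablaInner, sub_self, inner_zero_left, integral_zero]

end Equivalences

end HarmonicSections

end

theorem theoremA {n : ℕ}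
    {M : Type*} [TopologicalSpace M] [T2Space M] [SecondCountableTopology M]
    [ChartedSpace (EuclideanSpace ℝ (Fin n)) M] [IsManifold (𝓡 n) ∞ M]
    [MeasurableSpace M] [BorelSpace M]
    [RiemannianBundle (fun x : M ↦ TangentSpace (𝓡 n) x)]
    [IsContMDiffRiemannianBundle (𝓡 n) ∞ (EuclideanSpace ℝ (Fin n))
      (fun x : M ↦ TangentSpace (𝓡 n) x)]
    {F : Type*} [NormedAddCommGroup F] [NormedSpace ℝ F] [FiniteDimensional ℝ F]
    {V : M → Type*} [TopologicalSpace (TotalSpace F V)]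
    [∀ x, NormedAddCommGroup (V x)] [∀ x, InnerProductSpace ℝ (V x)]
    [FiberBundle F V] [VectorBundle ℝ F V] [ContMDiffVectorBundle ∞ F V (𝓡 n)]
    [IsContMDiffRiemannianBundle (𝓡 n) ∞ F V]
    (nabla : CovariantDerivative (𝓡 n) F V)
    [CovariantDerivative.ContMDiffCovariantDerivative nabla ∞]
    (hnabla : nabla.IsMetricCompatible)
    (p q k : ℝ) (hk : 0 < k)
    (σ : Π x : M, V x) (hσ : HarmonicSections.IsSmoothSection n F σ) (hσk : ∀ x, ‖σ x‖ = k) :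
    (p ≠ 1 + 1 / k ^ 2 →
      (HarmonicSections.IsPQHarmonicSection nabla p q σ ↔ HarmonicSections.IsParallel nabla σ)) ∧
    (p = 1 + 1 / k ^ 2 →
      (HarmonicSections.IsPQHarmonicSection nabla p q σ ↔
        HarmonicSections.IsHarmonicSphereSection nabla k σ)) ∧
    (HarmonicSections.IsHarmonicSphereSection nabla k σ ↔
      ∀ x, HarmonicSections.roughLaplacian nabla σ x =
        (1 / k ^ 2 * HarmonicSections.normSqNabla nabla σ x) • σ x) := by
  have hk1 : 0 < 1 + k ^ 2 := by positivity
  refine ⟨fun hp ↦ ?_, fun hp ↦ ?_, ?_⟩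
  · rw [HarmonicSections.isPQHarmonicSection_iff_weakForm hnabla hσ hσk]
    -- The excluded case `p / (1 + k²) * k² = 1` is `p = 1 + 1 / k²`.
    refine HarmonicSections.forall_weakForm_eq_zero_iff_isParallel hnabla hσ hσk fun h ↦ hp ?_
    field_simp at h ⊢
    linarith
  · rw [HarmonicSections.isPQHarmonicSection_iff_weakForm hnabla hσ hσk,
      HarmonicSections.isHarmonicSphereSection_iff_weakForm hnabla hσ hk hσk]
    have h : p / (1 + k ^ 2) = 1 / k ^ 2 := by
      rw [hp]
      field_simp
      ring
    rw [h]
  · rw [HarmonicSections.isHarmonicSphereSection_iff_weakForm hnabla hσ hk hσk]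
    exact HarmonicSections.forall_weakForm_eq_zero_iff_roughLaplacian hnabla hσ (1 / k ^ 2)
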